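/- Let $z=(z_1,\dots,z_k)$. A *potential* is a polynomial $V\in\mathbb C[z]$ that is quasi-homogeneous of weight $2$ for some rational weights $|z_i|>0$, lies in $\langle z_1,\dots,z_k\rangle^2$, and has finite-dimensional Jacobi ring $\mathbb C[z]/\langle\partial_{z_1}V,\dots,\partial_{z_k}V\rangle$; its central charge is $\hat c=\sum_i(1-|z_i|)$. For potentials $V_1(x)$, $x=(x_1,\dots,x_n)$, and $V_2(y)$, $y=(y_1,\dots,y_m)$, a *graded matrix factorisation of rank $N$* of $V_1(x)-V_2(y)$ is a matrix $Q=\begin{pmatrix}0&E\\J&0\end{pmatrix}$ with $E,J\in M_N(\mathbb C[x,y])$, without non-zero constant entries, such that $EJ=JE=(V_1-V_2)\mathbf 1_N$ and such that for some rational $g_1,\dots,g_{2N}$ every entry $Q_{rs}$ is quasi-homogeneous of weight $g_s-g_r+1$. Its quantum dimensions are $$q_L(Q)=(-1)^{\binom{m+1}2}\,\mathrm{res}_x\Big[\frac{\mathrm{str}(\partial_{x_1}Q\cdots\partial_{x_n}Q\,\partial_{y_1}Q\cdots\partial_{y_m}Q)}{\partial_{x_1}V_1\cdots\partial_{x_n}V_1}\Big],\qquad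 q_R(Q)=(-1)^{\binom{n+1}2}\,\mathrm{res}_y\Big[\frac{\mathrm{str}(\partial_{x_1}Q\cdots\partial_{x_n}Q\,\partial_{y_1}Q\cdots\partial_{y_m}Q)}{\partial_{y_1}V_2\cdots\partial_{y_m}V_2}\Big],$$ where $\mathrm{str}(A)=\mathrm{tr}(\mathrm{diag}(\mathbf 1_N,-\mathbf 1_N)A)$ and $\mathrm{res}$ is the Grothendieck residue, so that $q_L(Q)\in\mathbb C[y]$ and $q_R(Q)\in\mathbb C[x]$. The potentials $V_1$ and $V_2$ are *orbifold equivalent* if some graded matrix factorisation $Q$ of $V_1(x)-V_2(y)$ has invertible quantum dimensions. **Theorem 4.1.** In each of the following cases $V_1(x)$ and $V_2(y)$ are potentials of central charge $\hat c$, and they are orbifold equivalent. More precisely, there is a graded matrix factorisation $Q$ of $V_1(x)-V_2(y)$ of rank $N$ whose quantum dimensions are non-zero complex numbers with $q_L(Q)\,q_R(Q)\neq\pm1$. 1. $V_1=x_1^6+x_2^2$, $V_2=y_1^3+y_2^3$ ($A_5$ and $A_2\times A_2$), with $\hat c=\tfrac23$, $N=2$; 2. $V_1=x_1^5x_2+x_2^3$,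 $V_2=y_1^3y_2+y_2^5$ ($E_{13}$ and $Z_{11}$), with $\hat c=\tfrac{16}{15}$, $N=3$; 3. $V_1=x_1^6+x_1x_2^3+x_3^2$, $V_2=y_2y_3^3+y_2^3+y_1^2y_3$ ($Z_{13}$ and $Q_{11}$), with $\hat c=\tfrac{10}9$, $N=6$; 4. $V_1=x_1^2x_3+x_2x_3^2+x_2^4$, $V_2=-y_1^2+y_2^4+y_2y_3^4$ ($S_{11}$ and $W_{13}$), with $\hat c=\tfrac98$, $N=4$; 5. $V_1=x_1^{10}x_2+x_2^3$, $V_2=y_1y_2^7+y_1^3y_2$ (a chain and a loop), with $\hat c=\tfrac65$, $N=3$. -/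

import Mathlib

open MvPolynomial

namespace LandauGinzburg

/-! ### Residues of polynomials in several variables -/

section Residue

variable {n : ℕ} {S : Type*} [CommRing S]

/-- Exponents `ν i + 1 ≥ 1` and a matrix `C` of polynomials with
`xᵢ ^ (νᵢ + 1) = ∑ⱼ Cᵢⱼ fⱼ` for all `i`. -/
def IsResidueDatum (f : Fin n → MvPolynomial (Fin n) S) (ν : Fin n →₀ ℕ)
    (C : Matrix (Fin n) (Fin n) (MvPolynomial (Fin n) S)) : Prop :=
  ∀ i, (X i : MvPolynomial (Fin n) S) ^ (ν i + 1) = ∑ j, C i j * f j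

open Classical in
/-- The (Grothendieck) residue `res_x [φ / (f₁ ⋯ fₙ)]` of a polynomial `φ` in the variables
`x₁, …, xₙ` over a ring `S` of parameters. For `xᵢ ^ (νᵢ + 1) = ∑ⱼ Cᵢⱼ fⱼ` the transformation law
gives `res [φ / (f₁ ⋯ fₙ)] = res [det C · φ / ∏ᵢ xᵢ ^ (νᵢ + 1)]`, and the latter is the coefficient
of `∏ᵢ xᵢ ^ νᵢ` in `det C · φ`. The value does not depend on the choice of `ν` and `C`, see
`residue_eq` below. (If no such `ν`, `C` exist the residue is undefined; the value is then `0`.) -/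
noncomputable def residue (f : Fin n → MvPolynomial (Fin n) S) (φ : MvPolynomial (Fin n) S) : S :=
  if h : ∃ p : (Fin n →₀ ℕ) × Matrix (Fin n) (Fin n) (MvPolynomial (Fin n) S),
      IsResidueDatum f p.1 p.2 then
    coeff h.choose.1 (h.choose.2.det * φ)
  else 0

theorem IsResidueDatum.coeff_updateRow {f : Fin n → MvPolynomial (Fin n) S} {ν : Fin n →₀ ℕ}
    {C : Matrix (Fin n) (Fin n) (MvPolynomial (Fin n) S)} (h : IsResidueDatum f ν C) (i : Fin n)
    (v : Fin n → MvPolynomial (Fin n) S) (hv : X i ^ (ν i + 1) = ∑ j, v j * f j)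
    (φ : MvPolynomial (Fin n) S) :
    coeff ν ((C.updateRow i v).det * φ) = coeff ν (C.det * φ) := by
  set M := C.updateRow i (v - C i) with hM
  have h1 : (C.updateRow i v).det = M.det + C.det := by
    have h2 := Matrix.det_updateRow_add C i (v - C i) (C i)
    rw [sub_add_cancel, Matrix.updateRow_eq_self] at h2
    exact h2
  have hMf : ∀ k, (M.mulVec f) k = if k = i then 0 else X k ^ (ν k + 1) := by
    intro k
    by_cases hk : k = i
    · subst hk
      simp only [Matrix.mulVec, dotProduct, hM, Matrix.updateRow_self, Pi.sub_apply, sub_mul,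
        Finset.sum_sub_distrib, if_true]
      rw [← hv, ← h k, sub_self]
    · simp only [Matrix.mulVec, dotProduct, hM, if_neg hk, Matrix.updateRow_ne hk]
      exact (h k).symm
  have h3 : ∀ j, M.det * f j = ∑ k, M.adjugate j k * (if k = i then 0 else X k ^ (ν k + 1)) := by
    intro j
    have h4 : (M.adjugate * M).mulVec f = M.det • f := by
      rw [Matrix.adjugate_mul, Matrix.smul_mulVec, Matrix.one_mulVec]
    rw [← Matrix.mulVec_mulVec] at h4
    have h5 := congrFun h4 j
    simp only [Pi.smul_apply, smul_eq_mul] at h5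
    rw [← h5]
    simp only [Matrix.mulVec, dotProduct]
    refine Finset.sum_congr rfl fun k _ => ?_
    rw [← hMf k]
    rfl
  have h6 : coeff ν (M.det * φ) = 0 := by
    have h7 : coeff (ν + Finsupp.single i (ν i + 1)) ((M.det * φ) * X i ^ (ν i + 1)) = 0 := by
      have h8 : (M.det * φ) * X i ^ (ν i + 1) = ∑ j, ∑ k, (C i j * φ * M.adjugate j k) *
          (if k = i then 0 else X k ^ (ν k + 1)) := by
        rw [h i, Finset.mul_sum]
        refine Finset.sum_congr rfl fun j _ => ?_
        rw [show M.det * φ * (C i j * f j) = C i j * φ * (M.det * f j) by ring, h3 j,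
          Finset.mul_sum]
        refine Finset.sum_congr rfl fun k _ => ?_
        ring
      rw [h8, coeff_sum]
      refine Finset.sum_eq_zero fun j _ => ?_
      rw [coeff_sum]
      refine Finset.sum_eq_zero fun k _ => ?_
      by_cases hk : k = i
      · simp [hk]
      · rw [if_neg hk, X_pow_eq_monomial, coeff_mul_monomial', if_neg]
        intro hle
        have := hle k
        simp [Ne.symm hk] at this
    rw [X_pow_eq_monomial, coeff_mul_monomial, mul_one] at h7
    exact h7
  rw [h1, add_mul, coeff_add, h6, zero_add]

theorem IsResidueDatum.coeff_eq_of_same {f : Fin n → MvPolynomial (Fin n) S} {ν : Fin n →₀ ℕ}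
    {C C' : Matrix (Fin n) (Fin n) (MvPolynomial (Fin n) S)} (h : IsResidueDatum f ν C)
    (h' : IsResidueDatum f ν C') (φ : MvPolynomial (Fin n) S) :
    coeff ν (C'.det * φ) = coeff ν (C.det * φ) := by
  have key : ∀ s : Finset (Fin n), ∃ D : Matrix (Fin n) (Fin n) (MvPolynomial (Fin n) S),
      (∀ i ∈ s, D i = C' i) ∧ IsResidueDatum f ν D ∧
        coeff ν (D.det * φ) = coeff ν (C.det * φ) := by
    intro s
    induction s using Finset.induction_on with
    | empty => exact ⟨C, by simp, h, rfl⟩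
    | insert a s ha ih =>
      obtain ⟨D, hD1, hD2, hD3⟩ := ih
      refine ⟨D.updateRow a (C' a), ?_, ?_, ?_⟩
      · intro i hi
        by_cases hia : i = a
        · subst hia
          exact Matrix.updateRow_self
        · rw [Matrix.updateRow_ne hia]
          exact hD1 i ((Finset.mem_insert.mp hi).resolve_left hia)
      · intro i
        by_cases hia : i = a
        · subst hia
          rw [Matrix.updateRow_self]
          exact h' i
        · rw [Matrix.updateRow_ne hia]
          exact hD2 i
      · rw [hD2.coeff_updateRow a (C' a) (h' a) φ, hD3]
  obtain ⟨D, hD1, -, hD3⟩ := key Finset.univ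
  have : D = C' := funext fun i => hD1 i (Finset.mem_univ i)
  rw [← this, hD3]

theorem IsResidueDatum.shift {f : Fin n → MvPolynomial (Fin n) S} {ν : Fin n →₀ ℕ}
    {C : Matrix (Fin n) (Fin n) (MvPolynomial (Fin n) S)} (h : IsResidueDatum f ν C)
    (μ : Fin n →₀ ℕ) (φ : MvPolynomial (Fin n) S) :
    ∃ D, IsResidueDatum f (μ + ν) D ∧ coeff (μ + ν) (D.det * φ) = coeff ν (C.det * φ) := by
  refine ⟨Matrix.of fun i j => X i ^ μ i * C i j, ?_, ?_⟩
  · intro i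
    simp only [Matrix.of_apply, Finsupp.add_apply, mul_assoc, ← Finset.mul_sum]
    rw [← h i, add_assoc, pow_add]
  · rw [Matrix.det_mul_column, mul_assoc]
    have : (∏ i, (X i : MvPolynomial (Fin n) S) ^ μ i) = monomial μ 1 := by
      rw [monomial_eq, C_1, one_mul, Finsupp.prod_fintype]
      simp
    rw [this, coeff_monomial_mul, one_mul]

/-- The residue can be computed from any choice of `ν` and `C`. -/
theorem residue_eq {f : Fin n → MvPolynomial (Fin n) S} {ν : Fin n →₀ ℕ}
    {C : Matrix (Fin n) (Fin n) (MvPolynomial (Fin n) S)} (h : IsResidueDatum f ν C)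
    (φ : MvPolynomial (Fin n) S) : residue f φ = coeff ν (C.det * φ) := by
  have hex : ∃ p : (Fin n →₀ ℕ) × Matrix (Fin n) (Fin n) (MvPolynomial (Fin n) S),
      IsResidueDatum f p.1 p.2 := ⟨(ν, C), h⟩
  rw [residue, dif_pos hex]
  obtain ⟨D, hD, hD'⟩ := h.shift hex.choose.1 φ
  obtain ⟨D₂, hD₂, hD₂'⟩ := hex.choose_spec.shift ν φ
  rw [← hD', ← hD₂']
  rw [add_comm] at hD₂
  rw [add_comm ν]
  exact hD.coeff_eq_of_same hD₂ φ

end Residue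

/-! ### Potentials -/

/-- `V ∈ ℂ[x₁, …, xₙ]` is a potential with respect to the variable weights `|xᵢ| = w i`:
the weights are positive, `V` is quasi-homogeneous of weight `2`, it lies in the square of the
maximal ideal `⟨x₁, …, xₙ⟩`, and its Jacobi ring is finite-dimensional. -/
structure IsPotential {n : ℕ} (w : Fin n → ℚ) (V : MvPolynomial (Fin n) ℂ) : Prop where
  weight_pos : ∀ i, 0 < w i
  quasiHomogeneous : IsWeightedHomogeneous w V 2
  mem_sq : V ∈ (Ideal.span (Set.range (X : Fin n → MvPolynomial (Fin n) ℂ))) ^ 2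
  jacobi_finite : Module.Finite ℂ
    (MvPolynomial (Fin n) ℂ ⧸ Ideal.span (Set.range fun i => pderiv i V))

/-- The central charge `∑ᵢ (1 - |xᵢ|)`. -/
def centralCharge {n : ℕ} (w : Fin n → ℚ) : ℚ := ∑ i, (1 - w i)

/-! ### Matrix factorisations of `V₁(x) - V₂(y)` -/

section Defects

variable {n m N : ℕ}

/-- The ring `ℂ[x₁, …, xₙ, y₁, …, yₘ]`. -/
abbrev Poly (n m : ℕ) : Type := MvPolynomial (Fin n ⊕ Fin m) ℂ

/-- The matrix `Q = (0, E; J, 0)`. -/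
noncomputable def oddMatrix (E J : Matrix (Fin N) (Fin N) (Poly n m)) :
    Matrix (Fin N ⊕ Fin N) (Fin N ⊕ Fin N) (Poly n m) :=
  Matrix.fromBlocks 0 E J 0

/-- The supertrace `str A = tr (σ A)` with `σ = diag (1, -1)`. -/
noncomputable def supertrace (A : Matrix (Fin N ⊕ Fin N) (Fin N ⊕ Fin N) (Poly n m)) : Poly n m :=
  Matrix.trace (Matrix.fromBlocks 1 0 0 (-1) * A)

/-- `V₁(x) - V₂(y)` as a polynomial in all the variables. -/
noncomputable def difference (V₁ : MvPolynomial (Fin n) ℂ) (V₂ : MvPolynomial (Fin m) ℂ) :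
    Poly n m :=
  rename Sum.inl V₁ - rename Sum.inr V₂

/-- `(E, J)` is a graded rank `N` matrix factorisation of `V₁(x) - V₂(y)`, where `w₁` and `w₂` are
the weights of the variables `x` and `y`, and without non-zero constant entries. The grading
condition `U(λ) Q(λ ▹ z) U(λ)⁻¹ = λ Q(z)` with `U(λ) = diag (λ ^ g₁, …, λ ^ g₂ₙ)` says that the
entry `Q r s` is quasi-homogeneous of weight `g s - g r + 1`. -/
structure IsGradedFactorisation (w₁ : Fin n → ℚ) (w₂ : Fin m → ℚ)
    (V₁ : MvPolynomial (Fin n) ℂ) (V₂ : MvPolynomial (Fin m) ℂ)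
    (E J : Matrix (Fin N) (Fin N) (Poly n m)) : Prop where
  mul_EJ : E * J = Matrix.scalar (Fin N) (difference V₁ V₂)
  mul_JE : J * E = Matrix.scalar (Fin N) (difference V₁ V₂)
  graded : ∃ g : Fin N ⊕ Fin N → ℚ, ∀ r s,
    IsWeightedHomogeneous (Sum.elim w₁ w₂) (oddMatrix E J r s) (g s - g r + 1)
  constantCoeff_eq_zero : ∀ r s, constantCoeff (oddMatrix E J r s) = 0

/-- The polynomial `str (∂_{x₁} Q ⋯ ∂_{xₙ} Q · ∂_{y₁} Q ⋯ ∂_{yₘ} Q)`. -/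
noncomputable def strDeriv (E J : Matrix (Fin N) (Fin N) (Poly n m)) : Poly n m :=
  supertrace
    ((List.ofFn fun i : Fin n => (oddMatrix E J).map (pderiv (Sum.inl i))).prod *
      (List.ofFn fun j : Fin m => (oddMatrix E J).map (pderiv (Sum.inr j))).prod)

/-- The left quantum dimension, a polynomial in `y`: the residue in `x`, over the ring `ℂ[y]`, of
`str (∂_{x₁} Q ⋯ ∂_{yₘ} Q)` over `∂_{x₁} V₁ ⋯ ∂_{xₙ} V₁`, with the sign `(-1) ^ C(m + 1, 2)`. -/
noncomputable def leftQuantumDim (V₁ : MvPolynomial (Fin n) ℂ)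
    (E J : Matrix (Fin N) (Fin N) (Poly n m)) : MvPolynomial (Fin m) ℂ :=
  (-1) ^ (m + 1).choose 2 *
    residue (fun i => map (C : ℂ →+* MvPolynomial (Fin m) ℂ) (pderiv i V₁))
      (sumAlgEquiv ℂ (Fin n) (Fin m) (strDeriv E J))

/-- The right quantum dimension, a polynomial in `x`: the residue in `y`, over the ring `ℂ[x]`, of
`str (∂_{x₁} Q ⋯ ∂_{yₘ} Q)` over `∂_{y₁} V₂ ⋯ ∂_{yₘ} V₂`, with the sign `(-1) ^ C(n + 1, 2)`. -/
noncomputable def rightQuantumDim (V₂ : MvPolynomial (Fin m) ℂ)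
    (E J : Matrix (Fin N) (Fin N) (Poly n m)) : MvPolynomial (Fin n) ℂ :=
  (-1) ^ (n + 1).choose 2 *
    residue (fun j => map (C : ℂ →+* MvPolynomial (Fin n) ℂ) (pderiv j V₂))
      (sumAlgEquiv ℂ (Fin m) (Fin n) (rename Sum.swap (strDeriv E J)))

/-- `Q`, formed from `E` and `J`, is an orbifold equivalence between `V₁` and `V₂`. -/
structure IsOrbifoldEquivalence (w₁ : Fin n → ℚ) (w₂ : Fin m → ℚ)
    (V₁ : MvPolynomial (Fin n) ℂ) (V₂ : MvPolynomial (Fin m) ℂ)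
    (E J : Matrix (Fin N) (Fin N) (Poly n m)) : Prop where
  isGradedFactorisation : IsGradedFactorisation w₁ w₂ V₁ V₂ E J
  isUnit_left : IsUnit (leftQuantumDim V₁ E J)
  isUnit_right : IsUnit (rightQuantumDim V₂ E J)

end Defects

/-- The potentials `V₁` and `V₂` are orbifold equivalent. -/
def OrbifoldEquivalent {n m : ℕ} (V₁ : MvPolynomial (Fin n) ℂ) (V₂ : MvPolynomial (Fin m) ℂ) :
    Prop :=
  ∃ (w₁ : Fin n → ℚ) (w₂ : Fin m → ℚ), IsPotential w₁ V₁ ∧ IsPotential w₂ V₂ ∧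
    ∃ (N : ℕ) (E J : Matrix (Fin N) (Fin N) (Poly n m)), IsOrbifoldEquivalence w₁ w₂ V₁ V₂ E J

/-- `V₁` and `V₂` are potentials of central charge `c`, and there is an orbifold equivalence of
rank `N` between them whose quantum dimensions are non-zero complex numbers `qL`, `qR` with
`qL * qR ≠ ± 1`. -/
def HasTrueOrbifoldEquivalence {n m : ℕ} (N : ℕ) (c : ℚ) (V₁ : MvPolynomial (Fin n) ℂ)
    (V₂ : MvPolynomial (Fin m) ℂ) : Prop :=
  ∃ (w₁ : Fin n → ℚ) (w₂ : Fin m → ℚ), IsPotential w₁ V₁ ∧ IsPotential w₂ V₂ ∧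
    centralCharge w₁ = c ∧ centralCharge w₂ = c ∧
    ∃ E J : Matrix (Fin N) (Fin N) (Poly n m), IsOrbifoldEquivalence w₁ w₂ V₁ V₂ E J ∧
      ∃ qL qR : ℂ, leftQuantumDim V₁ E J = C qL ∧ rightQuantumDim V₂ E J = C qR ∧
        qL ≠ 0 ∧ qR ≠ 0 ∧ qL * qR ≠ 1 ∧ qL * qR ≠ -1

end LandauGinzburg

/-!
For each of the five pairs of potentials an explicit graded matrix factorisation is written down,
and its two quantum dimensions are computed.

*The factorisations.* Two constructions suffice. If a square matrix `A` has scalar square `a`, then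
`z + A` and `z - A` are a factorisation of `z ^ 2 - a` (`IsGradedFactorisation.of_sq`); this serves
the pairs in which one potential contains the square of a variable. Here `A` is a
`2 × 2` matrix for `A₅` and `A₂ × A₂`, a `4 × 4` Koszul matrix for `S₁₁` and `W₁₃`, and a `6 × 6`
matrix for `Z₁₃` and `Q₁₁`. If `E` is a `3 × 3` matrix with determinant `V₁ - V₂`, then `E` and
its adjugate are a factorisation (`IsGradedFactorisation.of_det`); this serves `E₁₃` and `Z₁₁`, and
the chain and the loop. The entries of the matrices contain algebraic numbers, the essential ones
being for `Z₁₃` a root of `u ^ 3 - 3 u + 1` and for `E₁₃` a root of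
`a ^ 8 - 150 a ^ 4 + 360 a ^ 2 + 45`. The polynomial identities behind the factorisations are first
proved over an arbitrary commutative ring whose elements satisfy
the necessary relations, and the rescalings of the variables that produce the exact potentials are
applied afterwards.

*The quantum dimensions.* The supertrace in the definition of `q_L` is quasi-homogeneous, of a
weight for which the residue is homogeneous of weight zero in the remaining variables `y`
(`IsGradedFactorisation.isWeightedHomogeneous_strDeriv`). As all weights are positive, the residue
is its own constant term, so that `y` may be set to zero before the supertrace is computed
(`coeff_sumAlgEquiv_eq_C`, `residue_map_C_eq_C`, `IsGradedFactorisation.leftQuantumDim_eq`).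
By the transformation law for residues, which is built into the definition, what remains is the
coefficient of one monomial in a polynomial of `ℂ[x]`, multiplied by the determinant of a matrix
expressing powers of the variables through the partial derivatives of the potential. The same
matrix shows that the Jacobi ring is finite-dimensional (`IsResidueDatum.finite_quotient`).

The products `q_L q_R` are `2` for `A₅` and for `S₁₁`, and `6` for the chain and the loop. For `Z₁₃`
and `E₁₃` they are `2 (3 - 10 u + 5 u ^ 2) / (2 - 6 u + 3 u ^ 2)` and `(15 + a ^ 2) / 4`; there the
values `0` and `±1` are excluded because the corresponding polynomials are prime to the equation of
the parameter.
-/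

namespace LandauGinzburg

/-! ### Quasi-homogeneous polynomials -/

section Weighted

variable {σ τ R : Type*} [CommRing R] {w : σ → ℚ}

theorem _root_.MvPolynomial.IsWeightedHomogeneous.of_eq {p : MvPolynomial σ R} {a b : ℚ}
    (h : IsWeightedHomogeneous w p a) (hab : a = b) : IsWeightedHomogeneous w p b :=
  hab ▸ h

theorem isWeightedHomogeneous_ofNat (k : ℕ) [k.AtLeastTwo] :
    IsWeightedHomogeneous w (OfNat.ofNat k : MvPolynomial σ R) (0 : ℚ) := by
  have h := isWeightedHomogeneous_C w (OfNat.ofNat k : R)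
  rwa [map_ofNat] at h

theorem _root_.MvPolynomial.IsWeightedHomogeneous.rename_comp {v : τ → ℚ} (f : σ → τ)
    {p : MvPolynomial σ R} {d : ℚ} (h : IsWeightedHomogeneous (v ∘ f) p d) : IsWeightedHomogeneous
      v (rename f p) d := by
  intro e he
  obtain ⟨u, hu, hc⟩ := coeff_rename_ne_zero f p e he
  rw [← hu, ← h hc, Finsupp.weight_apply, Finsupp.weight_apply,
    Finsupp.sum_mapDomain_index (by simp) (by simp [add_smul])]
  rfl

theorem _root_.MvPolynomial.IsWeightedHomogeneous.pderiv_of_eq {i : σ}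
    {p : MvPolynomial σ R} {d e : ℚ} (h : IsWeightedHomogeneous w p d) (he : d - w i = e) :
    IsWeightedHomogeneous w (pderiv i p) e :=
  h.pderiv (by linarith)

theorem _root_.MvPolynomial.IsWeightedHomogeneous.constantCoeff_eq_zero
    {p : MvPolynomial σ R} {d : ℚ} (h : IsWeightedHomogeneous w p d) (hd : d ≠ 0) : constantCoeff p
      = 0 := by
  by_contra hc
  exact hd (by simpa using (h hc).symm)

end Weighted

/-! ### Quasi-homogeneity of explicit expressions

These rules reduce the quasi-homogeneity of a polynomial expression of arbitrary degree to equations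
between rational numbers. In an iterated product the factors are split off from the right.
-/

section WeightRules

variable {σ R : Type*} [CommRing R] {w : σ → ℚ} {p q : MvPolynomial σ R} {a d : ℚ}

theorem isWeightedHomogeneous_X' {i : σ} (h : w i = d) :
    IsWeightedHomogeneous w (X i : MvPolynomial σ R) d :=
  (isWeightedHomogeneous_X R w i).of_eq h

theorem isWeightedHomogeneous_X_pow {i : σ} {k : ℕ} (h : k * w i = d) :
    IsWeightedHomogeneous w (X i ^ k : MvPolynomial σ R) d :=
  ((isWeightedHomogeneous_X R w i).pow k).of_eq (by simpa using h)

theorem isWeightedHomogeneous_C' {c : R} (h : d = 0) :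
    IsWeightedHomogeneous w (C c : MvPolynomial σ R) d :=
  (isWeightedHomogeneous_C w c).of_eq h.symm

theorem isWeightedHomogeneous_ofNat' {k : ℕ} [k.AtLeastTwo] (h : d = 0) :
    IsWeightedHomogeneous w (OfNat.ofNat k : MvPolynomial σ R) d :=
  (isWeightedHomogeneous_ofNat k).of_eq h.symm

theorem isWeightedHomogeneous_mul_X {i : σ} (h : IsWeightedHomogeneous w p (d - w i)) :
    IsWeightedHomogeneous w (p * X i) d :=
  (h.mul (isWeightedHomogeneous_X R w i)).of_eq (by ring)

theorem isWeightedHomogeneous_mul_X_pow {i : σ} {k : ℕ}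
    (h : IsWeightedHomogeneous w p (d - k * w i)) : IsWeightedHomogeneous w (p * X i ^ k) d :=
  (h.mul ((isWeightedHomogeneous_X R w i).pow k)).of_eq (by simp)

theorem isWeightedHomogeneous_mul_C {c : R} (h : IsWeightedHomogeneous w p d) :
    IsWeightedHomogeneous w (p * C c) d :=
  (h.mul (isWeightedHomogeneous_C w c)).of_eq (by ring)

theorem isWeightedHomogeneous_mul_C_pow {c : R} {k : ℕ} (h : IsWeightedHomogeneous w p d) :
    IsWeightedHomogeneous w (p * C c ^ k) d :=
  (h.mul ((isWeightedHomogeneous_C w c).pow k)).of_eq (by simp)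

theorem isWeightedHomogeneous_pow_of_eq (h : IsWeightedHomogeneous w p a) {k : ℕ}
    (hk : k * a = d) : IsWeightedHomogeneous w (p ^ k) d :=
  (h.pow k).of_eq (by simpa using hk)

theorem isWeightedHomogeneous_mul_right (h : IsWeightedHomogeneous w p a)
    (hq : IsWeightedHomogeneous w q (d - a)) : IsWeightedHomogeneous w (q * p) d :=
  (hq.mul h).of_eq (by ring)

theorem isWeightedHomogeneous_mul_pow (h : IsWeightedHomogeneous w p a) {k : ℕ}
    (hq : IsWeightedHomogeneous w q (d - k * a)) : IsWeightedHomogeneous w (q * p ^ k) d :=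
  (hq.mul (h.pow k)).of_eq (by simp)

end WeightRules

/-! ### Polynomials in two sets of variables -/

theorem coeff_coeff_sumAlgEquiv {n m : ℕ} (p : Poly n m) (ν : Fin n →₀ ℕ) (μ : Fin m →₀ ℕ) :
    coeff μ (coeff ν (sumAlgEquiv ℂ (Fin n) (Fin m) p)) = coeff (Finsupp.sumElim ν μ) p := by
  classical
  induction p using MvPolynomial.induction_on' with
  | add p q hp hq => simp only [map_add, coeff_add, hp, hq]
  | monomial e a =>
    have he : e = Finsupp.sumElim ν μ ↔
        Finsupp.comapDomain Sum.inl e Sum.inl_injective.injOn = ν ∧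
          Finsupp.comapDomain Sum.inr e Sum.inr_injective.injOn = μ := by
      constructor
      · rintro rfl
        constructor <;> ext i <;> simp
      · rintro ⟨rfl, rfl⟩
        ext (i | i) <;> simp
    simp only [sumAlgEquiv, coeff, monomial, AlgEquiv.trans_apply, AddMonoidAlgebra.lsingle_apply,
      AddMonoidAlgebra.domCongr_single, AddMonoidAlgebra.coeff_single, Finsupp.single_apply, he]
    by_cases h1 : Finsupp.comapDomain Sum.inl e Sum.inl_injective.injOn = ν
    · simp [h1, Finsupp.single_apply]
    · simp [h1]

theorem aeval_sumElim_X_zero {n m : ℕ} (p : Poly n m) :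
    aeval (Sum.elim X 0) p =
      MvPolynomial.map constantCoeff (sumAlgEquiv ℂ (Fin n) (Fin m) p) := by
  induction p using MvPolynomial.induction_on with
  | C a => simp [algebraMap_eq]
  | add p q hp hq => simp only [map_add, hp, hq]
  | mul_X p v hp =>
    rw [map_mul, map_mul, map_mul, hp]
    rcases v with v | v <;> simp

/-- A quasi-homogeneous polynomial of the variables `x` and `y` is viewed as a polynomial in `x`.
The coefficient of a monomial in `x` of the same weight is constant if all weights of the
variables `y` are positive, so it is found by setting `y = 0`. -/
theorem coeff_sumAlgEquiv_eq_C {n m : ℕ} {w₁ : Fin n → ℚ} {w₂ : Fin m → ℚ} (h₂ : ∀ j, 0 < w₂ j)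
    {p : Poly n m} {d : ℚ} (hp : IsWeightedHomogeneous (Sum.elim w₁ w₂) p d) {ν : Fin n →₀ ℕ}
    (hν : Finsupp.weight w₁ ν = d) :
    coeff ν (sumAlgEquiv ℂ (Fin n) (Fin m) p) = C (coeff ν (aeval (Sum.elim X 0) p)) := by
  rw [aeval_sumElim_X_zero, coeff_map]
  ext μ
  rw [coeff_C]
  split_ifs with hμ
  · rw [← hμ]; rfl
  · rw [coeff_coeff_sumAlgEquiv]
    apply hp.coeff_eq_zero
    intro h
    apply hμ
    -- A monomial of weight `d` whose `x`-part has weight `d` has a `y`-part of weight zero.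
    have h0 : Finsupp.weight w₂ μ = 0 := by
      have h1 : Finsupp.weight (Sum.elim w₁ w₂) (Finsupp.sumElim ν μ) =
          Finsupp.weight w₁ ν + Finsupp.weight w₂ μ := by
        simp [Finsupp.weight_apply, Finsupp.sum_fintype]
      linarith
    rw [Finsupp.weight_apply, Finsupp.sum_fintype _ _ (by simp), Finset.sum_eq_zero_iff_of_nonneg
      (fun j _ => smul_nonneg (Nat.zero_le _) (h₂ j).le)] at h0
    ext j
    have := h0 j (Finset.mem_univ j)
    have hj : μ j = 0 := by simpa [(h₂ j).ne'] using this
    simp [hj]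

/-! ### Potentials -/

/-- If a power of each variable lies in the ideal of the `fᵢ`, then the quotient is
finite-dimensional, because it is generated by finitely many nilpotent elements. -/
theorem IsResidueDatum.finite_quotient {n : ℕ} {f : Fin n → MvPolynomial (Fin n) ℂ}
    {ν : Fin n →₀ ℕ} {M : Matrix (Fin n) (Fin n) (MvPolynomial (Fin n) ℂ)}
    (h : IsResidueDatum f ν M) :
    Module.Finite ℂ (MvPolynomial (Fin n) ℂ ⧸ Ideal.span (Set.range f)) := by
  set I := Ideal.span (Set.range f)
  have hX : ∀ i, IsIntegral ℂ (Ideal.Quotient.mk I (X i)) := by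
    intro i
    have h0 : Ideal.Quotient.mk I (X i) ^ (ν i + 1) = 0 := by
      rw [← map_pow, Ideal.Quotient.eq_zero_iff_mem, h i]
      exact Ideal.sum_mem _ fun j _ =>
        Ideal.mul_mem_left _ _ (Ideal.subset_span (Set.mem_range_self j))
    exact IsIntegral.of_pow (Nat.succ_pos _) (h0 ▸ isIntegral_zero)
  have hint : Algebra.IsIntegral ℂ (MvPolynomial (Fin n) ℂ ⧸ I) := by
    refine ⟨fun a => ?_⟩
    obtain ⟨p, rfl⟩ := Ideal.Quotient.mk_surjective a
    induction p using MvPolynomial.induction_on with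
    | C a => exact isIntegral_algebraMap (R := ℂ) (x := a)
    | add p q hp hq => rw [map_add]; exact hp.add hq
    | mul_X p i hp => rw [map_mul]; exact hp.mul (hX i)
  exact Algebra.finite_iff_isIntegral_and_finiteType.mpr ⟨hint, inferInstance⟩

theorem X_mul_X_mul_mem_sq {n : ℕ} (i j : Fin n) (p : MvPolynomial (Fin n) ℂ) :
    X i * X j * p ∈ Ideal.span (Set.range (X : Fin n → MvPolynomial (Fin n) ℂ)) ^ 2 := by
  rw [sq]
  exact Ideal.mul_mem_right _ _ (Ideal.mul_mem_mul (Ideal.subset_span (Set.mem_range_self i))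
    (Ideal.subset_span (Set.mem_range_self j)))

/-! ### The polynomial `strDeriv` of a graded factorisation -/

section Factorisation

variable {n m N : ℕ} {w₁ : Fin n → ℚ} {w₂ : Fin m → ℚ}

theorem isWeightedHomogeneous_prod_ofFn {σ ι : Type*} [Fintype ι] [DecidableEq ι] {w : σ → ℚ}
    (g : ι → ℚ) {k : ℕ} (A : Fin k → Matrix ι ι (MvPolynomial σ ℂ)) (c : Fin k → ℚ)
    (hA : ∀ i r s, IsWeightedHomogeneous w (A i r s) (g s - g r + c i)) (r s : ι) :
    IsWeightedHomogeneous w ((List.ofFn A).prod r s) (g s - g r + ∑ i, c i) := by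
  induction k generalizing r with
  | zero =>
    simp only [List.ofFn_zero, List.prod_nil, Finset.univ_eq_empty, Finset.sum_empty, add_zero]
    by_cases h : r = s
    · subst h
      rw [Matrix.one_apply_eq]
      exact (isWeightedHomogeneous_one ℂ w).of_eq (by ring)
    · rw [Matrix.one_apply_ne h]
      exact isWeightedHomogeneous_zero ℂ w _
  | succ k ih =>
    rw [List.ofFn_succ, List.prod_cons, Matrix.mul_apply, Fin.sum_univ_succ]
    refine IsWeightedHomogeneous.sum _ _ _ fun t _ => ?_
    exact ((hA 0 r t).mul (ih _ _ (fun i => hA i.succ) t)).of_eq (by ring)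

/-- The supertrace of the product of all the derivatives of `Q` has weight
`∑ᵢ (1 - |xᵢ|) + ∑ⱼ (1 - |yⱼ|)`, because the contributions of the `g r` cancel. -/
theorem IsGradedFactorisation.isWeightedHomogeneous_strDeriv {V₁ : MvPolynomial (Fin n) ℂ}
    {V₂ : MvPolynomial (Fin m) ℂ} {E J : Matrix (Fin N) (Fin N) (Poly n m)}
    (h : IsGradedFactorisation w₁ w₂ V₁ V₂ E J) :
    IsWeightedHomogeneous (Sum.elim w₁ w₂) (strDeriv E J)
      (centralCharge w₁ + centralCharge w₂) := by
  obtain ⟨g, hg⟩ := h.graded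
  set P := ((List.ofFn fun i : Fin n => (oddMatrix E J).map (pderiv (Sum.inl i))).prod *
      (List.ofFn fun j : Fin m => (oddMatrix E J).map (pderiv (Sum.inr j))).prod) with hP
  have hPP : ∀ r s, IsWeightedHomogeneous (Sum.elim w₁ w₂) (P r s)
      (g s - g r + (centralCharge w₁ + centralCharge w₂)) := by
    intro r s
    rw [hP, Matrix.mul_apply]
    refine IsWeightedHomogeneous.sum _ _ _ fun t _ => ?_
    refine ((isWeightedHomogeneous_prod_ofFn g _ (fun i => 1 - w₁ i) ?_ r t).mul
      (isWeightedHomogeneous_prod_ofFn g _ (fun i => 1 - w₂ i) ?_ t s)).of_eq ?_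
    · exact fun i r s => (hg r s).pderiv_of_eq (by simp; ring)
    · exact fun i r s => (hg r s).pderiv_of_eq (by simp; ring)
    · simp only [centralCharge]; ring
  rw [strDeriv, ← hP, supertrace, Matrix.trace]
  refine IsWeightedHomogeneous.sum _ _ _ fun r _ => ?_
  rw [Matrix.diag_apply, Matrix.mul_apply]
  refine IsWeightedHomogeneous.sum _ _ _ fun t _ => ?_
  by_cases hrt : r = t
  · subst hrt
    have h1 : IsWeightedHomogeneous (Sum.elim w₁ w₂)
        ((Matrix.fromBlocks 1 0 0 (-1) : Matrix (Fin N ⊕ Fin N) (Fin N ⊕ Fin N) (Poly n m)) r r)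
        (0 : ℚ) := by
      rcases r with r | r
      · simpa using isWeightedHomogeneous_one ℂ (Sum.elim w₁ w₂)
      · simpa using (isWeightedHomogeneous_one ℂ (Sum.elim w₁ w₂)).neg
    exact (h1.mul (hPP r r)).of_eq (by ring)
  · have h0 : (Matrix.fromBlocks 1 0 0 (-1) :
        Matrix (Fin N ⊕ Fin N) (Fin N ⊕ Fin N) (Poly n m)) r t = 0 := by
      rcases r with r | r <;> rcases t with t | t <;> simp_all
    rw [h0, zero_mul]
    exact isWeightedHomogeneous_zero ℂ _ _

/-- To compute the residue in `x` of a quasi-homogeneous polynomial whose residue is a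
constant, one may set `y = 0`. -/
theorem residue_map_C_eq_C (h₂ : ∀ j, 0 < w₂ j) {f : Fin n → MvPolynomial (Fin n) ℂ}
    {ν : Fin n →₀ ℕ} {M : Matrix (Fin n) (Fin n) (MvPolynomial (Fin n) ℂ)}
    (hM : IsResidueDatum f ν M) {d e : ℚ} (hdet : IsWeightedHomogeneous w₁ M.det e)
    {φ : Poly n m} (hφ : IsWeightedHomogeneous (Sum.elim w₁ w₂) φ d)
    (hν : Finsupp.weight w₁ ν = e + d) :
    residue (fun i => map (C : ℂ →+* MvPolynomial (Fin m) ℂ) (f i))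
        (sumAlgEquiv ℂ (Fin n) (Fin m) φ) =
      C (coeff ν (M.det * aeval (Sum.elim X 0) φ)) := by
  have hM' : IsResidueDatum (fun i => map (C : ℂ →+* MvPolynomial (Fin m) ℂ) (f i)) ν
      (M.map (map C)) := by
    intro i
    have := congrArg (map (C : ℂ →+* MvPolynomial (Fin m) ℂ)) (hM i)
    simpa [map_sum] using this
  have h1 : (M.map (map (C : ℂ →+* MvPolynomial (Fin m) ℂ))).det =
      sumAlgEquiv ℂ (Fin n) (Fin m) (rename Sum.inl M.det) := by
    have := DFunLike.congr_fun (sumAlgEquiv_comp_rename_inl (R := ℂ) (S₁ := Fin n) (S₂ := Fin m))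
      M.det
    exact (RingHom.map_det (map C) M).symm.trans this.symm
  rw [residue_eq hM', h1, ← map_mul, coeff_sumAlgEquiv_eq_C (d := e + d) h₂ ?_ hν, map_mul,
    aeval_rename]
  · congr 3
    exact aeval_X_left_apply _
  · exact (IsWeightedHomogeneous.rename_comp (v := Sum.elim w₁ w₂) Sum.inl hdet).mul hφ

/-- For a graded factorisation the left quantum dimension is the constant obtained by setting
`y = 0` in `strDeriv E J`. -/
theorem IsGradedFactorisation.leftQuantumDim_eq (h₂ : ∀ j, 0 < w₂ j)
    {V₁ : MvPolynomial (Fin n) ℂ}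
    {V₂ : MvPolynomial (Fin m) ℂ} {E J : Matrix (Fin N) (Fin N) (Poly n m)}
    (h : IsGradedFactorisation w₁ w₂ V₁ V₂ E J) {ν : Fin n →₀ ℕ}
    {M : Matrix (Fin n) (Fin n) (MvPolynomial (Fin n) ℂ)}
    (hM : IsResidueDatum (fun i => pderiv i V₁) ν M) {e : ℚ}
    (hdet : IsWeightedHomogeneous w₁ M.det e)
    (hν : Finsupp.weight w₁ ν = e + (centralCharge w₁ + centralCharge w₂)) :
    leftQuantumDim V₁ E J = C ((-1) ^ (m + 1).choose 2 *
      coeff ν (M.det * aeval (Sum.elim X 0) (strDeriv E J))) := by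
  rw [leftQuantumDim, residue_map_C_eq_C h₂ hM hdet h.isWeightedHomogeneous_strDeriv hν]
  simp

/-- For a graded factorisation the right quantum dimension is the constant obtained by setting
`x = 0` in `strDeriv E J`. -/
theorem IsGradedFactorisation.rightQuantumDim_eq (h₁ : ∀ i, 0 < w₁ i)
    {V₁ : MvPolynomial (Fin n) ℂ}
    {V₂ : MvPolynomial (Fin m) ℂ} {E J : Matrix (Fin N) (Fin N) (Poly n m)}
    (h : IsGradedFactorisation w₁ w₂ V₁ V₂ E J) {ν : Fin m →₀ ℕ}
    {M : Matrix (Fin m) (Fin m) (MvPolynomial (Fin m) ℂ)}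
    (hM : IsResidueDatum (fun i => pderiv i V₂) ν M) {e : ℚ}
    (hdet : IsWeightedHomogeneous w₂ M.det e)
    (hν : Finsupp.weight w₂ ν = e + (centralCharge w₁ + centralCharge w₂)) :
    rightQuantumDim V₂ E J = C ((-1) ^ (n + 1).choose 2 *
      coeff ν (M.det * aeval (Sum.elim 0 X) (strDeriv E J))) := by
  have hs : IsWeightedHomogeneous (Sum.elim w₂ w₁) (rename Sum.swap (strDeriv E J))
      (centralCharge w₁ + centralCharge w₂) := by
    refine IsWeightedHomogeneous.rename_comp _ ?_
    have : (Sum.elim w₂ w₁ : Fin m ⊕ Fin n → ℚ) ∘ Sum.swap = Sum.elim w₁ w₂ := by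
      funext i
      rcases i with i | i <;> rfl
    rw [this]
    exact h.isWeightedHomogeneous_strDeriv
  rw [rightQuantumDim, residue_map_C_eq_C h₁ hM hdet hs hν, aeval_rename]
  have : (Sum.elim X 0 : Fin m ⊕ Fin n → MvPolynomial (Fin m) ℂ) ∘ Sum.swap =
      (Sum.elim 0 X : Fin n ⊕ Fin m → MvPolynomial (Fin m) ℂ) := by
    funext i
    rcases i with i | i <;> rfl
  rw [this]
  simp

/-- A factorisation is graded if the entries of `E` and `J` have the weights prescribed by
gradings `g` and `h` of its two halves. The entries have no constant terms if these weights do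
not vanish. -/
theorem IsGradedFactorisation.of_weights {V₁ : MvPolynomial (Fin n) ℂ}
    {V₂ : MvPolynomial (Fin m) ℂ} {E J : Matrix (Fin N) (Fin N) (Poly n m)}
    (hEJ : E * J = Matrix.scalar (Fin N) (difference V₁ V₂))
    (hJE : J * E = Matrix.scalar (Fin N) (difference V₁ V₂)) (g h : Fin N → ℚ)
    (hE : ∀ r s, IsWeightedHomogeneous (Sum.elim w₁ w₂) (E r s) (h s - g r + 1))
    (hJ : ∀ r s, IsWeightedHomogeneous (Sum.elim w₁ w₂) (J r s) (g s - h r + 1))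
    (hE0 : ∀ r s, h s - g r + 1 ≠ 0) (hJ0 : ∀ r s, g s - h r + 1 ≠ 0) :
    IsGradedFactorisation w₁ w₂ V₁ V₂ E J where
  mul_EJ := hEJ
  mul_JE := hJE
  graded := by
    refine ⟨Sum.elim g h, ?_⟩
    rintro (r | r) (s | s)
    · exact isWeightedHomogeneous_zero ℂ _ _
    · exact hE r s
    · exact hJ r s
    · exact isWeightedHomogeneous_zero ℂ _ _
  constantCoeff_eq_zero := by
    rintro (r | r) (s | s)
    · exact map_zero _
    · exact (hE r s).constantCoeff_eq_zero (hE0 r s)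
    · exact (hJ r s).constantCoeff_eq_zero (hJ0 r s)
    · exact map_zero _

end Factorisation

theorem HasTrueOrbifoldEquivalence.orbifoldEquivalent {n m N : ℕ} {c : ℚ}
    {V₁ : MvPolynomial (Fin n) ℂ} {V₂ : MvPolynomial (Fin m) ℂ}
    (h : HasTrueOrbifoldEquivalence N c V₁ V₂) : OrbifoldEquivalent V₁ V₂ := by
  obtain ⟨w₁, w₂, h₁, h₂, -, -, E, J, hEJ, -⟩ := h
  exact ⟨w₁, w₂, h₁, h₂, N, E, J, hEJ⟩


/-! ### Shapes of factorisations -/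

section Shapes

variable {n m N : ℕ} {w₁ : Fin n → ℚ} {w₂ : Fin m → ℚ}
  {V₁ : MvPolynomial (Fin n) ℂ} {V₂ : MvPolynomial (Fin m) ℂ}

/-- If `A` squares to a scalar matrix, then `z + A` and `z - A` are a factorisation. -/
theorem IsGradedFactorisation.of_sq {A : Matrix (Fin N) (Fin N) (Poly n m)} {z a : Poly n m}
    (hA : A * A = Matrix.scalar (Fin N) a) (hV : z ^ 2 - a = difference V₁ V₂)
    (hz : IsWeightedHomogeneous (Sum.elim w₁ w₂) z (1 : ℚ)) (g : Fin N → ℚ)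
    (hg : ∀ r s, IsWeightedHomogeneous (Sum.elim w₁ w₂) (A r s) (g s - g r + 1))
    (h0 : ∀ r s, g s - g r + 1 ≠ 0) :
    IsGradedFactorisation w₁ w₂ V₁ V₂ (Matrix.scalar (Fin N) z + A)
      (Matrix.scalar (Fin N) z - A) := by
  have hc : Matrix.scalar (Fin N) z * A = A * Matrix.scalar (Fin N) z :=
    Matrix.scalar_comm z (fun _ => Commute.all _ _) A
  have hsc : ∀ r s, IsWeightedHomogeneous (Sum.elim w₁ w₂) (Matrix.scalar (Fin N) z r s)
      (g s - g r + 1) := by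
    intro r s
    by_cases hrs : r = s
    · subst hrs
      simpa using hz
    · simpa [Matrix.scalar_apply, hrs] using isWeightedHomogeneous_zero ℂ _ _
  have hzz : Matrix.scalar (Fin N) z * Matrix.scalar (Fin N) z - A * A =
      Matrix.scalar (Fin N) (difference V₁ V₂) := by
    rw [hA, ← map_mul, ← map_sub, ← hV, sq]
  refine .of_weights ?_ ?_ g g (fun r s => (hsc r s).add (hg r s))
    (fun r s => (hsc r s).sub (hg r s)) h0 h0
  · rw [← hzz, add_mul, mul_sub, mul_sub, hc]
    abel
  · rw [← hzz, sub_mul, mul_add, mul_add, hc]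
    abel

/-- A quasi-homogeneous `3 × 3` matrix of determinant `V₁ - V₂` and its adjugate are a
factorisation. -/
theorem IsGradedFactorisation.of_det {E : Matrix (Fin 3) (Fin 3) (Poly n m)}
    (hdet : E.det = difference V₁ V₂) (g h : Fin 3 → ℚ)
    (hE : ∀ r s, IsWeightedHomogeneous (Sum.elim w₁ w₂) (E r s) (h s - g r + 1))
    (hgh : h 0 + h 1 + h 2 + 1 = g 0 + g 1 + g 2)
    (hE0 : ∀ r s, h s - g r + 1 ≠ 0) (hJ0 : ∀ r s, g s - h r + 1 ≠ 0) :
    IsGradedFactorisation w₁ w₂ V₁ V₂ E E.adjugate := by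
  refine .of_weights ?_ ?_ g h hE ?_ hE0 hJ0
  · rw [Matrix.mul_adjugate, hdet, Matrix.scalar_apply, Matrix.smul_one_eq_diagonal]
  · rw [Matrix.adjugate_mul, hdet, Matrix.scalar_apply, Matrix.smul_one_eq_diagonal]
  · have h2 : ∀ (i j k l i' j' k' l' r s : Fin 3),
        h j - g i + 1 + (h l - g k + 1) = g s - h r + 1 →
        h j' - g i' + 1 + (h l' - g k' + 1) = g s - h r + 1 →
        IsWeightedHomogeneous (Sum.elim w₁ w₂) (E i j * E k l - E i' j' * E k' l')
          (g s - h r + 1) :=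
      fun i j k l i' j' k' l' r s hw hw' =>
        (((hE i j).mul (hE k l)).of_eq hw).sub (((hE i' j').mul (hE k' l')).of_eq hw')
    have h2' : ∀ (i j k l i' j' k' l' r s : Fin 3),
        h j - g i + 1 + (h l - g k + 1) = g s - h r + 1 →
        h j' - g i' + 1 + (h l' - g k' + 1) = g s - h r + 1 →
        IsWeightedHomogeneous (Sum.elim w₁ w₂) (-(E i j * E k l) + E i' j' * E k' l')
          (g s - h r + 1) :=
      fun i j k l i' j' k' l' r s hw hw' =>
        (((hE i j).mul (hE k l)).of_eq hw).neg.add (((hE i' j').mul (hE k' l')).of_eq hw')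
    intro r s
    rw [Matrix.adjugate_fin_three]
    fin_cases r <;> fin_cases s
    · exact h2 1 1 2 2 1 2 2 1 0 0 (by linarith) (by linarith)
    · exact h2' 0 1 2 2 0 2 2 1 0 1 (by linarith) (by linarith)
    · exact h2 0 1 1 2 0 2 1 1 0 2 (by linarith) (by linarith)
    · exact h2' 1 0 2 2 1 2 2 0 1 0 (by linarith) (by linarith)
    · exact h2 0 0 2 2 0 2 2 0 1 1 (by linarith) (by linarith)
    · exact h2' 0 0 1 2 0 2 1 0 1 2 (by linarith) (by linarith)
    · exact h2 1 0 2 1 1 1 2 0 2 0 (by linarith) (by linarith)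
    · exact h2' 0 0 2 1 0 1 2 0 2 1 (by linarith) (by linarith)
    · exact h2 0 0 1 1 0 1 1 0 2 2 (by linarith) (by linarith)

end Shapes

/-! ### The supertrace of the derivatives -/

section Derivatives

variable {n m N : ℕ} {R : Type*} [CommRing R] [Algebra ℂ R]

/-- The matrix of the values under `φ` of the derivatives of the entries in the direction of the
variable `v`. -/
noncomputable def derivAt (φ : Poly n m →ₐ[ℂ] R) (v : Fin n ⊕ Fin m)
    (A : Matrix (Fin N) (Fin N) (Poly n m)) : Matrix (Fin N) (Fin N) R :=
  A.map fun p => φ (pderiv v p)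

theorem derivAt_apply (φ : Poly n m →ₐ[ℂ] R) (v : Fin n ⊕ Fin m)
    (A : Matrix (Fin N) (Fin N) (Poly n m)) (i j : Fin N) :
    derivAt φ v A i j = φ (pderiv v (A i j)) := rfl

@[simp]
theorem pderiv_ofNat {σ : Type*} (v : σ) (k : ℕ) [k.AtLeastTwo] :
    pderiv v (ofNat(k) : MvPolynomial σ ℂ) = 0 := by
  rw [← map_ofNat C k, pderiv_C]

theorem map_supertrace (φ : Poly n m →ₐ[ℂ] R) (A D : Matrix (Fin N) (Fin N) (Poly n m)) :
    φ (supertrace (Matrix.fromBlocks A 0 0 D)) =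
      Matrix.trace (φ.mapMatrix A) - Matrix.trace (φ.mapMatrix D) := by
  simp [supertrace, Matrix.fromBlocks_multiply, Matrix.trace, sub_eq_add_neg, map_sum]

theorem map_strDeriv_two (φ : Poly 2 2 →ₐ[ℂ] R) (E J : Matrix (Fin N) (Fin N) (Poly 2 2)) :
    φ (strDeriv E J) =
      Matrix.trace (derivAt φ (.inl 0) E * derivAt φ (.inl 1) J *
        (derivAt φ (.inr 0) E * derivAt φ (.inr 1) J)) -
      Matrix.trace (derivAt φ (.inl 0) J * derivAt φ (.inl 1) E *
        (derivAt φ (.inr 0) J * derivAt φ (.inr 1) E)) := by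
  have h : ∀ (v : Fin 2 ⊕ Fin 2) (A : Matrix (Fin N) (Fin N) (Poly 2 2)),
      derivAt φ v A = φ.mapMatrix (A.map (pderiv v)) := fun _ _ => rfl
  simp only [h, ← map_mul, ← map_supertrace]
  simp [strDeriv, oddMatrix, Matrix.fromBlocks_map, Matrix.fromBlocks_multiply]

theorem map_strDeriv_three (φ : Poly 3 3 →ₐ[ℂ] R) (E J : Matrix (Fin N) (Fin N) (Poly 3 3)) :
    φ (strDeriv E J) =
      Matrix.trace (derivAt φ (.inl 0) E * (derivAt φ (.inl 1) J * derivAt φ (.inl 2) E) *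
        (derivAt φ (.inr 0) J * (derivAt φ (.inr 1) E * derivAt φ (.inr 2) J))) -
      Matrix.trace (derivAt φ (.inl 0) J * (derivAt φ (.inl 1) E * derivAt φ (.inl 2) J) *
        (derivAt φ (.inr 0) E * (derivAt φ (.inr 1) J * derivAt φ (.inr 2) E))) := by
  have h : ∀ (v : Fin 3 ⊕ Fin 3) (A : Matrix (Fin N) (Fin N) (Poly 3 3)),
      derivAt φ v A = φ.mapMatrix (A.map (pderiv v)) := fun _ _ => rfl
  simp only [h, ← map_mul, ← map_supertrace]
  simp [strDeriv, oddMatrix, Matrix.fromBlocks_map, Matrix.fromBlocks_multiply]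

theorem derivAt_scalar_add (φ : Poly n m →ₐ[ℂ] R) (v : Fin n ⊕ Fin m) (z : Poly n m)
    (A : Matrix (Fin N) (Fin N) (Poly n m)) :
    derivAt φ v (Matrix.scalar (Fin N) z + A) =
      Matrix.scalar (Fin N) (φ (pderiv v z)) + derivAt φ v A := by
  ext i j
  by_cases h : i = j <;> simp [derivAt, h]

theorem derivAt_scalar_sub (φ : Poly n m →ₐ[ℂ] R) (v : Fin n ⊕ Fin m) (z : Poly n m)
    (A : Matrix (Fin N) (Fin N) (Poly n m)) :
    derivAt φ v (Matrix.scalar (Fin N) z - A) =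
      Matrix.scalar (Fin N) (φ (pderiv v z)) - derivAt φ v A := by
  ext i j
  by_cases h : i = j <;> simp [derivAt, h]

/-- For a factorisation `x₂ ± A`, only the derivatives of `A` by the other variables matter. -/
theorem map_strDeriv_two_of_sq (φ : Poly 2 2 →ₐ[ℂ] R) (A : Matrix (Fin N) (Fin N) (Poly 2 2))
    (hA : derivAt φ (.inl 1) A = 0) :
    φ (strDeriv (Matrix.scalar (Fin N) (X (.inl 1)) + A)
        (Matrix.scalar (Fin N) (X (.inl 1)) - A)) =
      -2 * Matrix.trace (derivAt φ (.inl 0) A *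
        (derivAt φ (.inr 0) A * derivAt φ (.inr 1) A)) := by
  rw [map_strDeriv_two]
  simp only [derivAt_scalar_add, derivAt_scalar_sub, hA]
  simp [pderiv_X, -Matrix.scalar_apply]
  ring

/-- For a factorisation `x₃ ± A`, only the derivatives of `A` by the other variables matter. -/
theorem map_strDeriv_three_of_sq (φ : Poly 3 3 →ₐ[ℂ] R)
    (A : Matrix (Fin N) (Fin N) (Poly 3 3)) (hA : derivAt φ (.inl 2) A = 0) :
    φ (strDeriv (Matrix.scalar (Fin N) (X (.inl 2)) + A)
        (Matrix.scalar (Fin N) (X (.inl 2)) - A)) =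
      -2 * Matrix.trace (derivAt φ (.inl 0) A * derivAt φ (.inl 1) A *
        (derivAt φ (.inr 0) A * (derivAt φ (.inr 1) A * derivAt φ (.inr 2) A))) := by
  rw [map_strDeriv_three]
  simp only [derivAt_scalar_add, derivAt_scalar_sub, hA]
  simp [pderiv_X, -Matrix.scalar_apply]
  ring

/-- For a factorisation `y₁ ± A`, only the derivatives of `A` by the other variables matter. -/
theorem map_strDeriv_three_of_sq' (φ : Poly 3 3 →ₐ[ℂ] R)
    (A : Matrix (Fin N) (Fin N) (Poly 3 3)) (hA : derivAt φ (.inr 0) A = 0) :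
    φ (strDeriv (Matrix.scalar (Fin N) (X (.inr 0)) + A)
        (Matrix.scalar (Fin N) (X (.inr 0)) - A)) =
      2 * Matrix.trace (derivAt φ (.inl 0) A * (derivAt φ (.inl 1) A * derivAt φ (.inl 2) A) *
        (derivAt φ (.inr 1) A * derivAt φ (.inr 2) A)) := by
  rw [map_strDeriv_three]
  simp only [derivAt_scalar_add, derivAt_scalar_sub, hA]
  simp [pderiv_X, -Matrix.scalar_apply]
  ring

end Derivatives

/-! ### Exponents and coefficients -/

theorem coeff_X_pow_mul_X_pow (ν : Fin 2 →₀ ℕ) (a b : ℕ) :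
    coeff ν (X 0 ^ a * X 1 ^ b : MvPolynomial (Fin 2) ℂ) = if ν 0 = a ∧ ν 1 = b then 1 else 0 := by
  classical
  rw [X_pow_eq_monomial, X_pow_eq_monomial, monomial_mul, coeff_monomial, mul_one]
  refine if_congr ?_ rfl rfl
  rw [Finsupp.ext_iff, Fin.forall_fin_two]
  simp [eq_comm]

theorem coeff_X_pow_mul_X_pow_mul_X_pow (ν : Fin 3 →₀ ℕ) (a b c : ℕ) :
    coeff ν (X 0 ^ a * X 1 ^ b * X 2 ^ c : MvPolynomial (Fin 3) ℂ) =
      if ν 0 = a ∧ ν 1 = b ∧ ν 2 = c then 1 else 0 := by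
  classical
  rw [X_pow_eq_monomial, X_pow_eq_monomial, X_pow_eq_monomial, monomial_mul, monomial_mul,
    coeff_monomial, mul_one, mul_one]
  refine if_congr ?_ rfl rfl
  rw [Finsupp.ext_iff]
  simp [Fin.forall_fin_succ, eq_comm]

/-- The exponent vector with the given values. -/
noncomputable def exponent {n : ℕ} (f : Fin n → ℕ) : Fin n →₀ ℕ :=
  Finsupp.equivFunOnFinite.symm f

@[simp]
theorem exponent_apply {n : ℕ} (f : Fin n → ℕ) (i : Fin n) : exponent f i = f i := rfl

theorem weight_exponent {n : ℕ} (w : Fin n → ℚ) (f : Fin n → ℕ) :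
    Finsupp.weight w (exponent f) = ∑ i, f i * w i := by
  simp [Finsupp.weight_apply, Finsupp.sum_fintype]


/-! ### From a factorisation to an orbifold equivalence -/

theorem IsPotential.of_isResidueDatum {n : ℕ} {w : Fin n → ℚ} {V : MvPolynomial (Fin n) ℂ}
    {ν : Fin n →₀ ℕ} {M : Matrix (Fin n) (Fin n) (MvPolynomial (Fin n) ℂ)}
    (hM : IsResidueDatum (fun i => pderiv i V) ν M) (hw : ∀ i, 0 < w i)
    (hV : IsWeightedHomogeneous w V (2 : ℚ))
    (hsq : V ∈ Ideal.span (Set.range (X : Fin n → MvPolynomial (Fin n) ℂ)) ^ 2) :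
    IsPotential w V :=
  ⟨hw, hV, hsq, hM.finite_quotient⟩

/-- The data needed for an orbifold equivalence: a graded factorisation together with
presentations of powers of the variables in the Jacobi ideals, from which the two quantum
dimensions are read off as coefficients. The weights `hν₁` and `hν₂` of the extracted monomials are
those for which the quantum dimensions are constant. -/
theorem HasTrueOrbifoldEquivalence.of_isGradedFactorisation {n m N : ℕ} {c : ℚ}
    {w₁ : Fin n → ℚ} {w₂ : Fin m → ℚ}
    {V₁ : MvPolynomial (Fin n) ℂ} {V₂ : MvPolynomial (Fin m) ℂ}
    {E J : Matrix (Fin N) (Fin N) (Poly n m)}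
    (hEJ : IsGradedFactorisation w₁ w₂ V₁ V₂ E J)
    (h₁ : IsPotential w₁ V₁) (h₂ : IsPotential w₂ V₂)
    (hc₁ : centralCharge w₁ = c) (hc₂ : centralCharge w₂ = c)
    {ν₁ : Fin n →₀ ℕ} {M₁ : Matrix (Fin n) (Fin n) (MvPolynomial (Fin n) ℂ)}
    (hM₁ : IsResidueDatum (fun i => pderiv i V₁) ν₁ M₁) {D₁ : MvPolynomial (Fin n) ℂ} {e₁ : ℚ}
    (hD₁ : M₁.det = D₁) (hdet₁ : IsWeightedHomogeneous w₁ D₁ e₁)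
    (hν₁ : Finsupp.weight w₁ ν₁ = e₁ + (c + c))
    {ν₂ : Fin m →₀ ℕ} {M₂ : Matrix (Fin m) (Fin m) (MvPolynomial (Fin m) ℂ)}
    (hM₂ : IsResidueDatum (fun i => pderiv i V₂) ν₂ M₂) {D₂ : MvPolynomial (Fin m) ℂ} {e₂ : ℚ}
    (hD₂ : M₂.det = D₂) (hdet₂ : IsWeightedHomogeneous w₂ D₂ e₂)
    (hν₂ : Finsupp.weight w₂ ν₂ = e₂ + (c + c))
    {p₁ : MvPolynomial (Fin n) ℂ} (hp₁ : aeval (Sum.elim X 0) (strDeriv E J) = p₁)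
    {p₂ : MvPolynomial (Fin m) ℂ} (hp₂ : aeval (Sum.elim 0 X) (strDeriv E J) = p₂)
    {qL qR : ℂ} (hL : (-1) ^ (m + 1).choose 2 * coeff ν₁ (D₁ * p₁) = qL)
    (hR : (-1) ^ (n + 1).choose 2 * coeff ν₂ (D₂ * p₂) = qR)
    (h0 : qL * qR ≠ 0) (hp : qL * qR ≠ 1) (hn : qL * qR ≠ -1) :
    HasTrueOrbifoldEquivalence N c V₁ V₂ := by
  subst hD₁ hD₂
  have hl : leftQuantumDim V₁ E J = C qL := by
    rw [hEJ.leftQuantumDim_eq h₂.weight_pos hM₁ hdet₁ (by rw [hc₁, hc₂]; exact hν₁), hp₁, hL]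
  have hr : rightQuantumDim V₂ E J = C qR := by
    rw [hEJ.rightQuantumDim_eq h₁.weight_pos hM₂ hdet₂ (by rw [hc₁, hc₂]; exact hν₂), hp₂, hR]
  have hL0 : qL ≠ 0 := left_ne_zero_of_mul h0
  have hR0 : qR ≠ 0 := right_ne_zero_of_mul h0
  refine ⟨w₁, w₂, h₁, h₂, hc₁, hc₂, E, J, ⟨hEJ, ?_, ?_⟩, qL, qR, hl, hr, hL0, hR0, hp, hn⟩
  · rw [hl]; exact (isUnit_iff_ne_zero.mpr hL0).map C
  · rw [hr]; exact (isUnit_iff_ne_zero.mpr hR0).map C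


/-! ### `A₅` and `A₂ × A₂` -/

section A5

theorem isResidueDatum_A5 : IsResidueDatum
    (fun i => pderiv i (X 0 ^ 6 + X 1 ^ 2 : MvPolynomial (Fin 2) ℂ)) (exponent ![4, 0])
    !![C 6⁻¹, 0; 0, C 2⁻¹] := by
  have h6 : (C 6⁻¹ * 6 : MvPolynomial (Fin 2) ℂ) = 1 := by
    rw [← map_ofNat C 6, ← map_mul]; norm_num
  have h2 : (C 2⁻¹ * 2 : MvPolynomial (Fin 2) ℂ) = 1 := by
    rw [← map_ofNat C 2, ← map_mul]; norm_num
  intro i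
  fin_cases i
  · simp [Fin.sum_univ_two, pderiv_X]
    linear_combination -X 0 ^ 5 * h6
  · simp [Fin.sum_univ_two, pderiv_X]
    linear_combination -X 1 * h2

theorem isResidueDatum_A2A2 : IsResidueDatum
    (fun i => pderiv i (X 0 ^ 3 + X 1 ^ 3 : MvPolynomial (Fin 2) ℂ)) (exponent ![1, 1])
    !![C 3⁻¹, 0; 0, C 3⁻¹] := by
  have h3 : (C 3⁻¹ * 3 : MvPolynomial (Fin 2) ℂ) = 1 := by
    rw [← map_ofNat C 3, ← map_mul]; norm_num
  intro i
  fin_cases i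
  · simp [Fin.sum_univ_two, pderiv_X]
    linear_combination -X 0 ^ 2 * h3
  · simp [Fin.sum_univ_two, pderiv_X]
    linear_combination -X 1 ^ 2 * h3

theorem isPotential_A5 : IsPotential ![1 / 3, 1] (X 0 ^ 6 + X 1 ^ 2) := by
  refine .of_isResidueDatum isResidueDatum_A5 (by simp [Fin.forall_fin_two]) ?_ ?_
  · refine .add ?_ ?_ <;> refine .of_eq (.pow (isWeightedHomogeneous_X _ _ _) _) ?_ <;> norm_num
  · convert add_mem (X_mul_X_mul_mem_sq 0 0 (X 0 ^ 4)) (X_mul_X_mul_mem_sq 1 1 1) using 1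
    ring

theorem isPotential_A2A2 : IsPotential ![2 / 3, 2 / 3] (X 0 ^ 3 + X 1 ^ 3) := by
  refine .of_isResidueDatum isResidueDatum_A2A2 (by simp [Fin.forall_fin_two]) ?_ ?_
  · refine .add ?_ ?_ <;> refine .of_eq (.pow (isWeightedHomogeneous_X _ _ _) _) ?_ <;> norm_num
  · convert add_mem (X_mul_X_mul_mem_sq 0 0 (X 0)) (X_mul_X_mul_mem_sq 1 1 (X 1)) using 1
    ring

/-- A square root of the scalar matrix `y₁ ^ 3 + y₂ ^ 3 - x ^ 6`, for constants with
`16 t ^ 3 = 1` and `r ^ 2 = 3 t`. -/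
def sqrtA5 {R : Type*} [CommRing R] (t r x y₁ y₂ : R) : Matrix (Fin 2) (Fin 2) R :=
  !![r * x * y₁ - r * x * y₂, y₁ + y₂ - 4 * t * x ^ 2;
    y₁ ^ 2 - y₁ * y₂ + y₂ ^ 2 + t * y₁ * x ^ 2 + t * y₂ * x ^ 2 + 4 * t ^ 2 * x ^ 4,
      r * x * y₂ - r * x * y₁]

theorem sqrtA5_mul_self {R : Type*} [CommRing R] {t r : R} (ht : 16 * t ^ 3 = 1)
    (hr : r ^ 2 = 3 * t) (x y₁ y₂ : R) :
    sqrtA5 t r x y₁ y₂ * sqrtA5 t r x y₁ y₂ =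
      Matrix.scalar (Fin 2) (y₁ ^ 3 + y₂ ^ 3 - x ^ 6) := by
  ext i j
  fin_cases i <;> fin_cases j
  · simp [sqrtA5, Matrix.mul_apply, Fin.sum_univ_two]
    linear_combination (-x ^ 6) * ht + (x * (y₁ - y₂)) ^ 2 * hr
  · simp [sqrtA5, Matrix.mul_apply, Fin.sum_univ_two]
    ring
  · simp [sqrtA5, Matrix.mul_apply, Fin.sum_univ_two]
    ring
  · simp [sqrtA5, Matrix.mul_apply, Fin.sum_univ_two]
    linear_combination (-x ^ 6) * ht + (x * (y₁ - y₂)) ^ 2 * hr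

/-- `sqrtA5` for the variables of `ℂ[x₁, x₂, y₁, y₂]`. -/
noncomputable def sqrtPolyA5 (t r : ℂ) : Matrix (Fin 2) (Fin 2) (Poly 2 2) :=
  sqrtA5 (C t) (C r) (X (Sum.inl 0)) (X (Sum.inr 0)) (X (Sum.inr 1))

variable {t r : ℂ}

theorem isGradedFactorisation_A5 (ht : 16 * t ^ 3 = 1) (hr : r ^ 2 = 3 * t) :
    IsGradedFactorisation ![1 / 3, 1] ![2 / 3, 2 / 3] (X 0 ^ 6 + X 1 ^ 2) (X 0 ^ 3 + X 1 ^ 3)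
      (Matrix.scalar (Fin 2) (X (Sum.inl 1) : Poly 2 2) + sqrtPolyA5 t r)
      (Matrix.scalar (Fin 2) (X (Sum.inl 1) : Poly 2 2) - sqrtPolyA5 t r) := by
  have ht' : 16 * (C t : Poly 2 2) ^ 3 = 1 := by
    rw [← map_ofNat C 16, ← map_pow, ← map_mul, ht, map_one]
  have hr' : (C r : Poly 2 2) ^ 2 = 3 * C t := by
    rw [← map_ofNat C 3, ← map_pow, ← map_mul, hr]
  refine .of_sq (sqrtA5_mul_self ht' hr' _ _ _) ?_ ?_ ![1 / 3, 0] ?_ ?_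
  · simp [difference]
    ring
  · exact isWeightedHomogeneous_X' (by simp)
  · intro i j
    fin_cases i <;> fin_cases j <;> simp only [sqrtPolyA5, sqrtA5, Matrix.of_apply,
      Matrix.cons_val', Matrix.cons_val_zero, Matrix.cons_val_one, Fin.zero_eta, Fin.mk_one]
    -- At higher transparency `apply` would unfold the polynomials.
    all_goals
      repeat' with_reducible_and_instances first
        | apply IsWeightedHomogeneous.add
        | apply IsWeightedHomogeneous.sub
        | apply isWeightedHomogeneous_X'
        | apply isWeightedHomogeneous_X_pow
        | apply isWeightedHomogeneous_C'
        | apply isWeightedHomogeneous_ofNat'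
        | apply isWeightedHomogeneous_mul_X
        | apply isWeightedHomogeneous_mul_X_pow
        | apply isWeightedHomogeneous_mul_C
        | apply isWeightedHomogeneous_mul_C_pow
    all_goals norm_num
  · simp [Fin.forall_fin_two]
    norm_num

theorem map_strDeriv_A5 {R : Type*} [CommRing R] [Algebra ℂ R] (φ : Poly 2 2 →ₐ[ℂ] R)
    {x y₁ y₂ T U : R} (hx : φ (X (Sum.inl 0)) = x) (hy₁ : φ (X (Sum.inr 0)) = y₁)
    (hy₂ : φ (X (Sum.inr 1)) = y₂) (hT : φ (C t) = T) (hU : φ (C r) = U) :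
    φ (strDeriv (Matrix.scalar (Fin 2) (X (Sum.inl 1) : Poly 2 2) + sqrtPolyA5 t r)
      (Matrix.scalar (Fin 2) (X (Sum.inl 1) : Poly 2 2) - sqrtPolyA5 t r)) =
      6 * U * (y₁ - y₂) ^ 2 - 24 * U * T * x ^ 2 * (y₁ + y₂) - 96 * (T ^ 2 * U) * x ^ 4 := by
  have h0 : derivAt φ (Sum.inl 0) (sqrtPolyA5 t r) =
      !![U * (y₁ - y₂), -8 * T * x;
        2 * T * (y₁ + y₂) * x + 16 * T ^ 2 * x ^ 3, U * (y₂ - y₁)] := by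
    ext i j
    fin_cases i <;> fin_cases j <;>
      simp [derivAt, sqrtPolyA5, sqrtA5, pderiv_X, hx, hy₁, hy₂, hT, hU, map_ofNat]
    all_goals ring
  have h1 : derivAt φ (Sum.inl 1) (sqrtPolyA5 t r) = 0 := by
    ext i j
    fin_cases i <;> fin_cases j <;> simp [derivAt, sqrtPolyA5, sqrtA5, pderiv_X]
  have h2 : derivAt φ (Sum.inr 0) (sqrtPolyA5 t r) =
      !![U * x, 1; 2 * y₁ - y₂ + T * x ^ 2, -U * x] := by
    ext i j
    fin_cases i <;> fin_cases j <;>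
      simp [derivAt, sqrtPolyA5, sqrtA5, pderiv_X, hx, hy₁, hy₂, hT, hU, map_ofNat]
    all_goals ring
  have h3 : derivAt φ (Sum.inr 1) (sqrtPolyA5 t r) =
      !![-U * x, 1; 2 * y₂ - y₁ + T * x ^ 2, U * x] := by
    ext i j
    fin_cases i <;> fin_cases j <;>
      simp [derivAt, sqrtPolyA5, sqrtA5, pderiv_X, hx, hy₁, hy₂, hT, hU, map_ofNat]
    all_goals ring
  rw [map_strDeriv_two_of_sq _ _ h1, h0, h2, h3]
  simp [Matrix.trace_fin_two]
  ring

theorem hasTrueOrbifoldEquivalence_A5 : HasTrueOrbifoldEquivalence 2 (2 / 3)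
    (X 0 ^ 6 + X 1 ^ 2 : MvPolynomial (Fin 2) ℂ)
    (X 0 ^ 3 + X 1 ^ 3 : MvPolynomial (Fin 2) ℂ) := by
  obtain ⟨t, ht⟩ := IsAlgClosed.exists_pow_nat_eq (1 / 16 : ℂ) (n := 3) (by norm_num)
  obtain ⟨r, hr⟩ := IsAlgClosed.exists_pow_nat_eq (3 * t) (n := 2) (by norm_num)
  replace ht : 16 * t ^ 3 = 1 := by rw [ht]; norm_num
  have hq : 8 * t ^ 2 * r * (4 / 3 * r) = 2 := by linear_combination 32 / 3 * t ^ 2 * hr + 2 * ht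
  refine .of_isGradedFactorisation (isGradedFactorisation_A5 ht hr) isPotential_A5
    isPotential_A2A2 ?_ ?_ isResidueDatum_A5 (e₁ := 0) (D₁ := C (6⁻¹ * 2⁻¹)) ?_
    (isWeightedHomogeneous_C _ _) ?_ isResidueDatum_A2A2 (e₂ := 0) (D₂ := C (3⁻¹ * 3⁻¹)) ?_
    (isWeightedHomogeneous_C _ _) ?_
    (map_strDeriv_A5 _ (aeval_X _ _) (aeval_X _ _) (aeval_X _ _) (aeval_C _ _) (aeval_C _ _))
    (map_strDeriv_A5 _ (aeval_X _ _) (aeval_X _ _) (aeval_X _ _) (aeval_C _ _) (aeval_C _ _))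
    (qL := 8 * t ^ 2 * r) (qR := 4 / 3 * r) ?_ ?_ ?_ ?_ ?_
  · simp [centralCharge]; norm_num
  · simp [centralCharge]; norm_num
  · simp [Matrix.det_fin_two_of]
  · simp [weight_exponent]; norm_num
  · simp [Matrix.det_fin_two_of]
  · simp [weight_exponent]
  -- The products of the determinants with the supertraces are written out as sums of monomials.
  · trans (-1) ^ (2 + 1).choose 2 * coeff (exponent ![4, 0])
      (C (6⁻¹ * 2⁻¹ * (-96 * (t ^ 2 * r))) * (X 0 ^ 4 * X 1 ^ 0) : MvPolynomial (Fin 2) ℂ)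
    · congr! 2
      simp [algebraMap_eq, map_ofNat]
      ring
    · simp only [coeff_C_mul, coeff_X_pow_mul_X_pow]
      simp
      ring
  · trans (-1) ^ (2 + 1).choose 2 * coeff (exponent ![1, 1])
      (C (3⁻¹ * 3⁻¹ * (6 * r)) * (X 0 ^ 2 * X 1 ^ 0) -
        C (3⁻¹ * 3⁻¹ * (12 * r)) * (X 0 ^ 1 * X 1 ^ 1) +
        C (3⁻¹ * 3⁻¹ * (6 * r)) * (X 0 ^ 0 * X 1 ^ 2) : MvPolynomial (Fin 2) ℂ)
    · congr! 2
      simp [algebraMap_eq, map_ofNat]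
      ring
    · simp only [coeff_add, coeff_sub, coeff_C_mul, coeff_X_pow_mul_X_pow]
      simp
      ring
  · rw [hq]; norm_num
  · rw [hq]; norm_num
  · rw [hq]; norm_num

end A5

/-! ### Factorisations by a `3 × 3` matrix and its adjugate -/

section Adjugate

variable {R : Type*} [CommRing R]

/-- The polarisation of the quadratic map `adjugate` on `3 × 3` matrices. -/
def adjugatePolar (A B : Matrix (Fin 3) (Fin 3) R) : Matrix (Fin 3) (Fin 3) R :=
  !![A 1 1 * B 2 2 + B 1 1 * A 2 2 - A 1 2 * B 2 1 - B 1 2 * A 2 1,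
      A 0 2 * B 2 1 + B 0 2 * A 2 1 - A 0 1 * B 2 2 - B 0 1 * A 2 2,
      A 0 1 * B 1 2 + B 0 1 * A 1 2 - A 0 2 * B 1 1 - B 0 2 * A 1 1;
    A 1 2 * B 2 0 + B 1 2 * A 2 0 - A 1 0 * B 2 2 - B 1 0 * A 2 2,
      A 0 0 * B 2 2 + B 0 0 * A 2 2 - A 0 2 * B 2 0 - B 0 2 * A 2 0,
      A 0 2 * B 1 0 + B 0 2 * A 1 0 - A 0 0 * B 1 2 - B 0 0 * A 1 2;
    A 1 0 * B 2 1 + B 1 0 * A 2 1 - A 1 1 * B 2 0 - B 1 1 * A 2 0,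
      A 0 1 * B 2 0 + B 0 1 * A 2 0 - A 0 0 * B 2 1 - B 0 0 * A 2 1,
      A 0 0 * B 1 1 + B 0 0 * A 1 1 - A 0 1 * B 1 0 - B 0 1 * A 1 0]

theorem adjugatePolar_smul (A B : Matrix (Fin 3) (Fin 3) R) (c : R) :
    adjugatePolar A (c • B) = c • adjugatePolar A B := by
  ext i j
  fin_cases i <;> fin_cases j <;> simp [adjugatePolar] <;> ring

variable [Algebra ℂ R] {n m : ℕ}

/-- The derivative of the adjugate is given by its polarisation. -/
theorem derivAt_adjugate (φ : Poly n m →ₐ[ℂ] R) (v : Fin n ⊕ Fin m)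
    (E : Matrix (Fin 3) (Fin 3) (Poly n m)) :
    derivAt φ v E.adjugate = adjugatePolar (φ.mapMatrix E) (derivAt φ v E) := by
  ext i j
  rw [Matrix.adjugate_fin_three]
  fin_cases i <;> fin_cases j <;> simp [derivAt, adjugatePolar] <;> ring

/-- The supertrace for a factorisation by a matrix and its adjugate, where scalar factors of the
derivatives, as they arise from rescaled variables, are taken out. -/
theorem map_strDeriv_adjugate (φ : Poly 2 2 →ₐ[ℂ] R) {E : Matrix (Fin 3) (Fin 3) (Poly 2 2)}
    {E₀ D₀ D₁ D₂ D₃ : Matrix (Fin 3) (Fin 3) R} {c₀ c₁ c₂ c₃ : R} (hE : φ.mapMatrix E = E₀)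
    (h₀ : derivAt φ (Sum.inl 0) E = c₀ • D₀) (h₁ : derivAt φ (Sum.inl 1) E = c₁ • D₁)
    (h₂ : derivAt φ (Sum.inr 0) E = c₂ • D₂) (h₃ : derivAt φ (Sum.inr 1) E = c₃ • D₃) :
    φ (strDeriv E E.adjugate) = c₀ * c₁ * (c₂ * c₃) *
      (Matrix.trace (D₀ * adjugatePolar E₀ D₁ * (D₂ * adjugatePolar E₀ D₃)) -
        Matrix.trace (adjugatePolar E₀ D₀ * D₁ * (adjugatePolar E₀ D₂ * D₃))) := by
  rw [map_strDeriv_two]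
  simp only [derivAt_adjugate, hE, h₀, h₁, h₂, h₃, adjugatePolar_smul, Matrix.smul_mul,
    Matrix.mul_smul, Matrix.trace_smul, smul_eq_mul]
  ring

end Adjugate

/-! ### A chain and a loop -/

section ChainLoop

variable {R : Type*} [CommRing R]

/-- A matrix of determinant `z ^ 3 - x ^ 10 * z + u ^ 3 * v - u * v ^ 7`. -/
def chainLoop (x z u v : R) : Matrix (Fin 3) (Fin 3) R :=
  !![z + x ^ 2 * v ^ 2, u - v ^ 3 + 2 * x ^ 3 * v, x ^ 4 - x * v ^ 2;
    x ^ 4 * v - x * v ^ 3, z + x ^ 5 - 2 * x ^ 2 * v ^ 2, u - x ^ 3 * v;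
    u * v + v ^ 4 - x ^ 3 * v ^ 2, 2 * x * v ^ 3 - 2 * x ^ 4 * v, z + x ^ 2 * v ^ 2 - x ^ 5]

theorem det_chainLoop (x z u v : R) :
    (chainLoop x z u v).det = z ^ 3 - x ^ 10 * z + u ^ 3 * v - u * v ^ 7 := by
  simp [chainLoop, Matrix.det_fin_three]
  ring

theorem isWeightedHomogeneous_chainLoop {σ : Type*} {w : σ → ℚ} {x z u v : MvPolynomial σ R}
    (hx : IsWeightedHomogeneous w x (2 / 15 : ℚ)) (hz : IsWeightedHomogeneous w z (2 / 3 : ℚ))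
    (hu : IsWeightedHomogeneous w u (3 / 5 : ℚ)) (hv : IsWeightedHomogeneous w v (1 / 5 : ℚ))
    (i j : Fin 3) : IsWeightedHomogeneous w (chainLoop x z u v i j)
      ((![0, -1 / 15, -2 / 15] : Fin 3 → ℚ) j - (![1 / 3, 4 / 15, 1 / 5] : Fin 3 → ℚ) i + 1) := by
  fin_cases i <;> fin_cases j <;> simp only [chainLoop, Matrix.of_apply, Matrix.cons_val',
    Matrix.cons_val_zero, Matrix.cons_val_one, Matrix.cons_val, Fin.zero_eta, Fin.mk_one,
    Fin.reduceFinMk]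
  all_goals
    repeat' with_reducible_and_instances first
      | apply IsWeightedHomogeneous.add
      | apply IsWeightedHomogeneous.sub
      | apply hx.of_eq
      | apply hz.of_eq
      | apply hu.of_eq
      | apply hv.of_eq
      | apply isWeightedHomogeneous_ofNat'
      | apply isWeightedHomogeneous_mul_right hx
      | apply isWeightedHomogeneous_mul_right hv
      | apply isWeightedHomogeneous_mul_pow hx
      | apply isWeightedHomogeneous_mul_pow hv
      | apply isWeightedHomogeneous_pow_of_eq hx
      | apply isWeightedHomogeneous_pow_of_eq hv
  all_goals norm_num

/-- The differential of `chainLoop`. -/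
def chainLoopDiff (x u v dx dz du dv : R) : Matrix (Fin 3) (Fin 3) R :=
  !![dz + 2 * x * v ^ 2 * dx + 2 * x ^ 2 * v * dv,
      du - 3 * v ^ 2 * dv + 6 * x ^ 2 * v * dx + 2 * x ^ 3 * dv,
      4 * x ^ 3 * dx - v ^ 2 * dx - 2 * x * v * dv;
    4 * x ^ 3 * v * dx + x ^ 4 * dv - v ^ 3 * dx - 3 * x * v ^ 2 * dv,
      dz + 5 * x ^ 4 * dx - 4 * x * v ^ 2 * dx - 4 * x ^ 2 * v * dv,
      du - 3 * x ^ 2 * v * dx - x ^ 3 * dv;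
    v * du + u * dv + 4 * v ^ 3 * dv - 3 * x ^ 2 * v ^ 2 * dx - 2 * x ^ 3 * v * dv,
      2 * v ^ 3 * dx + 6 * x * v ^ 2 * dv - 8 * x ^ 3 * v * dx - 2 * x ^ 4 * dv,
      dz + 2 * x * v ^ 2 * dx + 2 * x ^ 2 * v * dv - 5 * x ^ 4 * dx]

theorem chainLoopDiff_mul (x u v c dx dz du dv : R) :
    chainLoopDiff x u v (c * dx) (c * dz) (c * du) (c * dv) =
      c • chainLoopDiff x u v dx dz du dv := by
  ext i j
  fin_cases i <;> fin_cases j <;> simp [chainLoopDiff]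
  all_goals ring

theorem mapMatrix_chainLoop {S : Type*} [CommRing S] [Algebra ℂ R] [Algebra ℂ S] (φ : R →ₐ[ℂ] S)
    (x z u v : R) :
    φ.mapMatrix (chainLoop x z u v) = chainLoop (φ x) (φ z) (φ u) (φ v) := by
  ext i j
  fin_cases i <;> fin_cases j <;> simp [chainLoop, map_ofNat]

theorem derivAt_chainLoop [Algebra ℂ R] (φ : Poly 2 2 →ₐ[ℂ] R) (i : Fin 2 ⊕ Fin 2)
    (x z u v : Poly 2 2) :
    derivAt φ i (chainLoop x z u v) = chainLoopDiff (φ x) (φ u) (φ v) (φ (pderiv i x))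
      (φ (pderiv i z)) (φ (pderiv i u)) (φ (pderiv i v)) := by
  ext1 j k
  rw [derivAt_apply]
  fin_cases j <;> fin_cases k <;>
    simp only [chainLoop, chainLoopDiff, Matrix.of_apply, Matrix.cons_val', Matrix.cons_val_zero,
      Matrix.cons_val_one, Matrix.cons_val, Fin.zero_eta, Fin.mk_one, Fin.reduceFinMk,
      map_add, map_sub, map_mul, map_pow, map_ofNat, map_zero, pderiv_mul, pderiv_pow,
      pderiv_ofNat, Nat.cast_ofNat]
  all_goals ring

theorem trace_chainLoop_left (x z : R) :
    Matrix.trace (chainLoopDiff x 0 0 1 0 0 0 *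
      adjugatePolar (chainLoop x z 0 0) (chainLoopDiff x 0 0 0 1 0 0) *
      (chainLoopDiff x 0 0 0 0 1 0 *
        adjugatePolar (chainLoop x z 0 0) (chainLoopDiff x 0 0 0 0 0 1))) -
    Matrix.trace (adjugatePolar (chainLoop x z 0 0) (chainLoopDiff x 0 0 1 0 0 0) *
      chainLoopDiff x 0 0 0 1 0 0 *
      (adjugatePolar (chainLoop x z 0 0) (chainLoopDiff x 0 0 0 0 1 0) *
        chainLoopDiff x 0 0 0 0 0 1)) =
      10 * x ^ 18 - 20 * x ^ 13 * z + 30 * x ^ 8 * z ^ 2 := by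
  simp [adjugatePolar, chainLoop, chainLoopDiff, Matrix.trace_fin_three]
  ring

theorem trace_chainLoop_right (u v : R) :
    Matrix.trace (chainLoopDiff 0 u v 1 0 0 0 *
      adjugatePolar (chainLoop 0 0 u v) (chainLoopDiff 0 u v 0 1 0 0) *
      (chainLoopDiff 0 u v 0 0 1 0 *
        adjugatePolar (chainLoop 0 0 u v) (chainLoopDiff 0 u v 0 0 0 1))) -
    Matrix.trace (adjugatePolar (chainLoop 0 0 u v) (chainLoopDiff 0 u v 1 0 0 0) *
      chainLoopDiff 0 u v 0 1 0 0 *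
      (adjugatePolar (chainLoop 0 0 u v) (chainLoopDiff 0 u v 0 0 1 0) *
        chainLoopDiff 0 u v 0 0 0 1)) =
      6 * u ^ 3 * v ^ 3 + 30 * u ^ 2 * v ^ 6 - 2 * u * v ^ 9 + 10 * v ^ 12 := by
  simp [adjugatePolar, chainLoop, chainLoopDiff, Matrix.trace_fin_three]
  ring

/-- `chainLoop` for rescaled variables of `ℂ[x₁, x₂, y₁, y₂]`. -/
noncomputable def polyChainLoop (ζ a b : ℂ) : Matrix (Fin 3) (Fin 3) (Poly 2 2) :=
  chainLoop (C ζ * X (Sum.inl 0)) (X (Sum.inl 1)) (C a * X (Sum.inr 0)) (C b * X (Sum.inr 1))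

variable {ζ a b : ℂ}

theorem map_strDeriv_polyChainLoop [Algebra ℂ R] (φ : Poly 2 2 →ₐ[ℂ] R) {x z u v : R}
    (hx : φ (C ζ * X (Sum.inl 0)) = x) (hz : φ (X (Sum.inl 1)) = z)
    (hu : φ (C a * X (Sum.inr 0)) = u) (hv : φ (C b * X (Sum.inr 1)) = v) :
    φ (strDeriv (polyChainLoop ζ a b) (polyChainLoop ζ a b).adjugate) =
      φ (C ζ) * 1 * (φ (C a) * φ (C b)) *
      (Matrix.trace (chainLoopDiff x u v 1 0 0 0 *
        adjugatePolar (chainLoop x z u v) (chainLoopDiff x u v 0 1 0 0) *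
        (chainLoopDiff x u v 0 0 1 0 *
          adjugatePolar (chainLoop x z u v) (chainLoopDiff x u v 0 0 0 1))) -
      Matrix.trace (adjugatePolar (chainLoop x z u v) (chainLoopDiff x u v 1 0 0 0) *
        chainLoopDiff x u v 0 1 0 0 *
        (adjugatePolar (chainLoop x z u v) (chainLoopDiff x u v 0 0 1 0) *
          chainLoopDiff x u v 0 0 0 1))) := by
  apply map_strDeriv_adjugate
  · rw [polyChainLoop, mapMatrix_chainLoop, hx, hz, hu, hv]
  all_goals
    rw [polyChainLoop, derivAt_chainLoop, hx, hu, hv, ← chainLoopDiff_mul]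
    simp only [pderiv_C_mul, pderiv_X, Pi.single_apply, Sum.inl.injEq, Sum.inr.injEq,
      Fin.reduceEq, reduceCtorEq, if_true, if_false, map_one, map_zero, mul_zero, mul_one]

theorem strDeriv_polyChainLoop_left :
    aeval (Sum.elim X 0 : _ → MvPolynomial (Fin 2) ℂ)
      (strDeriv (polyChainLoop ζ a b) (polyChainLoop ζ a b).adjugate) =
    C (ζ * a * b) * (10 * (C ζ * X 0) ^ 18 - 20 * (C ζ * X 0) ^ 13 * X 1 +
      30 * (C ζ * X 0) ^ 8 * X 1 ^ 2) := by
  rw [map_strDeriv_polyChainLoop (x := C ζ * X 0) (z := X 1) (u := 0) (v := 0) _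
    (by simp [algebraMap_eq]) (by simp) (by simp) (by simp), trace_chainLoop_left]
  simp only [aeval_C, algebraMap_eq, map_mul]
  ring

theorem strDeriv_polyChainLoop_right :
    aeval (Sum.elim 0 X : _ → MvPolynomial (Fin 2) ℂ)
      (strDeriv (polyChainLoop ζ a b) (polyChainLoop ζ a b).adjugate) =
    C (ζ * a * b) * (6 * (C a * X 0) ^ 3 * (C b * X 1) ^ 3 +
      30 * (C a * X 0) ^ 2 * (C b * X 1) ^ 6 - 2 * (C a * X 0) * (C b * X 1) ^ 9 +
      10 * (C b * X 1) ^ 12) := by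
  rw [map_strDeriv_polyChainLoop (x := 0) (z := 0) (u := C a * X 0) (v := C b * X 1) _
    (by simp) (by simp) (by simp [algebraMap_eq]) (by simp [algebraMap_eq]), trace_chainLoop_right]
  simp only [aeval_C, algebraMap_eq, map_mul]
  ring


theorem isResidueDatum_chain : IsResidueDatum
    (fun i => pderiv i (X 0 ^ 10 * X 1 + X 1 ^ 3 : MvPolynomial (Fin 2) ℂ)) (exponent ![18, 2])
    !![-9 * C 30⁻¹ * X 1, X 0 ^ 9; -C 30⁻¹ * X 0, 10 * C 30⁻¹ * X 1] := by
  have h : (C 30⁻¹ * 30 : MvPolynomial (Fin 2) ℂ) = 1 := by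
    rw [← map_ofNat C 30, ← map_mul]; norm_num
  intro i
  fin_cases i
  · simp [Fin.sum_univ_two, pderiv_X]
    linear_combination (3 * X 0 ^ 9 * X 1 ^ 2) * h
  · simp [Fin.sum_univ_two, pderiv_X]
    linear_combination (-X 1 ^ 3) * h

theorem isResidueDatum_loop : IsResidueDatum
    (fun i => pderiv i (X 0 * X 1 ^ 7 + X 0 ^ 3 * X 1 : MvPolynomial (Fin 2) ℂ))
    (exponent ![4, 12])
    !![-49 * C 20⁻¹ * X 0 * X 1 ^ 5, X 0 ^ 2 + 7 * C 20⁻¹ * X 1 ^ 6;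
      X 1 ^ 6 + 3 * C 20⁻¹ * X 0 ^ 2, -9 * C 20⁻¹ * X 0 * X 1] := by
  have h : (C 20⁻¹ * 20 : MvPolynomial (Fin 2) ℂ) = 1 := by
    rw [← map_ofNat C 20, ← map_mul]; norm_num
  intro i
  fin_cases i
  · simp [Fin.sum_univ_two, pderiv_X]
    linear_combination (7 * X 0 ^ 3 * X 1 ^ 6) * h
  · simp [Fin.sum_univ_two, pderiv_X]
    linear_combination (3 * X 0 ^ 2 * X 1 ^ 7) * h

theorem isPotential_chain : IsPotential ![2 / 15, 2 / 3] (X 0 ^ 10 * X 1 + X 1 ^ 3) := by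
  refine .of_isResidueDatum isResidueDatum_chain (by simp [Fin.forall_fin_two]) ?_ ?_
  · refine .add (isWeightedHomogeneous_mul_X (isWeightedHomogeneous_X_pow ?_))
      (isWeightedHomogeneous_X_pow ?_) <;> norm_num
  · convert add_mem (X_mul_X_mul_mem_sq 0 1 (X 0 ^ 9)) (X_mul_X_mul_mem_sq 1 1 (X 1)) using 1
    ring

theorem isPotential_loop : IsPotential ![3 / 5, 1 / 5] (X 0 * X 1 ^ 7 + X 0 ^ 3 * X 1) := by
  refine .of_isResidueDatum isResidueDatum_loop (by simp [Fin.forall_fin_two]) ?_ ?_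
  · refine .add (isWeightedHomogeneous_mul_X_pow (isWeightedHomogeneous_X' ?_))
      (isWeightedHomogeneous_mul_X (isWeightedHomogeneous_X_pow ?_)) <;> norm_num
  · convert add_mem (X_mul_X_mul_mem_sq 0 1 (X 1 ^ 6)) (X_mul_X_mul_mem_sq 0 1 (X 0 ^ 2)) using 1
    ring

theorem isGradedFactorisation_chainLoop {ζ a b : ℂ} (hζ : ζ ^ 10 = -1) (hab : a ^ 3 * b = -1)
    (hab' : a * b ^ 7 = 1) :
    IsGradedFactorisation ![2 / 15, 2 / 3] ![3 / 5, 1 / 5] (X 0 ^ 10 * X 1 + X 1 ^ 3)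
      (X 0 * X 1 ^ 7 + X 0 ^ 3 * X 1) (polyChainLoop ζ a b) (polyChainLoop ζ a b).adjugate := by
  have h₁ : (C ζ : Poly 2 2) ^ 10 = -1 := by rw [← map_pow, hζ, map_neg, map_one]
  have h₂ : (C a : Poly 2 2) ^ 3 * C b = -1 := by
    rw [← map_pow, ← map_mul, hab, map_neg, map_one]
  have h₃ : (C a : Poly 2 2) * C b ^ 7 = 1 := by rw [← map_pow, ← map_mul, hab', map_one]
  refine .of_det ?_ ![1 / 3, 4 / 15, 1 / 5] ![0, -1 / 15, -2 / 15] ?_ ?_ ?_ ?_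
  · rw [polyChainLoop, det_chainLoop]
    simp [difference]
    linear_combination (-X (Sum.inl 0) ^ 10 * X (Sum.inl 1)) * h₁ +
      (X (Sum.inr 0) ^ 3 * X (Sum.inr 1)) * h₂ - (X (Sum.inr 0) * X (Sum.inr 1) ^ 7) * h₃
  · refine isWeightedHomogeneous_chainLoop ?_ ?_ ?_ ?_
    · exact isWeightedHomogeneous_mul_X (isWeightedHomogeneous_C' (by norm_num))
    · exact isWeightedHomogeneous_X' (by norm_num)
    · exact isWeightedHomogeneous_mul_X (isWeightedHomogeneous_C' (by norm_num))
    · exact isWeightedHomogeneous_mul_X (isWeightedHomogeneous_C' (by norm_num))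
  · simp; norm_num
  · simp [Fin.forall_fin_succ]; norm_num
  · simp [Fin.forall_fin_succ]; norm_num

theorem hasTrueOrbifoldEquivalence_chainLoop : HasTrueOrbifoldEquivalence 3 (6 / 5)
    (X 0 ^ 10 * X 1 + X 1 ^ 3 : MvPolynomial (Fin 2) ℂ)
    (X 0 * X 1 ^ 7 + X 0 ^ 3 * X 1 : MvPolynomial (Fin 2) ℂ) := by
  obtain ⟨b, hb⟩ := IsAlgClosed.exists_pow_nat_eq (-1 : ℂ) (n := 20) (by norm_num)
  obtain ⟨ζ, a, hζ, hab, hab'⟩ : ∃ ζ a : ℂ, ζ ^ 10 = -1 ∧ a ^ 3 * b = -1 ∧ a * b ^ 7 = 1 := by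
    refine ⟨b ^ 2, -b ^ 13, ?_, ?_, ?_⟩
    · linear_combination hb
    · linear_combination (1 - b ^ 20) * hb
    · linear_combination -hb
  have hq : -2 * a * b * ζ ^ 9 * (-(3 / 2) * ζ * a * b * (a ^ 2 * b ^ 6 - b ^ 12)) = 6 := by
    linear_combination 3 * a ^ 2 * b ^ 2 * (a ^ 2 * b ^ 6 - b ^ 12) * hζ
      - 3 * (a * b ^ 7) * hab + 3 * (a * b ^ 7 + 2) * hab'
  refine .of_isGradedFactorisation (isGradedFactorisation_chainLoop hζ hab hab')
    isPotential_chain isPotential_loop ?_ ?_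
    isResidueDatum_chain (e₁ := 4 / 3) (D₁ := C 30⁻¹ * X 0 ^ 10 - C 10⁻¹ * X 1 ^ 2) ?_ ?_ ?_
    isResidueDatum_loop (e₂ := 12 / 5)
    (D₂ := C 20⁻¹ * X 0 ^ 2 * X 1 ^ 6 - C (3 / 20) * X 0 ^ 4 - C (7 / 20) * X 1 ^ 12) ?_ ?_ ?_
    strDeriv_polyChainLoop_left strDeriv_polyChainLoop_right
    (qL := -2 * a * b * ζ ^ 9) (qR := -(3 / 2) * ζ * a * b * (a ^ 2 * b ^ 6 - b ^ 12))
    ?_ ?_ ?_ ?_ ?_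
  · simp [centralCharge]; norm_num
  · simp [centralCharge]; norm_num
  · have h : (C 30⁻¹ * 30 : MvPolynomial (Fin 2) ℂ) = 1 := by
      rw [← map_ofNat C 30, ← map_mul]; norm_num
    have h' : (C 10⁻¹ : MvPolynomial (Fin 2) ℂ) = 3 * C 30⁻¹ := by
      rw [← map_ofNat C 3, ← map_mul]; norm_num
    rw [Matrix.det_fin_two_of, h']
    linear_combination (-3 * C 30⁻¹ * X 1 ^ 2) * h
  · exact .sub (isWeightedHomogeneous_mul_X_pow (isWeightedHomogeneous_C' (by norm_num)))
      (isWeightedHomogeneous_mul_X_pow (isWeightedHomogeneous_C' (by norm_num)))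
  · simp [weight_exponent]; norm_num
  · have h : (C 20⁻¹ * 20 : MvPolynomial (Fin 2) ℂ) = 1 := by
      rw [← map_ofNat C 20, ← map_mul]; norm_num
    have h' : (C (3 / 20) : MvPolynomial (Fin 2) ℂ) = 3 * C 20⁻¹ := by
      rw [← map_ofNat C 3, ← map_mul]; norm_num
    have h'' : (C (7 / 20) : MvPolynomial (Fin 2) ℂ) = 7 * C 20⁻¹ := by
      rw [← map_ofNat C 7, ← map_mul]; norm_num
    rw [Matrix.det_fin_two_of, h', h'']
    linear_combination (21 * C 20⁻¹ + 1) * X 0 ^ 2 * X 1 ^ 6 * h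
  · exact .sub (.sub
      (isWeightedHomogeneous_mul_X_pow (isWeightedHomogeneous_mul_X_pow
        (isWeightedHomogeneous_C' (by norm_num))))
      (isWeightedHomogeneous_mul_X_pow (isWeightedHomogeneous_C' (by norm_num))))
      (isWeightedHomogeneous_mul_X_pow (isWeightedHomogeneous_C' (by norm_num)))
  · simp [weight_exponent]; norm_num
  · trans (-1) ^ (2 + 1).choose 2 * coeff (exponent ![18, 2])
      (C (30⁻¹ * (ζ * a * b * (10 * ζ ^ 18))) * (X 0 ^ 28 * X 1 ^ 0) +
        C (30⁻¹ * (ζ * a * b * (-20 * ζ ^ 13))) * (X 0 ^ 23 * X 1 ^ 1) +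
        C (30⁻¹ * (ζ * a * b * (30 * ζ ^ 8))) * (X 0 ^ 18 * X 1 ^ 2) +
        C (-10⁻¹ * (ζ * a * b * (10 * ζ ^ 18))) * (X 0 ^ 18 * X 1 ^ 2) +
        C (-10⁻¹ * (ζ * a * b * (-20 * ζ ^ 13))) * (X 0 ^ 13 * X 1 ^ 3) +
        C (-10⁻¹ * (ζ * a * b * (30 * ζ ^ 8))) * (X 0 ^ 8 * X 1 ^ 4) : MvPolynomial (Fin 2) ℂ)
    · congr! 2
      simp [map_ofNat]
      ring
    · simp only [coeff_add, coeff_C_mul, coeff_X_pow_mul_X_pow]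
      simp
      linear_combination (ζ ^ 9 * a * b) * hζ
  · trans (-1) ^ (2 + 1).choose 2 * coeff (exponent ![4, 12])
      (C (20⁻¹ * (ζ * a * b * (6 * (a ^ 3 * b ^ 3)))) * (X 0 ^ 5 * X 1 ^ 9) +
        C (20⁻¹ * (ζ * a * b * (30 * (a ^ 2 * b ^ 6)))) * (X 0 ^ 4 * X 1 ^ 12) +
        C (20⁻¹ * (ζ * a * b * (-2 * (a * b ^ 9)))) * (X 0 ^ 3 * X 1 ^ 15) +
        C (20⁻¹ * (ζ * a * b * (10 * b ^ 12))) * (X 0 ^ 2 * X 1 ^ 18) +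
        C (-(3 / 20) * (ζ * a * b * (6 * (a ^ 3 * b ^ 3)))) * (X 0 ^ 7 * X 1 ^ 3) +
        C (-(3 / 20) * (ζ * a * b * (30 * (a ^ 2 * b ^ 6)))) * (X 0 ^ 6 * X 1 ^ 6) +
        C (-(3 / 20) * (ζ * a * b * (-2 * (a * b ^ 9)))) * (X 0 ^ 5 * X 1 ^ 9) +
        C (-(3 / 20) * (ζ * a * b * (10 * b ^ 12))) * (X 0 ^ 4 * X 1 ^ 12) +
        C (-(7 / 20) * (ζ * a * b * (6 * (a ^ 3 * b ^ 3)))) * (X 0 ^ 3 * X 1 ^ 15) +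
        C (-(7 / 20) * (ζ * a * b * (30 * (a ^ 2 * b ^ 6)))) * (X 0 ^ 2 * X 1 ^ 18) +
        C (-(7 / 20) * (ζ * a * b * (-2 * (a * b ^ 9)))) * (X 0 ^ 1 * X 1 ^ 21) +
        C (-(7 / 20) * (ζ * a * b * (10 * b ^ 12))) * (X 0 ^ 0 * X 1 ^ 24) : MvPolynomial (Fin 2) ℂ)
    · congr! 2
      simp [map_ofNat]
      ring
    · simp only [coeff_add, coeff_C_mul, coeff_X_pow_mul_X_pow]
      simp
      ring
  · rw [hq]; norm_num
  · rw [hq]; norm_num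
  · rw [hq]; norm_num

end ChainLoop

/-! ### `S₁₁` and `W₁₃` -/

section S11

section

variable {R : Type*} [CommRing R]

/-- The matrix `A` for which `y ± A` is the tensor product of the Koszul factorisations of
`y ^ 2 - c ^ 2`, `a₁ * b₁` and `a₂ * b₂`. -/
def koszul (c a₁ b₁ a₂ b₂ : R) : Matrix (Fin 4) (Fin 4) R :=
  !![c, a₁, a₂, 0; -b₁, -c, 0, a₂; -b₂, 0, -c, -a₁; 0, -b₂, b₁, c]

theorem koszul_mul_self (c a₁ b₁ a₂ b₂ : R) : koszul c a₁ b₁ a₂ b₂ * koszul c a₁ b₁ a₂ b₂ =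
    Matrix.scalar (Fin 4) (c ^ 2 - a₁ * b₁ - a₂ * b₂) := by
  ext i j
  fin_cases i <;> fin_cases j <;> simp [koszul, Matrix.mul_apply, Fin.sum_univ_four]
  all_goals ring

variable [Algebra ℂ R] {n m : ℕ}

theorem derivAt_koszul (φ : Poly n m →ₐ[ℂ] R) (v : Fin n ⊕ Fin m) (c a₁ b₁ a₂ b₂ : Poly n m) :
    derivAt φ v (koszul c a₁ b₁ a₂ b₂) = koszul (φ (pderiv v c)) (φ (pderiv v a₁))
      (φ (pderiv v b₁)) (φ (pderiv v a₂)) (φ (pderiv v b₂)) := by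
  ext i j
  fin_cases i <;> fin_cases j <;> simp [derivAt, koszul]

end

theorem isResidueDatum_S11 : IsResidueDatum
    (fun i => pderiv i (X 0 ^ 2 * X 2 + X 1 * X 2 ^ 2 + X 1 ^ 4 : MvPolynomial (Fin 3) ℂ))
    (exponent ![2, 4, 3])
    !![-X 1, 0, X 0;
      C 16⁻¹ * X 0 * X 1, 4 * C 16⁻¹ * X 1 ^ 2, -2 * C 16⁻¹ * X 1 * X 2;
      X 0 * X 1 ^ 2, X 2 ^ 2, -2 * X 1 ^ 2 * X 2] := by
  have h : (C 16⁻¹ * 16 : MvPolynomial (Fin 3) ℂ) = 1 := by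
    rw [← map_ofNat C 16, ← map_mul]; norm_num
  intro i
  fin_cases i
  · simp [Fin.sum_univ_three, pderiv_X]
    ring
  · simp [Fin.sum_univ_three, pderiv_X]
    linear_combination (-X 1 ^ 5) * h
  · simp [Fin.sum_univ_three, pderiv_X]
    ring

theorem isResidueDatum_W13 : IsResidueDatum
    (fun i => pderiv i (-X 0 ^ 2 + X 1 ^ 4 + X 1 * X 2 ^ 4 : MvPolynomial (Fin 3) ℂ))
    (exponent ![0, 3, 6])
    !![-C 2⁻¹, 0, 0; 0, 4 * C 16⁻¹ * X 1, -C 16⁻¹ * X 2; 0, X 2 ^ 3, -X 1 ^ 2] := by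
  have h : (C 16⁻¹ * 16 : MvPolynomial (Fin 3) ℂ) = 1 := by
    rw [← map_ofNat C 16, ← map_mul]; norm_num
  have h2 : (C 2⁻¹ * 2 : MvPolynomial (Fin 3) ℂ) = 1 := by
    rw [← map_ofNat C 2, ← map_mul]; norm_num
  intro i
  fin_cases i
  · simp [Fin.sum_univ_three, pderiv_X]
    linear_combination (-X 0) * h2
  · simp [Fin.sum_univ_three, pderiv_X]
    linear_combination (-X 1 ^ 4) * h
  · simp [Fin.sum_univ_three, pderiv_X]
    ring

theorem isPotential_S11 : IsPotential ![5 / 8, 1 / 2, 3 / 4]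
    (X 0 ^ 2 * X 2 + X 1 * X 2 ^ 2 + X 1 ^ 4) := by
  refine .of_isResidueDatum isResidueDatum_S11 (by simp [Fin.forall_fin_succ]) ?_ ?_
  · refine .add (.add (isWeightedHomogeneous_mul_X (isWeightedHomogeneous_X_pow ?_))
      (isWeightedHomogeneous_mul_X_pow (isWeightedHomogeneous_X' ?_)))
      (isWeightedHomogeneous_X_pow ?_) <;> simp <;> norm_num
  · convert add_mem (add_mem (X_mul_X_mul_mem_sq 0 0 (X 2)) (X_mul_X_mul_mem_sq 1 2 (X 2)))
      (X_mul_X_mul_mem_sq 1 1 (X 1 ^ 2)) using 1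
    ring

theorem isPotential_W13 : IsPotential ![1, 1 / 2, 3 / 8]
    (-X 0 ^ 2 + X 1 ^ 4 + X 1 * X 2 ^ 4) := by
  refine .of_isResidueDatum isResidueDatum_W13 (by simp [Fin.forall_fin_succ]) ?_ ?_
  · refine .add (.add (.neg (isWeightedHomogeneous_X_pow ?_)) (isWeightedHomogeneous_X_pow ?_))
      (isWeightedHomogeneous_mul_X_pow (isWeightedHomogeneous_X' ?_)) <;> simp <;> norm_num
  · convert add_mem (add_mem (X_mul_X_mul_mem_sq 0 0 (-1)) (X_mul_X_mul_mem_sq 1 1 (X 1 ^ 2)))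
      (X_mul_X_mul_mem_sq 1 2 (X 2 ^ 3)) using 1
    ring

/-- The Koszul matrix for the difference of the potentials of `S₁₁` and `W₁₃`. -/
noncomputable def koszulS11 : Matrix (Fin 4) (Fin 4) (Poly 3 3) :=
  koszul (C Complex.I * X (Sum.inl 0) * X (Sum.inr 2)) (X (Sum.inl 1) - X (Sum.inr 1))
    (X (Sum.inr 2) ^ 4 + X (Sum.inl 1) ^ 3 + X (Sum.inl 1) ^ 2 * X (Sum.inr 1) +
      X (Sum.inl 1) * X (Sum.inr 1) ^ 2 + X (Sum.inr 1) ^ 3)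
    (X (Sum.inl 2) - X (Sum.inr 2) ^ 2)
    (X (Sum.inl 0) ^ 2 + X (Sum.inl 1) * X (Sum.inl 2) + X (Sum.inl 1) * X (Sum.inr 2) ^ 2)

theorem isGradedFactorisation_S11 :
    IsGradedFactorisation ![5 / 8, 1 / 2, 3 / 4] ![1, 1 / 2, 3 / 8]
      (X 0 ^ 2 * X 2 + X 1 * X 2 ^ 2 + X 1 ^ 4) (-X 0 ^ 2 + X 1 ^ 4 + X 1 * X 2 ^ 4)
      (Matrix.scalar (Fin 4) (X (Sum.inr 0) : Poly 3 3) + koszulS11)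
      (Matrix.scalar (Fin 4) (X (Sum.inr 0) : Poly 3 3) - koszulS11) := by
  have hI : (C Complex.I : Poly 3 3) ^ 2 = -1 := by
    rw [← map_pow, Complex.I_sq, map_neg, map_one]
  refine .of_sq (koszul_mul_self _ _ _ _ _) ?_ ?_ ![3 / 4, 1 / 4, 1 / 2, 0] ?_ ?_
  · simp [difference]
    linear_combination (-X (Sum.inl 0) ^ 2 * X (Sum.inr 2) ^ 2) * hI
  · exact isWeightedHomogeneous_X' (by simp)
  · intro i j
    fin_cases i <;> fin_cases j <;> simp only [koszulS11, koszul, Matrix.of_apply,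
      Matrix.cons_val', Matrix.cons_val_zero, Matrix.cons_val_one, Matrix.cons_val,
      Fin.zero_eta, Fin.mk_one, Fin.reduceFinMk]
    all_goals
      repeat' with_reducible_and_instances first
        | exact isWeightedHomogeneous_zero _ _ _
        | apply IsWeightedHomogeneous.add
        | apply IsWeightedHomogeneous.sub
        | apply IsWeightedHomogeneous.neg
        | apply isWeightedHomogeneous_X'
        | apply isWeightedHomogeneous_X_pow
        | apply isWeightedHomogeneous_C'
        | apply isWeightedHomogeneous_mul_X
        | apply isWeightedHomogeneous_mul_X_pow
    all_goals simp
    all_goals norm_num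
  · simp [Fin.forall_fin_succ]
    norm_num

theorem strDeriv_S11_left : aeval (Sum.elim X 0 : _ → MvPolynomial (Fin 3) ℂ)
    (strDeriv (Matrix.scalar (Fin 4) (X (Sum.inr 0) : Poly 3 3) + koszulS11)
      (Matrix.scalar (Fin 4) (X (Sum.inr 0) : Poly 3 3) - koszulS11)) =
    C (16 * Complex.I) * (X 0 ^ 2 * X 1 ^ 2 * X 2 ^ 0) := by
  have h0 : derivAt (aeval (Sum.elim X 0 : _ → MvPolynomial (Fin 3) ℂ)) (Sum.inr 0) koszulS11 =
      0 := by
    ext i j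
    fin_cases i <;> fin_cases j <;> simp [derivAt, koszulS11, koszul, pderiv_X]
  rw [map_strDeriv_three_of_sq' _ _ h0]
  simp [koszulS11, derivAt_koszul, pderiv_X, algebraMap_eq, map_ofNat]
  simp [koszul, Matrix.trace, Fin.sum_univ_four]
  ring

theorem strDeriv_S11_right : aeval (Sum.elim 0 X : _ → MvPolynomial (Fin 3) ℂ)
    (strDeriv (Matrix.scalar (Fin 4) (X (Sum.inr 0) : Poly 3 3) + koszulS11)
      (Matrix.scalar (Fin 4) (X (Sum.inr 0) : Poly 3 3) - koszulS11)) =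
    C (8 * Complex.I) * (X 0 ^ 0 * X 1 ^ 0 * X 2 ^ 6) := by
  have h0 : derivAt (aeval (Sum.elim 0 X : _ → MvPolynomial (Fin 3) ℂ)) (Sum.inr 0) koszulS11 =
      0 := by
    ext i j
    fin_cases i <;> fin_cases j <;> simp [derivAt, koszulS11, koszul, pderiv_X]
  rw [map_strDeriv_three_of_sq' _ _ h0]
  simp [koszulS11, derivAt_koszul, pderiv_X, algebraMap_eq, map_ofNat]
  simp [koszul, Matrix.trace, Fin.sum_univ_four]
  ring

theorem hasTrueOrbifoldEquivalence_S11 : HasTrueOrbifoldEquivalence 4 (9 / 8)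
    (X 0 ^ 2 * X 2 + X 1 * X 2 ^ 2 + X 1 ^ 4 : MvPolynomial (Fin 3) ℂ)
    (-X 0 ^ 2 + X 1 ^ 4 + X 1 * X 2 ^ 4 : MvPolynomial (Fin 3) ℂ) := by
  have hq : -2 * Complex.I * Complex.I = 2 := by linear_combination -2 * Complex.I_sq
  refine .of_isGradedFactorisation isGradedFactorisation_S11 isPotential_S11 isPotential_W13 ?_ ?_
    isResidueDatum_S11 (e₁ := 13 / 4) (D₁ := C 2⁻¹ * X 1 ^ 5 * X 2 - C 8⁻¹ * X 1 ^ 2 * X 2 ^ 3 +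
      C 16⁻¹ * X 0 ^ 2 * X 1 * X 2 ^ 2 - C 4⁻¹ * X 0 ^ 2 * X 1 ^ 4) ?_ ?_ ?_
    isResidueDatum_W13 (e₂ := 3 / 2) (D₂ := C 8⁻¹ * X 1 ^ 3 - C 32⁻¹ * X 2 ^ 4) ?_ ?_ ?_
    strDeriv_S11_left strDeriv_S11_right (qL := -2 * Complex.I) (qR := Complex.I) ?_ ?_ ?_ ?_ ?_
  · simp [centralCharge, Fin.sum_univ_three]; norm_num
  · simp [centralCharge, Fin.sum_univ_three]; norm_num
  · have h2 : (C 2⁻¹ : MvPolynomial (Fin 3) ℂ) = 8 * C 16⁻¹ := by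
      rw [← map_ofNat C 8, ← map_mul]; norm_num
    have h8 : (C 8⁻¹ : MvPolynomial (Fin 3) ℂ) = 2 * C 16⁻¹ := by
      rw [← map_ofNat C 2, ← map_mul]; norm_num
    have h4 : (C 4⁻¹ : MvPolynomial (Fin 3) ℂ) = 4 * C 16⁻¹ := by
      rw [← map_ofNat C 4, ← map_mul]; norm_num
    rw [h2, h8, h4]
    simp [Matrix.det_fin_three]
    ring
  · exact .sub (.add (.sub
      (isWeightedHomogeneous_mul_X (isWeightedHomogeneous_mul_X_pow
        (isWeightedHomogeneous_C' (by simp; norm_num))))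
      (isWeightedHomogeneous_mul_X_pow (isWeightedHomogeneous_mul_X_pow
        (isWeightedHomogeneous_C' (by simp; norm_num)))))
      (isWeightedHomogeneous_mul_X_pow (isWeightedHomogeneous_mul_X
        (isWeightedHomogeneous_mul_X_pow (isWeightedHomogeneous_C' (by simp; norm_num))))))
      (isWeightedHomogeneous_mul_X_pow (isWeightedHomogeneous_mul_X_pow
        (isWeightedHomogeneous_C' (by simp; norm_num))))
  · simp [weight_exponent, Fin.sum_univ_three]; norm_num
  · have h8 : (C 8⁻¹ : MvPolynomial (Fin 3) ℂ) = C 2⁻¹ * (4 * C 16⁻¹) := by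
      rw [← map_ofNat C 4, ← map_mul, ← map_mul]; norm_num
    have h32 : (C 32⁻¹ : MvPolynomial (Fin 3) ℂ) = C 2⁻¹ * C 16⁻¹ := by
      rw [← map_mul]; norm_num
    rw [h8, h32]
    simp [Matrix.det_fin_three]
    ring
  · exact .sub (isWeightedHomogeneous_mul_X_pow (isWeightedHomogeneous_C' (by norm_num)))
      (isWeightedHomogeneous_mul_X_pow (isWeightedHomogeneous_C' (by simp; norm_num)))
  · simp [weight_exponent, Fin.sum_univ_three]; norm_num
  · trans (-1) ^ (3 + 1).choose 2 * coeff (exponent ![2, 4, 3])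
      (C (2⁻¹ * (16 * Complex.I)) * (X 0 ^ 2 * X 1 ^ 7 * X 2 ^ 1) +
        C (-8⁻¹ * (16 * Complex.I)) * (X 0 ^ 2 * X 1 ^ 4 * X 2 ^ 3) +
        C (16⁻¹ * (16 * Complex.I)) * (X 0 ^ 4 * X 1 ^ 3 * X 2 ^ 2) +
        C (-4⁻¹ * (16 * Complex.I)) * (X 0 ^ 4 * X 1 ^ 6 * X 2 ^ 0) : MvPolynomial (Fin 3) ℂ)
    · congr! 2
      simp only [map_mul, map_neg, map_ofNat]
      ring
    · simp only [coeff_add, coeff_C_mul, coeff_X_pow_mul_X_pow_mul_X_pow]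
      simp [Nat.choose]
      ring
  · trans (-1) ^ (3 + 1).choose 2 * coeff (exponent ![0, 3, 6])
      (C (8⁻¹ * (8 * Complex.I)) * (X 0 ^ 0 * X 1 ^ 3 * X 2 ^ 6) +
        C (-32⁻¹ * (8 * Complex.I)) * (X 0 ^ 0 * X 1 ^ 0 * X 2 ^ 10) : MvPolynomial (Fin 3) ℂ)
    · congr! 2
      simp only [map_mul, map_neg, map_ofNat]
      ring
    · simp only [coeff_add, coeff_C_mul, coeff_X_pow_mul_X_pow_mul_X_pow]
      simp [Nat.choose]
      ring
  · rw [hq]; norm_num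
  · rw [hq]; norm_num
  · rw [hq]; norm_num

end S11

/-! ### `Z₁₃` and `Q₁₁` -/

section Z13

section

variable {R : Type*} [CommRing R]

/-- A square root of the scalar matrix
`(8 - 24 u + 12 u ^ 2) x₁ ^ 6 + 4 u x₁ x₂ ^ 3 + y₁ ^ 2 y₃ + y₂ ^ 3 - y₂ y₃ ^ 3` where
`u ^ 3 = 3 u - 1`, for `p = 2 u - 2 u ^ 2`, `q = 2 u ^ 2 - 4 u`, `r = 2 u - 1`,
`s = 2 u - 1 - 2 u ^ 2` and `k = 4 u`. -/
def sqrtZ13 (p q r s k x₁ x₂ y₁ y₂ y₃ : R) : Matrix (Fin 6) (Fin 6) R :=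
  !![q * x₁ ^ 3 + r * x₁ * y₂,
      -x₂ ^ 2,
      p * x₁ ^ 2 * x₂ + x₂ * y₂,
      -p * x₁ ^ 4 + s * x₁ ^ 2 * y₂ - x₁ * x₂ * y₃ + x₂ * y₁ + y₂ ^ 2,
      -p * x₁ ^ 3 * y₃ - p * x₁ ^ 2 * y₁ + k * x₁ * x₂ ^ 2 - x₁ * y₂ * y₃ - x₂ * y₃ ^ 2 - y₁ * y₂,
      2 * p * x₁ ^ 3 * x₂ + 2 * x₁ * x₂ * y₂ + x₂ ^ 2 * y₃ + y₁ ^ 2 - y₂ * y₃ ^ 2;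
    0,
      q * x₁ ^ 3 + r * x₁ * y₂ - x₂ * y₃,
      0,
      -p * x₁ ^ 2 * x₂ - x₁ * y₃ ^ 2 - x₂ * y₂ + y₁ * y₃,
      p ^ 2 * x₁ ^ 4 + 2 * p * x₁ ^ 2 * y₂ + k * x₁ * x₂ * y₃ + y₂ ^ 2 - y₃ ^ 3,
      p * x₁ ^ 3 * y₃ - p * x₁ ^ 2 * y₁ - k * x₁ * x₂ ^ 2 + x₁ * y₂ * y₃ + x₂ * y₃ ^ 2 - y₁ * y₂;
    0,
      0,
      q * x₁ ^ 3 + r * x₁ * y₂ - x₂ * y₃,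
      x₁ ^ 2 * y₃ - x₂ ^ 2 - y₂ * y₃,
      p * x₁ ^ 2 * x₂ + x₁ * y₃ ^ 2 + x₂ * y₂ + y₁ * y₃,
      -p * x₁ ^ 4 + s * x₁ ^ 2 * y₂ - x₁ * x₂ * y₃ - x₂ * y₁ + y₂ ^ 2;
    p * x₁ ^ 2 + y₂,
      x₁ * y₃ + y₁,
      -k * x₁ * x₂ + y₃ ^ 2,
      -q * x₁ ^ 3 - r * x₁ * y₂ + x₂ * y₃,
      0,
      -p * x₁ ^ 2 * x₂ - x₂ * y₂;
    x₂,
      y₂ - x₁ ^ 2,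
      y₁ - x₁ * y₃,
      0,
      -q * x₁ ^ 3 - r * x₁ * y₂ + x₂ * y₃,
      -x₂ ^ 2;
    y₃,
      -x₂,
      p * x₁ ^ 2 + y₂,
      0,
      0,
      -q * x₁ ^ 3 - r * x₁ * y₂]

theorem sqrtZ13_mul_self {u p q r s k : R} (hu : u ^ 3 = 3 * u - 1) (hp : p = 2 * u - 2 * u ^ 2)
    (hq : q = 2 * u ^ 2 - 4 * u) (hr : r = 2 * u - 1) (hs : s = 2 * u - 1 - 2 * u ^ 2)
    (hk : k = 4 * u) (x₁ x₂ y₁ y₂ y₃ : R) :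
    sqrtZ13 p q r s k x₁ x₂ y₁ y₂ y₃ * sqrtZ13 p q r s k x₁ x₂ y₁ y₂ y₃ =
      Matrix.scalar (Fin 6) ((8 - 24 * u + 12 * u ^ 2) * x₁ ^ 6 + 4 * u * x₁ * x₂ ^ 3 +
        y₁ ^ 2 * y₃ + y₂ ^ 3 - y₂ * y₃ ^ 3) := by
  subst hp hq hr hs hk
  ext i j
  fin_cases i <;> fin_cases j <;>
    simp only [sqrtZ13, Matrix.mul_apply, Fin.sum_univ_six, Matrix.of_apply, Matrix.cons_val',
      Matrix.cons_val_zero, Matrix.cons_val_one, Matrix.cons_val, Fin.zero_eta, Fin.mk_one,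
      Fin.reduceFinMk, Matrix.scalar_apply, Matrix.diagonal_apply, Fin.reduceEq,
      Fin.isValue, reduceIte]
  all_goals
    first
    | ring1
    | linear_combination (-8 * x₁ ^ 6 + 4 * x₁ ^ 4 * y₂ * u) * hu

set_option maxHeartbeats 1000000 in
/-- The trace of the product of the derivatives of `sqrtZ13` at `y = 0`. The product is computed
pairwise, to keep the entries small. -/
theorem trace_sqrtZ13_left (p q r s k x₁ x₂ : R) :
    Matrix.trace (((!![3 * x₁ ^ 2 * q, 0, 2 * x₁ * x₂ * p, -4 * x₁ ^ 3 * p, x₂ ^ 2 * k,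
      6 * x₁ ^ 2 * x₂ * p;
      0, 3 * x₁ ^ 2 * q, 0, -2 * x₁ * x₂ * p, 4 * x₁ ^ 3 * p ^ 2, -x₂ ^ 2 * k;
      0, 0, 3 * x₁ ^ 2 * q, 0, 2 * x₁ * x₂ * p, -4 * x₁ ^ 3 * p;
      2 * x₁ * p, 0, -x₂ * k, -3 * x₁ ^ 2 * q, 0, -2 * x₁ * x₂ * p;
      0, -2 * x₁, 0, 0, -3 * x₁ ^ 2 * q, 0;
      0, 0, 2 * x₁ * p, 0, 0, -3 * x₁ ^ 2 * q] : Matrix _ _ R) *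
      !![0, -2 * x₂, x₁ ^ 2 * p, 0, 2 * x₁ * x₂ * k, 2 * x₁ ^ 3 * p;
      0, 0, 0, -x₁ ^ 2 * p, 0, -2 * x₁ * x₂ * k;
      0, 0, 0, -2 * x₂, x₁ ^ 2 * p, 0;
      0, 0, -x₁ * k, 0, 0, -x₁ ^ 2 * p;
      1, 0, 0, 0, 0, -2 * x₂;
      0, -1, 0, 0, 0, 0]) *
      (!![0, 0, 0, x₂, -x₁ ^ 2 * p, 0;
      0, 0, 0, 0, 0, -x₁ ^ 2 * p;
      0, 0, 0, 0, 0, -x₂;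
      0, 1, 0, 0, 0, 0;
      0, 0, 1, 0, 0, 0;
      0, 0, 0, 0, 0, 0] *
      (!![x₁ * r, 0, x₂, x₁ ^ 2 * s, 0, 2 * x₁ * x₂;
      0, x₁ * r, 0, -x₂, 2 * x₁ ^ 2 * p, 0;
      0, 0, x₁ * r, 0, x₂, x₁ ^ 2 * s;
      1, 0, 0, -x₁ * r, 0, -x₂;
      0, 1, 0, 0, -x₁ * r, 0;
      0, 0, 1, 0, 0, -x₁ * r] *
      !![0, 0, 0, -x₁ * x₂, -x₁ ^ 3 * p, x₂ ^ 2;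
      0, -x₂, 0, 0, x₁ * x₂ * k, x₁ ^ 3 * p;
      0, 0, -x₂, x₁ ^ 2, 0, -x₁ * x₂;
      0, x₁, 0, x₂, 0, 0;
      0, 0, -x₁, 0, x₂, 0;
      1, 0, 0, 0, 0, 0]))) =
      4 * x₁ ^ 5 * x₂ * p ^ 3 - 18 * x₁ ^ 5 * x₂ * p ^ 2 * r + 2 * x₁ ^ 5 * x₂ * p ^ 2 * s +
        8 * x₁ ^ 5 * x₂ * p ^ 2 - 6 * x₁ ^ 5 * x₂ * p * q * r + 3 * x₁ ^ 5 * x₂ * p * q * k +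
        18 * x₁ ^ 5 * x₂ * p * q + 9 * x₁ ^ 5 * x₂ * p * r * k + 6 * x₁ ^ 5 * x₂ * q * s * k -
        3 * x₁ ^ 5 * x₂ * q * k - 3 * x₂ ^ 4 * k := by
  have h₁ : (!![3 * x₁ ^ 2 * q, 0, 2 * x₁ * x₂ * p, -4 * x₁ ^ 3 * p, x₂ ^ 2 * k,
    6 * x₁ ^ 2 * x₂ * p;
      0, 3 * x₁ ^ 2 * q, 0, -2 * x₁ * x₂ * p, 4 * x₁ ^ 3 * p ^ 2, -x₂ ^ 2 * k;
      0, 0, 3 * x₁ ^ 2 * q, 0, 2 * x₁ * x₂ * p, -4 * x₁ ^ 3 * p;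
      2 * x₁ * p, 0, -x₂ * k, -3 * x₁ ^ 2 * q, 0, -2 * x₁ * x₂ * p;
      0, -2 * x₁, 0, 0, -3 * x₁ ^ 2 * q, 0;
      0, 0, 2 * x₁ * p, 0, 0, -3 * x₁ ^ 2 * q] : Matrix _ _ R) *
      !![0, -2 * x₂, x₁ ^ 2 * p, 0, 2 * x₁ * x₂ * k, 2 * x₁ ^ 3 * p;
      0, 0, 0, -x₁ ^ 2 * p, 0, -2 * x₁ * x₂ * k;
      0, 0, 0, -2 * x₂, x₁ ^ 2 * p, 0;
      0, 0, -x₁ * k, 0, 0, -x₁ ^ 2 * p;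
      1, 0, 0, 0, 0, -2 * x₂;
      0, -1, 0, 0, 0, 0] =
      !![x₂ ^ 2 * k, -6 * x₁ ^ 2 * x₂ * p - 6 * x₁ ^ 2 * x₂ * q, 3 * x₁ ^ 4 * p * q +
        4 * x₁ ^ 4 * p * k, -4 * x₁ * x₂ ^ 2 * p, 2 * x₁ ^ 3 * x₂ * p ^ 2 +
        6 * x₁ ^ 3 * x₂ * q * k, 4 * x₁ ^ 5 * p ^ 2 + 6 * x₁ ^ 5 * p * q - 2 * x₂ ^ 3 * k;
      4 * x₁ ^ 3 * p ^ 2, x₂ ^ 2 * k, 2 * x₁ ^ 2 * x₂ * p * k, -3 * x₁ ^ 4 * p * q, 0,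
        -6 * x₁ ^ 3 * x₂ * p ^ 2 - 6 * x₁ ^ 3 * x₂ * q * k;
      2 * x₁ * x₂ * p, 4 * x₁ ^ 3 * p, 0, -6 * x₁ ^ 2 * x₂ * q, 3 * x₁ ^ 4 * p * q,
        -4 * x₁ * x₂ ^ 2 * p;
      0, -2 * x₁ * x₂ * p, 2 * x₁ ^ 3 * p ^ 2 + 3 * x₁ ^ 3 * q * k, 2 * x₂ ^ 2 * k,
        3 * x₁ ^ 2 * x₂ * p * k, 4 * x₁ ^ 4 * p ^ 2 + 3 * x₁ ^ 4 * p * q;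
      -3 * x₁ ^ 2 * q, 0, 0, 2 * x₁ ^ 3 * p, 0, 6 * x₁ ^ 2 * x₂ * q + 4 * x₁ ^ 2 * x₂ * k;
      0, 3 * x₁ ^ 2 * q, 0, -4 * x₁ * x₂ * p, 2 * x₁ ^ 3 * p ^ 2, 0] := by
    ext i j
    fin_cases i <;> fin_cases j <;>
      simp only [Matrix.mul_apply, Fin.sum_univ_six, Matrix.of_apply, Matrix.cons_val',
        Matrix.cons_val_zero, Matrix.cons_val_one, Matrix.cons_val, Fin.zero_eta, Fin.mk_one,
        Fin.reduceFinMk]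
    all_goals ring
  have h₂ : (!![x₁ * r, 0, x₂, x₁ ^ 2 * s, 0, 2 * x₁ * x₂;
      0, x₁ * r, 0, -x₂, 2 * x₁ ^ 2 * p, 0;
      0, 0, x₁ * r, 0, x₂, x₁ ^ 2 * s;
      1, 0, 0, -x₁ * r, 0, -x₂;
      0, 1, 0, 0, -x₁ * r, 0;
      0, 0, 1, 0, 0, -x₁ * r] : Matrix _ _ R) *
      !![0, 0, 0, -x₁ * x₂, -x₁ ^ 3 * p, x₂ ^ 2;
      0, -x₂, 0, 0, x₁ * x₂ * k, x₁ ^ 3 * p;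
      0, 0, -x₂, x₁ ^ 2, 0, -x₁ * x₂;
      0, x₁, 0, x₂, 0, 0;
      0, 0, -x₁, 0, x₂, 0;
      1, 0, 0, 0, 0, 0] =
      !![2 * x₁ * x₂, x₁ ^ 3 * s, -x₂ ^ 2, -x₁ ^ 2 * x₂ * r + x₁ ^ 2 * x₂ * s + x₁ ^ 2 * x₂,
        -x₁ ^ 4 * p * r, x₁ * x₂ ^ 2 * r - x₁ * x₂ ^ 2;
      0, -x₁ * x₂ * r - x₁ * x₂, -2 * x₁ ^ 3 * p, -x₂ ^ 2, 2 * x₁ ^ 2 * x₂ * p +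
        x₁ ^ 2 * x₂ * r * k, x₁ ^ 4 * p * r;
      x₁ ^ 2 * s, 0, -x₁ * x₂ * r - x₁ * x₂, x₁ ^ 3 * r, x₂ ^ 2, -x₁ ^ 2 * x₂ * r;
      -x₂, -x₁ ^ 2 * r, 0, -x₁ * x₂ * r - x₁ * x₂, -x₁ ^ 3 * p, x₂ ^ 2;
      0, -x₂, x₁ ^ 2 * r, 0, -x₁ * x₂ * r + x₁ * x₂ * k, x₁ ^ 3 * p;
      -x₁ * r, 0, -x₂, x₁ ^ 2, 0, -x₁ * x₂] := by
    ext i j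
    fin_cases i <;> fin_cases j <;>
      simp only [Matrix.mul_apply, Fin.sum_univ_six, Matrix.of_apply, Matrix.cons_val',
        Matrix.cons_val_zero, Matrix.cons_val_one, Matrix.cons_val, Fin.zero_eta, Fin.mk_one,
        Fin.reduceFinMk]
    all_goals ring
  have h₃ : (!![0, 0, 0, x₂, -x₁ ^ 2 * p, 0;
      0, 0, 0, 0, 0, -x₁ ^ 2 * p;
      0, 0, 0, 0, 0, -x₂;
      0, 1, 0, 0, 0, 0;
      0, 0, 1, 0, 0, 0;
      0, 0, 0, 0, 0, 0] : Matrix _ _ R) *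
      !![2 * x₁ * x₂, x₁ ^ 3 * s, -x₂ ^ 2, -x₁ ^ 2 * x₂ * r + x₁ ^ 2 * x₂ * s + x₁ ^ 2 * x₂,
        -x₁ ^ 4 * p * r, x₁ * x₂ ^ 2 * r - x₁ * x₂ ^ 2;
      0, -x₁ * x₂ * r - x₁ * x₂, -2 * x₁ ^ 3 * p, -x₂ ^ 2, 2 * x₁ ^ 2 * x₂ * p +
        x₁ ^ 2 * x₂ * r * k, x₁ ^ 4 * p * r;
      x₁ ^ 2 * s, 0, -x₁ * x₂ * r - x₁ * x₂, x₁ ^ 3 * r, x₂ ^ 2, -x₁ ^ 2 * x₂ * r;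
      -x₂, -x₁ ^ 2 * r, 0, -x₁ * x₂ * r - x₁ * x₂, -x₁ ^ 3 * p, x₂ ^ 2;
      0, -x₂, x₁ ^ 2 * r, 0, -x₁ * x₂ * r + x₁ * x₂ * k, x₁ ^ 3 * p;
      -x₁ * r, 0, -x₂, x₁ ^ 2, 0, -x₁ * x₂] =
      !![-x₂ ^ 2, x₁ ^ 2 * x₂ * p - x₁ ^ 2 * x₂ * r, -x₁ ^ 4 * p * r, -x₁ * x₂ ^ 2 * r -
        x₁ * x₂ ^ 2, x₁ ^ 3 * x₂ * p * r - x₁ ^ 3 * x₂ * p * k - x₁ ^ 3 * x₂ * p,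
        -x₁ ^ 5 * p ^ 2 + x₂ ^ 3;
      x₁ ^ 3 * p * r, 0, x₁ ^ 2 * x₂ * p, -x₁ ^ 4 * p, 0, x₁ ^ 3 * x₂ * p;
      x₁ * x₂ * r, 0, x₂ ^ 2, -x₁ ^ 2 * x₂, 0, x₁ * x₂ ^ 2;
      0, -x₁ * x₂ * r - x₁ * x₂, -2 * x₁ ^ 3 * p, -x₂ ^ 2, 2 * x₁ ^ 2 * x₂ * p +
        x₁ ^ 2 * x₂ * r * k, x₁ ^ 4 * p * r;
      x₁ ^ 2 * s, 0, -x₁ * x₂ * r - x₁ * x₂, x₁ ^ 3 * r, x₂ ^ 2, -x₁ ^ 2 * x₂ * r;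
      0, 0, 0, 0, 0, 0] := by
    ext i j
    fin_cases i <;> fin_cases j <;>
      simp only [Matrix.mul_apply, Fin.sum_univ_six, Matrix.of_apply, Matrix.cons_val',
        Matrix.cons_val_zero, Matrix.cons_val_one, Matrix.cons_val, Fin.zero_eta, Fin.mk_one,
        Fin.reduceFinMk]
    all_goals ring
  rw [h₁, h₂, h₃]
  simp [Matrix.trace, Fin.sum_univ_six]
  ring

set_option maxHeartbeats 1000000 in
/-- The trace of the product of the derivatives of `sqrtZ13` at `x = 0`. -/
theorem trace_sqrtZ13_right (r y₁ y₂ y₃ : R) :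
    Matrix.trace (((!![y₂ * r, 0, 0, 0, -y₂ * y₃, 0;
      0, y₂ * r, 0, -y₃ ^ 2, 0, y₂ * y₃;
      0, 0, y₂ * r, 0, y₃ ^ 2, 0;
      0, y₃, 0, -y₂ * r, 0, 0;
      0, 0, -y₃, 0, -y₂ * r, 0;
      0, 0, 0, 0, 0, -y₂ * r] : Matrix _ _ R) *
      !![0, 0, y₂, y₁, -y₃ ^ 2, 0;
      0, -y₃, 0, -y₂, 0, y₃ ^ 2;
      0, 0, -y₃, 0, y₂, -y₁;
      0, 0, 0, y₃, 0, -y₂;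
      1, 0, 0, 0, y₃, 0;
      0, -1, 0, 0, 0, 0]) *
      (!![0, 0, 0, 0, -y₂, 2 * y₁;
      0, 0, 0, y₃, 0, -y₂;
      0, 0, 0, 0, y₃, 0;
      0, 1, 0, 0, 0, 0;
      0, 0, 1, 0, 0, 0;
      0, 0, 0, 0, 0, 0] *
      (!![0, 0, 0, 2 * y₂, -y₁, -y₃ ^ 2;
      0, 0, 0, 0, 2 * y₂, -y₁;
      0, 0, 0, -y₃, 0, 2 * y₂;
      1, 0, 0, 0, 0, 0;
      0, 1, 0, 0, 0, 0;
      0, 0, 1, 0, 0, 0] *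
      !![0, 0, 0, 0, 0, -2 * y₂ * y₃;
      0, 0, 0, y₁, -3 * y₃ ^ 2, 0;
      0, 0, 0, -y₂, y₁, 0;
      0, 0, 2 * y₃, 0, 0, 0;
      0, 0, 0, 0, 0, 0;
      1, 0, 0, 0, 0, 0]))) =
      -3 * y₁ ^ 2 * y₂ * r - 9 * y₂ ^ 2 * y₃ ^ 2 * r - 3 * y₂ ^ 2 * y₃ ^ 2 - 5 * y₃ ^ 5 := by
  have h₁ : (!![y₂ * r, 0, 0, 0, -y₂ * y₃, 0;
      0, y₂ * r, 0, -y₃ ^ 2, 0, y₂ * y₃;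
      0, 0, y₂ * r, 0, y₃ ^ 2, 0;
      0, y₃, 0, -y₂ * r, 0, 0;
      0, 0, -y₃, 0, -y₂ * r, 0;
      0, 0, 0, 0, 0, -y₂ * r] : Matrix _ _ R) *
      !![0, 0, y₂, y₁, -y₃ ^ 2, 0;
      0, -y₃, 0, -y₂, 0, y₃ ^ 2;
      0, 0, -y₃, 0, y₂, -y₁;
      0, 0, 0, y₃, 0, -y₂;
      1, 0, 0, 0, y₃, 0;
      0, -1, 0, 0, 0, 0] =
      !![-y₂ * y₃, 0, y₂ ^ 2 * r, y₁ * y₂ * r, -y₂ * y₃ ^ 2 * r - y₂ * y₃ ^ 2, 0;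
      0, -y₂ * y₃ * r - y₂ * y₃, 0, -y₂ ^ 2 * r - y₃ ^ 3, 0, y₂ * y₃ ^ 2 * r + y₂ * y₃ ^ 2;
      y₃ ^ 2, 0, -y₂ * y₃ * r, 0, y₂ ^ 2 * r + y₃ ^ 3, -y₁ * y₂ * r;
      0, -y₃ ^ 2, 0, -y₂ * y₃ * r - y₂ * y₃, 0, y₂ ^ 2 * r + y₃ ^ 3;
      -y₂ * r, 0, y₃ ^ 2, 0, -y₂ * y₃ * r - y₂ * y₃, y₁ * y₃;
      0, y₂ * r, 0, 0, 0, 0] := by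
    ext i j
    fin_cases i <;> fin_cases j <;>
      simp only [Matrix.mul_apply, Fin.sum_univ_six, Matrix.of_apply, Matrix.cons_val',
        Matrix.cons_val_zero, Matrix.cons_val_one, Matrix.cons_val, Fin.zero_eta, Fin.mk_one,
        Fin.reduceFinMk]
    all_goals ring
  have h₂ : (!![0, 0, 0, 2 * y₂, -y₁, -y₃ ^ 2;
      0, 0, 0, 0, 2 * y₂, -y₁;
      0, 0, 0, -y₃, 0, 2 * y₂;
      1, 0, 0, 0, 0, 0;
      0, 1, 0, 0, 0, 0;
      0, 0, 1, 0, 0, 0] : Matrix _ _ R) *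
      !![0, 0, 0, 0, 0, -2 * y₂ * y₃;
      0, 0, 0, y₁, -3 * y₃ ^ 2, 0;
      0, 0, 0, -y₂, y₁, 0;
      0, 0, 2 * y₃, 0, 0, 0;
      0, 0, 0, 0, 0, 0;
      1, 0, 0, 0, 0, 0] =
      !![-y₃ ^ 2, 0, 4 * y₂ * y₃, 0, 0, 0;
      -y₁, 0, 0, 0, 0, 0;
      2 * y₂, 0, -2 * y₃ ^ 2, 0, 0, 0;
      0, 0, 0, 0, 0, -2 * y₂ * y₃;
      0, 0, 0, y₁, -3 * y₃ ^ 2, 0;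
      0, 0, 0, -y₂, y₁, 0] := by
    ext i j
    fin_cases i <;> fin_cases j <;>
      simp only [Matrix.mul_apply, Fin.sum_univ_six, Matrix.of_apply, Matrix.cons_val',
        Matrix.cons_val_zero, Matrix.cons_val_one, Matrix.cons_val, Fin.zero_eta, Fin.mk_one,
        Fin.reduceFinMk]
    all_goals ring
  have h₃ : (!![0, 0, 0, 0, -y₂, 2 * y₁;
      0, 0, 0, y₃, 0, -y₂;
      0, 0, 0, 0, y₃, 0;
      0, 1, 0, 0, 0, 0;
      0, 0, 1, 0, 0, 0;
      0, 0, 0, 0, 0, 0] : Matrix _ _ R) *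
      !![-y₃ ^ 2, 0, 4 * y₂ * y₃, 0, 0, 0;
      -y₁, 0, 0, 0, 0, 0;
      2 * y₂, 0, -2 * y₃ ^ 2, 0, 0, 0;
      0, 0, 0, 0, 0, -2 * y₂ * y₃;
      0, 0, 0, y₁, -3 * y₃ ^ 2, 0;
      0, 0, 0, -y₂, y₁, 0] =
      !![0, 0, 0, -3 * y₁ * y₂, 2 * y₁ ^ 2 + 3 * y₂ * y₃ ^ 2, 0;
      0, 0, 0, y₂ ^ 2, -y₁ * y₂, -2 * y₂ * y₃ ^ 2;
      0, 0, 0, y₁ * y₃, -3 * y₃ ^ 3, 0;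
      -y₁, 0, 0, 0, 0, 0;
      2 * y₂, 0, -2 * y₃ ^ 2, 0, 0, 0;
      0, 0, 0, 0, 0, 0] := by
    ext i j
    fin_cases i <;> fin_cases j <;>
      simp only [Matrix.mul_apply, Fin.sum_univ_six, Matrix.of_apply, Matrix.cons_val',
        Matrix.cons_val_zero, Matrix.cons_val_one, Matrix.cons_val, Fin.zero_eta, Fin.mk_one,
        Fin.reduceFinMk]
    all_goals ring
  rw [h₁, h₂, h₃]
  simp [Matrix.trace, Fin.sum_univ_six]
  ring

end


section

variable {R : Type*} [CommRing R]

/-- The differential of `sqrtZ13` with respect to `x₁, x₂, y₁, y₂, y₃`. -/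
def sqrtZ13Diff (p q r s k x₁ x₂ y₁ y₂ y₃ dx₁ dx₂ dy₁ dy₂ dy₃ : R) : Matrix (Fin 6) (Fin 6) R :=
  !![3 * q * x₁ ^ 2 * dx₁ + r * x₁ * dy₂ + r * y₂ * dx₁,
      -2 * x₂ * dx₂,
      p * x₁ ^ 2 * dx₂ + 2 * p * x₁ * x₂ * dx₁ + x₂ * dy₂ + y₂ * dx₂,
      -4 * p * x₁ ^ 3 * dx₁ + s * x₁ ^ 2 * dy₂ + 2 * s * x₁ * y₂ * dx₁ - x₁ * x₂ * dy₃ -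
        x₁ * y₃ * dx₂ - x₂ * y₃ * dx₁ + x₂ * dy₁ + y₁ * dx₂ + 2 * y₂ * dy₂,
      -p * x₁ ^ 3 * dy₃ - 3 * p * x₁ ^ 2 * y₃ * dx₁ - p * x₁ ^ 2 * dy₁ - 2 * p * x₁ * y₁ * dx₁ +
        2 * k * x₁ * x₂ * dx₂ + k * x₂ ^ 2 * dx₁ - x₁ * y₂ * dy₃ - x₁ * y₃ * dy₂ -
        2 * x₂ * y₃ * dy₃ - y₁ * dy₂ - y₂ * y₃ * dx₁ - y₂ * dy₁ - y₃ ^ 2 * dx₂,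
      2 * p * x₁ ^ 3 * dx₂ + 6 * p * x₁ ^ 2 * x₂ * dx₁ + 2 * x₁ * x₂ * dy₂ + 2 * x₁ * y₂ * dx₂ +
        x₂ ^ 2 * dy₃ + 2 * x₂ * y₂ * dx₁ + 2 * x₂ * y₃ * dx₂ + 2 * y₁ * dy₁ -
        2 * y₂ * y₃ * dy₃ - y₃ ^ 2 * dy₂;
    0,
      3 * q * x₁ ^ 2 * dx₁ + r * x₁ * dy₂ + r * y₂ * dx₁ - x₂ * dy₃ - y₃ * dx₂,
      0,
      -p * x₁ ^ 2 * dx₂ - 2 * p * x₁ * x₂ * dx₁ - 2 * x₁ * y₃ * dy₃ - x₂ * dy₂ + y₁ * dy₃ -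
        y₂ * dx₂ - y₃ ^ 2 * dx₁ + y₃ * dy₁,
      4 * p ^ 2 * x₁ ^ 3 * dx₁ + 2 * p * x₁ ^ 2 * dy₂ + 4 * p * x₁ * y₂ * dx₁ +
        k * x₁ * x₂ * dy₃ + k * x₁ * y₃ * dx₂ + k * x₂ * y₃ * dx₁ + 2 * y₂ * dy₂ - 3 * y₃ ^ 2 * dy₃,
      p * x₁ ^ 3 * dy₃ + 3 * p * x₁ ^ 2 * y₃ * dx₁ - p * x₁ ^ 2 * dy₁ - 2 * p * x₁ * y₁ * dx₁ -
        2 * k * x₁ * x₂ * dx₂ - k * x₂ ^ 2 * dx₁ + x₁ * y₂ * dy₃ + x₁ * y₃ * dy₂ +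
        2 * x₂ * y₃ * dy₃ - y₁ * dy₂ + y₂ * y₃ * dx₁ - y₂ * dy₁ + y₃ ^ 2 * dx₂;
    0,
      0,
      3 * q * x₁ ^ 2 * dx₁ + r * x₁ * dy₂ + r * y₂ * dx₁ - x₂ * dy₃ - y₃ * dx₂,
      x₁ ^ 2 * dy₃ + 2 * x₁ * y₃ * dx₁ - 2 * x₂ * dx₂ - y₂ * dy₃ - y₃ * dy₂,
      p * x₁ ^ 2 * dx₂ + 2 * p * x₁ * x₂ * dx₁ + 2 * x₁ * y₃ * dy₃ + x₂ * dy₂ + y₁ * dy₃ +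
        y₂ * dx₂ + y₃ ^ 2 * dx₁ + y₃ * dy₁,
      -4 * p * x₁ ^ 3 * dx₁ + s * x₁ ^ 2 * dy₂ + 2 * s * x₁ * y₂ * dx₁ - x₁ * x₂ * dy₃ -
        x₁ * y₃ * dx₂ - x₂ * y₃ * dx₁ - x₂ * dy₁ - y₁ * dx₂ + 2 * y₂ * dy₂;
    2 * p * x₁ * dx₁ + dy₂,
      x₁ * dy₃ + y₃ * dx₁ + dy₁,
      -k * x₁ * dx₂ - k * x₂ * dx₁ + 2 * y₃ * dy₃,
      -3 * q * x₁ ^ 2 * dx₁ - r * x₁ * dy₂ - r * y₂ * dx₁ + x₂ * dy₃ + y₃ * dx₂,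
      0,
      -p * x₁ ^ 2 * dx₂ - 2 * p * x₁ * x₂ * dx₁ - x₂ * dy₂ - y₂ * dx₂;
    dx₂,
      -2 * x₁ * dx₁ + dy₂,
      -x₁ * dy₃ - y₃ * dx₁ + dy₁,
      0,
      -3 * q * x₁ ^ 2 * dx₁ - r * x₁ * dy₂ - r * y₂ * dx₁ + x₂ * dy₃ + y₃ * dx₂,
      -2 * x₂ * dx₂;
    dy₃,
      -dx₂,
      2 * p * x₁ * dx₁ + dy₂,
      0,
      0,
      -3 * q * x₁ ^ 2 * dx₁ - r * x₁ * dy₂ - r * y₂ * dx₁]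

set_option maxHeartbeats 1000000 in
theorem derivAt_sqrtZ13 [Algebra ℂ R] (φ : Poly 3 3 →ₐ[ℂ] R) (v : Fin 3 ⊕ Fin 3)
    (p q r s k : ℂ) (x₁ x₂ y₁ y₂ y₃ : Poly 3 3) :
    derivAt φ v (sqrtZ13 (C p) (C q) (C r) (C s) (C k) x₁ x₂ y₁ y₂ y₃) =
      sqrtZ13Diff (φ (C p)) (φ (C q)) (φ (C r)) (φ (C s)) (φ (C k)) (φ x₁) (φ x₂) (φ y₁) (φ y₂)
        (φ y₃) (φ (pderiv v x₁)) (φ (pderiv v x₂)) (φ (pderiv v y₁)) (φ (pderiv v y₂))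
        (φ (pderiv v y₃)) := by
  ext1 i j
  rw [derivAt_apply]
  fin_cases i <;> fin_cases j <;>
    simp only [sqrtZ13, sqrtZ13Diff, Matrix.of_apply, Matrix.cons_val', Matrix.cons_val_zero,
      Matrix.cons_val_one, Matrix.cons_val, Fin.zero_eta, Fin.mk_one, Fin.reduceFinMk,
      map_add, map_sub, map_neg, map_mul, map_pow, map_zero, map_ofNat, pderiv_mul,
      pderiv_pow, pderiv_C, pderiv_ofNat, Nat.cast_ofNat]
  all_goals ring

/-- The derivative of `sqrtZ13` by `x₁` at `y = 0`; the scalar `c` comes from rescaling `x₁`. -/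
theorem sqrtZ13Diff_left_x₁ (p q r s k x₁ x₂ c : R) :
    sqrtZ13Diff p q r s k x₁ x₂ 0 0 0 c 0 0 0 0 = c •
      (!![3 * x₁ ^ 2 * q, 0, 2 * x₁ * x₂ * p, -4 * x₁ ^ 3 * p, x₂ ^ 2 * k, 6 * x₁ ^ 2 * x₂ * p;
      0, 3 * x₁ ^ 2 * q, 0, -2 * x₁ * x₂ * p, 4 * x₁ ^ 3 * p ^ 2, -x₂ ^ 2 * k;
      0, 0, 3 * x₁ ^ 2 * q, 0, 2 * x₁ * x₂ * p, -4 * x₁ ^ 3 * p;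
      2 * x₁ * p, 0, -x₂ * k, -3 * x₁ ^ 2 * q, 0, -2 * x₁ * x₂ * p;
      0, -2 * x₁, 0, 0, -3 * x₁ ^ 2 * q, 0;
      0, 0, 2 * x₁ * p, 0, 0, -3 * x₁ ^ 2 * q] : Matrix _ _ R) := by
  ext i j
  fin_cases i <;> fin_cases j <;>
    simp only [sqrtZ13Diff, Matrix.smul_apply, smul_eq_mul, Matrix.of_apply, Matrix.cons_val',
      Matrix.cons_val_zero, Matrix.cons_val_one, Matrix.cons_val, Fin.zero_eta, Fin.mk_one,
      Fin.reduceFinMk]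
  all_goals ring

theorem sqrtZ13Diff_left_x₂ (p q r s k x₁ x₂ c : R) :
    sqrtZ13Diff p q r s k x₁ x₂ 0 0 0 0 c 0 0 0 = c •
      (!![0, -2 * x₂, x₁ ^ 2 * p, 0, 2 * x₁ * x₂ * k, 2 * x₁ ^ 3 * p;
      0, 0, 0, -x₁ ^ 2 * p, 0, -2 * x₁ * x₂ * k;
      0, 0, 0, -2 * x₂, x₁ ^ 2 * p, 0;
      0, 0, -x₁ * k, 0, 0, -x₁ ^ 2 * p;
      1, 0, 0, 0, 0, -2 * x₂;
      0, -1, 0, 0, 0, 0] : Matrix _ _ R) := by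
  ext i j
  fin_cases i <;> fin_cases j <;>
    simp only [sqrtZ13Diff, Matrix.smul_apply, smul_eq_mul, Matrix.of_apply, Matrix.cons_val',
      Matrix.cons_val_zero, Matrix.cons_val_one, Matrix.cons_val, Fin.zero_eta, Fin.mk_one,
      Fin.reduceFinMk]
  all_goals ring

theorem sqrtZ13Diff_left_y₁ (p q r s k x₁ x₂ c : R) :
    sqrtZ13Diff p q r s k x₁ x₂ 0 0 0 0 0 c 0 0 = c •
      (!![0, 0, 0, x₂, -x₁ ^ 2 * p, 0;
      0, 0, 0, 0, 0, -x₁ ^ 2 * p;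
      0, 0, 0, 0, 0, -x₂;
      0, 1, 0, 0, 0, 0;
      0, 0, 1, 0, 0, 0;
      0, 0, 0, 0, 0, 0] : Matrix _ _ R) := by
  ext i j
  fin_cases i <;> fin_cases j <;>
    simp only [sqrtZ13Diff, Matrix.smul_apply, smul_eq_mul, Matrix.of_apply, Matrix.cons_val',
      Matrix.cons_val_zero, Matrix.cons_val_one, Matrix.cons_val, Fin.zero_eta, Fin.mk_one,
      Fin.reduceFinMk]
  all_goals ring

theorem sqrtZ13Diff_left_y₂ (p q r s k x₁ x₂ c : R) :
    sqrtZ13Diff p q r s k x₁ x₂ 0 0 0 0 0 0 c 0 = c •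
      (!![x₁ * r, 0, x₂, x₁ ^ 2 * s, 0, 2 * x₁ * x₂;
      0, x₁ * r, 0, -x₂, 2 * x₁ ^ 2 * p, 0;
      0, 0, x₁ * r, 0, x₂, x₁ ^ 2 * s;
      1, 0, 0, -x₁ * r, 0, -x₂;
      0, 1, 0, 0, -x₁ * r, 0;
      0, 0, 1, 0, 0, -x₁ * r] : Matrix _ _ R) := by
  ext i j
  fin_cases i <;> fin_cases j <;>
    simp only [sqrtZ13Diff, Matrix.smul_apply, smul_eq_mul, Matrix.of_apply, Matrix.cons_val',
      Matrix.cons_val_zero, Matrix.cons_val_one, Matrix.cons_val, Fin.zero_eta, Fin.mk_one,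
      Fin.reduceFinMk]
  all_goals ring

theorem sqrtZ13Diff_left_y₃ (p q r s k x₁ x₂ c : R) :
    sqrtZ13Diff p q r s k x₁ x₂ 0 0 0 0 0 0 0 c = c •
      (!![0, 0, 0, -x₁ * x₂, -x₁ ^ 3 * p, x₂ ^ 2;
      0, -x₂, 0, 0, x₁ * x₂ * k, x₁ ^ 3 * p;
      0, 0, -x₂, x₁ ^ 2, 0, -x₁ * x₂;
      0, x₁, 0, x₂, 0, 0;
      0, 0, -x₁, 0, x₂, 0;
      1, 0, 0, 0, 0, 0] : Matrix _ _ R) := by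
  ext i j
  fin_cases i <;> fin_cases j <;>
    simp only [sqrtZ13Diff, Matrix.smul_apply, smul_eq_mul, Matrix.of_apply, Matrix.cons_val',
      Matrix.cons_val_zero, Matrix.cons_val_one, Matrix.cons_val, Fin.zero_eta, Fin.mk_one,
      Fin.reduceFinMk]
  all_goals ring

/-- The derivative of `sqrtZ13` by `x₁` at `x = 0`; the scalar `c` comes from rescaling `x₁`. -/
theorem sqrtZ13Diff_right_x₁ (p q r s k y₁ y₂ y₃ c : R) :
    sqrtZ13Diff p q r s k 0 0 y₁ y₂ y₃ c 0 0 0 0 = c •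
      (!![y₂ * r, 0, 0, 0, -y₂ * y₃, 0;
      0, y₂ * r, 0, -y₃ ^ 2, 0, y₂ * y₃;
      0, 0, y₂ * r, 0, y₃ ^ 2, 0;
      0, y₃, 0, -y₂ * r, 0, 0;
      0, 0, -y₃, 0, -y₂ * r, 0;
      0, 0, 0, 0, 0, -y₂ * r] : Matrix _ _ R) := by
  ext i j
  fin_cases i <;> fin_cases j <;>
    simp only [sqrtZ13Diff, Matrix.smul_apply, smul_eq_mul, Matrix.of_apply, Matrix.cons_val',
      Matrix.cons_val_zero, Matrix.cons_val_one, Matrix.cons_val, Fin.zero_eta, Fin.mk_one,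
      Fin.reduceFinMk]
  all_goals ring

theorem sqrtZ13Diff_right_x₂ (p q r s k y₁ y₂ y₃ c : R) :
    sqrtZ13Diff p q r s k 0 0 y₁ y₂ y₃ 0 c 0 0 0 = c •
      (!![0, 0, y₂, y₁, -y₃ ^ 2, 0;
      0, -y₃, 0, -y₂, 0, y₃ ^ 2;
      0, 0, -y₃, 0, y₂, -y₁;
      0, 0, 0, y₃, 0, -y₂;
      1, 0, 0, 0, y₃, 0;
      0, -1, 0, 0, 0, 0] : Matrix _ _ R) := by
  ext i j
  fin_cases i <;> fin_cases j <;>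
    simp only [sqrtZ13Diff, Matrix.smul_apply, smul_eq_mul, Matrix.of_apply, Matrix.cons_val',
      Matrix.cons_val_zero, Matrix.cons_val_one, Matrix.cons_val, Fin.zero_eta, Fin.mk_one,
      Fin.reduceFinMk]
  all_goals ring

theorem sqrtZ13Diff_right_y₁ (p q r s k y₁ y₂ y₃ c : R) :
    sqrtZ13Diff p q r s k 0 0 y₁ y₂ y₃ 0 0 c 0 0 = c •
      (!![0, 0, 0, 0, -y₂, 2 * y₁;
      0, 0, 0, y₃, 0, -y₂;
      0, 0, 0, 0, y₃, 0;
      0, 1, 0, 0, 0, 0;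
      0, 0, 1, 0, 0, 0;
      0, 0, 0, 0, 0, 0] : Matrix _ _ R) := by
  ext i j
  fin_cases i <;> fin_cases j <;>
    simp only [sqrtZ13Diff, Matrix.smul_apply, smul_eq_mul, Matrix.of_apply, Matrix.cons_val',
      Matrix.cons_val_zero, Matrix.cons_val_one, Matrix.cons_val, Fin.zero_eta, Fin.mk_one,
      Fin.reduceFinMk]
  all_goals ring

theorem sqrtZ13Diff_right_y₂ (p q r s k y₁ y₂ y₃ c : R) :
    sqrtZ13Diff p q r s k 0 0 y₁ y₂ y₃ 0 0 0 c 0 = c •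
      (!![0, 0, 0, 2 * y₂, -y₁, -y₃ ^ 2;
      0, 0, 0, 0, 2 * y₂, -y₁;
      0, 0, 0, -y₃, 0, 2 * y₂;
      1, 0, 0, 0, 0, 0;
      0, 1, 0, 0, 0, 0;
      0, 0, 1, 0, 0, 0] : Matrix _ _ R) := by
  ext i j
  fin_cases i <;> fin_cases j <;>
    simp only [sqrtZ13Diff, Matrix.smul_apply, smul_eq_mul, Matrix.of_apply, Matrix.cons_val',
      Matrix.cons_val_zero, Matrix.cons_val_one, Matrix.cons_val, Fin.zero_eta, Fin.mk_one,
      Fin.reduceFinMk]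
  all_goals ring

theorem sqrtZ13Diff_right_y₃ (p q r s k y₁ y₂ y₃ c : R) :
    sqrtZ13Diff p q r s k 0 0 y₁ y₂ y₃ 0 0 0 0 c = c •
      (!![0, 0, 0, 0, 0, -2 * y₂ * y₃;
      0, 0, 0, y₁, -3 * y₃ ^ 2, 0;
      0, 0, 0, -y₂, y₁, 0;
      0, 0, 2 * y₃, 0, 0, 0;
      0, 0, 0, 0, 0, 0;
      1, 0, 0, 0, 0, 0] : Matrix _ _ R) := by
  ext i j
  fin_cases i <;> fin_cases j <;>
    simp only [sqrtZ13Diff, Matrix.smul_apply, smul_eq_mul, Matrix.of_apply, Matrix.cons_val',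
      Matrix.cons_val_zero, Matrix.cons_val_one, Matrix.cons_val, Fin.zero_eta, Fin.mk_one,
      Fin.reduceFinMk]
  all_goals ring

end


theorem isWeightedHomogeneous_sqrtZ13 {σ R : Type*} [CommRing R] {w : σ → ℚ}
    {p q r s k x₁ x₂ y₁ y₂ y₃ : MvPolynomial σ R}
    (hp : IsWeightedHomogeneous w p (0 : ℚ)) (hq : IsWeightedHomogeneous w q (0 : ℚ))
    (hr : IsWeightedHomogeneous w r (0 : ℚ)) (hs : IsWeightedHomogeneous w s (0 : ℚ))
    (hk : IsWeightedHomogeneous w k (0 : ℚ)) (hx₁ : IsWeightedHomogeneous w x₁ (1 / 3 : ℚ))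
    (hx₂ : IsWeightedHomogeneous w x₂ (5 / 9 : ℚ)) (hy₁ : IsWeightedHomogeneous w y₁ (7 / 9 : ℚ))
    (hy₂ : IsWeightedHomogeneous w y₂ (2 / 3 : ℚ)) (hy₃ : IsWeightedHomogeneous w y₃ (4 / 9 : ℚ))
    (i j : Fin 6) : IsWeightedHomogeneous w (sqrtZ13 p q r s k x₁ x₂ y₁ y₂ y₃ i j)
      ((![0, 1 / 9, 2 / 9, 1 / 3, 4 / 9, 5 / 9] : Fin 6 → ℚ) j -
        (![0, 1 / 9, 2 / 9, 1 / 3, 4 / 9, 5 / 9] : Fin 6 → ℚ) i + 1) := by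
  fin_cases i <;> fin_cases j <;> simp only [sqrtZ13, Matrix.of_apply, Matrix.cons_val',
    Matrix.cons_val_zero, Matrix.cons_val_one, Matrix.cons_val, Fin.zero_eta, Fin.mk_one,
    Fin.reduceFinMk]
  all_goals
    repeat' with_reducible_and_instances first
      | exact isWeightedHomogeneous_zero _ _ _
      | apply IsWeightedHomogeneous.add
      | apply IsWeightedHomogeneous.sub
      | apply IsWeightedHomogeneous.neg
      | apply hx₁.of_eq
      | apply hx₂.of_eq
      | apply hy₁.of_eq
      | apply hy₂.of_eq
      | apply hy₃.of_eq
      | apply hp.of_eq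
      | apply hq.of_eq
      | apply hr.of_eq
      | apply hs.of_eq
      | apply hk.of_eq
      | apply isWeightedHomogeneous_ofNat'
      | apply isWeightedHomogeneous_mul_right hx₁
      | apply isWeightedHomogeneous_mul_right hx₂
      | apply isWeightedHomogeneous_mul_right hy₁
      | apply isWeightedHomogeneous_mul_right hy₂
      | apply isWeightedHomogeneous_mul_right hy₃
      | apply isWeightedHomogeneous_mul_right hp
      | apply isWeightedHomogeneous_mul_pow hx₁
      | apply isWeightedHomogeneous_mul_pow hx₂
      | apply isWeightedHomogeneous_mul_pow hy₃
      | apply isWeightedHomogeneous_pow_of_eq hx₁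
      | apply isWeightedHomogeneous_pow_of_eq hx₂
      | apply isWeightedHomogeneous_pow_of_eq hy₁
      | apply isWeightedHomogeneous_pow_of_eq hy₂
      | apply isWeightedHomogeneous_pow_of_eq hy₃
      | apply isWeightedHomogeneous_pow_of_eq hp
  all_goals norm_num

/-- `sqrtZ13` for the parameter `u` and rescaled variables of `ℂ[x₁, x₂, x₃, y₁, y₂, y₃]`. -/
noncomputable def sqrtPolyZ13 (u a b : ℂ) : Matrix (Fin 6) (Fin 6) (Poly 3 3) :=
  sqrtZ13 (C (2 * u - 2 * u ^ 2)) (C (2 * u ^ 2 - 4 * u)) (C (2 * u - 1))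
    (C (2 * u - 1 - 2 * u ^ 2)) (C (4 * u)) (C a * X (Sum.inl 0)) (C b * X (Sum.inl 1))
    (C Complex.I * X (Sum.inr 0)) (X (Sum.inr 1)) (-X (Sum.inr 2))

variable {u a b : ℂ}

theorem isGradedFactorisation_Z13 (hu : u ^ 3 = 3 * u - 1)
    (ha : (8 - 24 * u + 12 * u ^ 2) * a ^ 6 = -1) (hab : 4 * u * a * b ^ 3 = -1) :
    IsGradedFactorisation ![1 / 3, 5 / 9, 1] ![7 / 9, 2 / 3, 4 / 9]
      (X 0 ^ 6 + X 0 * X 1 ^ 3 + X 2 ^ 2) (X 1 * X 2 ^ 3 + X 1 ^ 3 + X 0 ^ 2 * X 2)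
      (Matrix.scalar (Fin 6) (X (Sum.inl 2) : Poly 3 3) + sqrtPolyZ13 u a b)
      (Matrix.scalar (Fin 6) (X (Sum.inl 2) : Poly 3 3) - sqrtPolyZ13 u a b) := by
  have hI : (C Complex.I : Poly 3 3) ^ 2 = -1 := by
    rw [← map_pow, Complex.I_sq, map_neg, map_one]
  have hu' : (C u : Poly 3 3) ^ 3 = 3 * C u - 1 := by
    rw [← map_pow, hu]; simp [map_ofNat]
  have ha' : (8 - 24 * C u + 12 * C u ^ 2 : Poly 3 3) * C a ^ 6 = -1 := by
    have := congrArg (C : ℂ →+* Poly 3 3) ha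
    simpa [map_ofNat] using this
  have hab' : (4 * C u * C a * C b ^ 3 : Poly 3 3) = -1 := by
    have := congrArg (C : ℂ →+* Poly 3 3) hab
    simpa [map_ofNat] using this
  have hC (c : ℂ) : IsWeightedHomogeneous
      (Sum.elim ![1 / 3, 5 / 9, 1] ![7 / 9, 2 / 3, 4 / 9] : Fin 3 ⊕ Fin 3 → ℚ)
      (C c : Poly 3 3) (0 : ℚ) := isWeightedHomogeneous_C' rfl
  refine .of_sq (sqrtZ13_mul_self hu' ?_ ?_ ?_ ?_ ?_ _ _ _ _ _) ?_ ?_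
    ![0, 1 / 9, 2 / 9, 1 / 3, 4 / 9, 5 / 9] ?_ ?_
  iterate 5 simp [map_ofNat]
  · simp [difference]
    linear_combination (-X (Sum.inl 0) ^ 6) * ha' +
      (-X (Sum.inl 0) * X (Sum.inl 1) ^ 3) * hab' +
      (X (Sum.inr 0) ^ 2 * X (Sum.inr 2)) * hI
  · exact isWeightedHomogeneous_X' (by simp)
  · refine isWeightedHomogeneous_sqrtZ13 (hC _) (hC _) (hC _) (hC _) (hC _)
      (isWeightedHomogeneous_mul_X (isWeightedHomogeneous_C' ?_))
      (isWeightedHomogeneous_mul_X (isWeightedHomogeneous_C' ?_))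
      (isWeightedHomogeneous_mul_X (isWeightedHomogeneous_C' ?_))
      (isWeightedHomogeneous_X' ?_) (.neg (isWeightedHomogeneous_X' ?_)) <;> simp
  · simp [Fin.forall_fin_succ]
    norm_num

theorem strDeriv_Z13_left (hu : u ^ 3 = 3 * u - 1) :
    aeval (Sum.elim X 0 : _ → MvPolynomial (Fin 3) ℂ)
      (strDeriv (Matrix.scalar (Fin 6) (X (Sum.inl 2) : Poly 3 3) + sqrtPolyZ13 u a b)
        (Matrix.scalar (Fin 6) (X (Sum.inl 2) : Poly 3 3) - sqrtPolyZ13 u a b)) =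
      C (2 * a * b * Complex.I * ((288 - 1008 * u + 504 * u ^ 2) * a ^ 5 * b)) *
        (X 0 ^ 5 * X 1 ^ 1 * X 2 ^ 0) +
      C (2 * a * b * Complex.I * (-12 * u * b ^ 4)) * (X 0 ^ 0 * X 1 ^ 4 * X 2 ^ 0) := by
  have hu' : (C u : MvPolynomial (Fin 3) ℂ) ^ 3 = 3 * C u - 1 := by
    rw [← map_pow, hu]; simp [map_ofNat]
  have h0 : derivAt (aeval (Sum.elim X 0 : _ → MvPolynomial (Fin 3) ℂ)) (Sum.inl 2)
      (sqrtPolyZ13 u a b) = 0 := by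
    simp only [sqrtPolyZ13, derivAt_sqrtZ13]
    simp only [map_mul, aeval_X, Sum.elim_inl, Sum.elim_inr,
      Pi.zero_apply, mul_zero, map_neg, neg_zero, pderiv_C_mul, pderiv_X, Pi.single_apply,
      Sum.inl.injEq, Fin.reduceEq, if_false, reduceCtorEq, map_zero,
      sqrtZ13Diff_left_x₁, zero_smul]
  rw [map_strDeriv_three_of_sq _ _ h0]
  simp only [sqrtPolyZ13, derivAt_sqrtZ13]
  simp only [map_mul, aeval_X, Sum.elim_inl, Sum.elim_inr,
      Pi.zero_apply, mul_zero, map_neg, neg_zero, pderiv_C_mul, pderiv_X, Pi.single_apply,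
      Sum.inl.injEq, Sum.inr.injEq, Fin.reduceEq, if_false, if_true, reduceCtorEq, map_zero,
      mul_one, map_one, aeval_C, algebraMap_eq,
      sqrtZ13Diff_left_x₁, sqrtZ13Diff_left_x₂, sqrtZ13Diff_left_y₁, sqrtZ13Diff_left_y₂,
      sqrtZ13Diff_left_y₃, Matrix.smul_mul, Matrix.mul_smul, Matrix.trace_smul, smul_eq_mul,
      trace_sqrtZ13_left]
  simp only [map_mul, map_sub, map_add, map_pow, map_ofNat, map_one]
  linear_combination (2 * C a * C b * C Complex.I * (C a * X 0) ^ 5 * (C b * X 1) *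
    (-288 + 144 * C u - 96 * C u ^ 2 - 48 * C u ^ 3)) * hu'

theorem strDeriv_Z13_right :
    aeval (Sum.elim 0 X : _ → MvPolynomial (Fin 3) ℂ)
      (strDeriv (Matrix.scalar (Fin 6) (X (Sum.inl 2) : Poly 3 3) + sqrtPolyZ13 u a b)
        (Matrix.scalar (Fin 6) (X (Sum.inl 2) : Poly 3 3) - sqrtPolyZ13 u a b)) =
      C (2 * a * b * Complex.I * (6 * u - 3)) * (X 0 ^ 2 * X 1 ^ 1 * X 2 ^ 0) +
      C (2 * a * b * Complex.I * (6 - 18 * u)) * (X 0 ^ 0 * X 1 ^ 2 * X 2 ^ 2) +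
      C (2 * a * b * Complex.I * 5) * (X 0 ^ 0 * X 1 ^ 0 * X 2 ^ 5) := by
  have hI : (C Complex.I : MvPolynomial (Fin 3) ℂ) ^ 2 = -1 := by
    rw [← map_pow, Complex.I_sq, map_neg, map_one]
  have h0 : derivAt (aeval (Sum.elim 0 X : _ → MvPolynomial (Fin 3) ℂ)) (Sum.inl 2)
      (sqrtPolyZ13 u a b) = 0 := by
    simp only [sqrtPolyZ13, derivAt_sqrtZ13]
    simp only [map_mul, aeval_X, Sum.elim_inl, Sum.elim_inr,
      Pi.zero_apply, mul_zero, map_neg, neg_zero, pderiv_C_mul, pderiv_X, Pi.single_apply,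
      Sum.inl.injEq, Fin.reduceEq, if_false, reduceCtorEq, map_zero,
      sqrtZ13Diff_right_x₁, zero_smul]
  rw [map_strDeriv_three_of_sq _ _ h0]
  simp only [sqrtPolyZ13, derivAt_sqrtZ13]
  simp only [map_mul, aeval_X, Sum.elim_inl, Sum.elim_inr,
      Pi.zero_apply, mul_zero, map_neg, neg_zero, pderiv_C_mul, pderiv_X, Pi.single_apply,
      Sum.inl.injEq, Sum.inr.injEq, Fin.reduceEq, if_false, if_true, reduceCtorEq, map_zero,
      mul_one, map_one, aeval_C, algebraMap_eq,
      sqrtZ13Diff_right_x₁, sqrtZ13Diff_right_x₂, sqrtZ13Diff_right_y₁, sqrtZ13Diff_right_y₂,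
      sqrtZ13Diff_right_y₃, Matrix.smul_mul, Matrix.mul_smul, Matrix.trace_smul, smul_eq_mul,
      trace_sqrtZ13_right]
  simp only [map_mul, map_sub, map_ofNat, map_one]
  linear_combination (-6 * C a * C b * C Complex.I * X 0 ^ 2 * X 1 * (2 * C u - 1)) * hI

theorem isResidueDatum_Z13 : IsResidueDatum
    (fun i => pderiv i (X 0 ^ 6 + X 0 * X 1 ^ 3 + X 2 ^ 2 : MvPolynomial (Fin 3) ℂ))
    (exponent ![5, 4, 0])
    !![3 * C 18⁻¹ * X 0, -C 18⁻¹ * X 1, 0; X 1 ^ 2, -2 * X 0 ^ 4, 0; 0, 0, C 2⁻¹] := by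
  have h : (C 18⁻¹ * 18 : MvPolynomial (Fin 3) ℂ) = 1 := by
    rw [← map_ofNat C 18, ← map_mul]; norm_num
  have h2 : (C 2⁻¹ * 2 : MvPolynomial (Fin 3) ℂ) = 1 := by
    rw [← map_ofNat C 2, ← map_mul]; norm_num
  intro i
  fin_cases i
  · simp [Fin.sum_univ_three, pderiv_X]
    linear_combination (-X 0 ^ 6) * h
  · simp [Fin.sum_univ_three, pderiv_X]
    ring
  · simp [Fin.sum_univ_three, pderiv_X]
    linear_combination (-X 2) * h2

theorem isResidueDatum_Q11 : IsResidueDatum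
    (fun i => pderiv i (X 1 * X 2 ^ 3 + X 1 ^ 3 + X 0 ^ 2 * X 2 : MvPolynomial (Fin 3) ℂ))
    (exponent ![2, 3, 5])
    !![-27 * C 18⁻¹ * X 1 * X 2, 0, X 0;
      C 18⁻¹ * X 0 * X 1, 6 * C 18⁻¹ * X 1 ^ 2, -2 * C 18⁻¹ * X 1 * X 2;
      9 * C 18⁻¹ * X 0 * X 1, X 2 ^ 3, -X 1 * X 2] := by
  have h : (C 18⁻¹ * 18 : MvPolynomial (Fin 3) ℂ) = 1 := by
    rw [← map_ofNat C 18, ← map_mul]; norm_num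
  intro i
  fin_cases i
  · simp [Fin.sum_univ_three, pderiv_X]
    linear_combination (3 * X 0 * X 1 * X 2 ^ 2) * h
  · simp [Fin.sum_univ_three, pderiv_X]
    linear_combination (-X 1 ^ 4) * h
  · simp [Fin.sum_univ_three, pderiv_X]
    linear_combination (-X 0 ^ 2 * X 1 * X 2) * h

theorem isPotential_Z13 : IsPotential ![1 / 3, 5 / 9, 1]
    (X 0 ^ 6 + X 0 * X 1 ^ 3 + X 2 ^ 2) := by
  refine .of_isResidueDatum isResidueDatum_Z13 (by simp [Fin.forall_fin_succ]) ?_ ?_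
  · refine .add (.add (isWeightedHomogeneous_X_pow ?_)
      (isWeightedHomogeneous_mul_X_pow (isWeightedHomogeneous_X' ?_)))
      (isWeightedHomogeneous_X_pow ?_) <;> simp <;> norm_num
  · convert add_mem (add_mem (X_mul_X_mul_mem_sq 0 0 (X 0 ^ 4)) (X_mul_X_mul_mem_sq 0 1 (X 1 ^ 2)))
      (X_mul_X_mul_mem_sq 2 2 1) using 1
    ring

theorem isPotential_Q11 : IsPotential ![7 / 9, 2 / 3, 4 / 9]
    (X 1 * X 2 ^ 3 + X 1 ^ 3 + X 0 ^ 2 * X 2) := by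
  refine .of_isResidueDatum isResidueDatum_Q11 (by simp [Fin.forall_fin_succ]) ?_ ?_
  · refine .add (.add (isWeightedHomogeneous_mul_X_pow (isWeightedHomogeneous_X' ?_))
      (isWeightedHomogeneous_X_pow ?_))
      (isWeightedHomogeneous_mul_X (isWeightedHomogeneous_X_pow ?_)) <;> simp <;> norm_num
  · convert add_mem (add_mem (X_mul_X_mul_mem_sq 1 2 (X 2 ^ 2)) (X_mul_X_mul_mem_sq 1 1 (X 1)))
      (X_mul_X_mul_mem_sq 0 0 (X 2)) using 1
    ring

/-- The two rescalings exist because `u` and `8 - 24 u + 12 u ^ 2` are nonzero: they are prime to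
`u ^ 3 - 3 u + 1`. -/
theorem exists_parameters_Z13 : ∃ u a b : ℂ, u ^ 3 = 3 * u - 1 ∧
    (8 - 24 * u + 12 * u ^ 2) * a ^ 6 = -1 ∧ 4 * u * a * b ^ 3 = -1 := by
  obtain ⟨u, hu⟩ := IsAlgClosed.exists_root (Polynomial.X ^ 3 - 3 * Polynomial.X + 1 :
    Polynomial ℂ) (by
      have : (Polynomial.X ^ 3 - 3 * Polynomial.X + 1 : Polynomial ℂ).degree = 3 := by
        compute_degree!
      rw [this]; norm_num)
  have hu : u ^ 3 = 3 * u - 1 := by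
    simp [Polynomial.IsRoot] at hu
    linear_combination hu
  have hu0 : u ≠ 0 := by
    rintro rfl
    norm_num at hu
  have hc : 8 - 24 * u + 12 * u ^ 2 ≠ 0 := fun h => one_ne_zero (α := ℂ) (by
    linear_combination (5 / 4 - 3 / 4 * u - 3 / 4 * u ^ 2) * h - (9 - 9 * u) * hu)
  obtain ⟨a, ha⟩ := IsAlgClosed.exists_pow_nat_eq (-(8 - 24 * u + 12 * u ^ 2)⁻¹) (n := 6)
    (by norm_num)
  have ha : (8 - 24 * u + 12 * u ^ 2) * a ^ 6 = -1 := by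
    rw [ha, mul_neg, mul_inv_cancel₀ hc]
  have ha0 : a ≠ 0 := by
    rintro rfl
    norm_num at ha
  obtain ⟨b, hb⟩ := IsAlgClosed.exists_pow_nat_eq (-(4 * u * a)⁻¹) (n := 3) (by norm_num)
  refine ⟨u, a, b, hu, ha, ?_⟩
  rw [hb, mul_neg, mul_inv_cancel₀ (by simp [hu0, ha0])]

theorem hasTrueOrbifoldEquivalence_Z13 : HasTrueOrbifoldEquivalence 6 (10 / 9)
    (X 0 ^ 6 + X 0 * X 1 ^ 3 + X 2 ^ 2 : MvPolynomial (Fin 3) ℂ)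
    (X 1 * X 2 ^ 3 + X 1 ^ 3 + X 0 ^ 2 * X 2 : MvPolynomial (Fin 3) ℂ) := by
  obtain ⟨u, a, b, hu, ha, hab⟩ := exists_parameters_Z13
  have hq : (2 * Complex.I * b ^ 2 * ((8 - 28 * u + 14 * u ^ 2) * a ^ 6 + 2 * u * a * b ^ 3) *
      (-4 * Complex.I * u * a * b)) * (8 - 24 * u + 12 * u ^ 2) =
      8 * (3 - 10 * u + 5 * u ^ 2) := by
    linear_combination (-8 * u * a * b ^ 3 * ((8 - 28 * u + 14 * u ^ 2) * a ^ 6 + 2 * u * a * b ^ 3)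
        * (8 - 24 * u + 12 * u ^ 2)) * Complex.I_sq +
      (2 * (8 - 24 * u + 12 * u ^ 2) * ((8 - 28 * u + 14 * u ^ 2) * a ^ 6 + 2 * u * a * b ^ 3) -
        (8 - 24 * u + 12 * u ^ 2)) * hab - 2 * (8 - 28 * u + 14 * u ^ 2) * ha
  refine .of_isGradedFactorisation (isGradedFactorisation_Z13 hu ha hab) isPotential_Z13
    isPotential_Q11 ?_ ?_
    isResidueDatum_Z13 (e₁ := 5 / 3) (D₁ := C 36⁻¹ * X 1 ^ 3 - C 6⁻¹ * X 0 ^ 5) ?_ ?_ ?_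
    isResidueDatum_Q11 (e₂ := 32 / 9) (D₂ := C 2⁻¹ * X 1 ^ 4 * X 2 ^ 2 -
      C 6⁻¹ * X 1 ^ 2 * X 2 ^ 5 + C 18⁻¹ * X 0 ^ 2 * X 1 * X 2 ^ 3 -
      C 6⁻¹ * X 0 ^ 2 * X 1 ^ 3) ?_ ?_ ?_
    (strDeriv_Z13_left hu) strDeriv_Z13_right
    (qL := 2 * Complex.I * b ^ 2 * ((8 - 28 * u + 14 * u ^ 2) * a ^ 6 + 2 * u * a * b ^ 3))
    (qR := -4 * Complex.I * u * a * b) ?_ ?_ ?_ ?_ ?_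
  · simp [centralCharge, Fin.sum_univ_three]; norm_num
  · simp [centralCharge, Fin.sum_univ_three]; norm_num
  · have h36 : (C 36⁻¹ : MvPolynomial (Fin 3) ℂ) = C 2⁻¹ * C 18⁻¹ := by
      rw [← map_mul]; norm_num
    have h6 : (C 6⁻¹ : MvPolynomial (Fin 3) ℂ) = C 2⁻¹ * (6 * C 18⁻¹) := by
      rw [← map_ofNat C 6, ← map_mul, ← map_mul]; norm_num
    rw [h36, h6]
    simp [Matrix.det_fin_three]
    ring
  · exact .sub (isWeightedHomogeneous_mul_X_pow (isWeightedHomogeneous_C' (by simp; norm_num)))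
      (isWeightedHomogeneous_mul_X_pow (isWeightedHomogeneous_C' (by simp; norm_num)))
  · simp [weight_exponent, Fin.sum_univ_three]; norm_num
  · have h2 : (C 2⁻¹ : MvPolynomial (Fin 3) ℂ) = 9 * C 18⁻¹ := by
      rw [← map_ofNat C 9, ← map_mul]; norm_num
    have h6 : (C 6⁻¹ : MvPolynomial (Fin 3) ℂ) = 3 * C 18⁻¹ := by
      rw [← map_ofNat C 3, ← map_mul]; norm_num
    have h : (C 18⁻¹ * 18 : MvPolynomial (Fin 3) ℂ) = 1 := by
      rw [← map_ofNat C 18, ← map_mul]; norm_num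
    rw [h2, h6]
    simp [Matrix.det_fin_three]
    linear_combination (9 * C 18⁻¹ * X 1 ^ 4 * X 2 ^ 2 - 3 * C 18⁻¹ * X 1 ^ 2 * X 2 ^ 5 -
      3 * C 18⁻¹ * X 0 ^ 2 * X 1 ^ 3) * h
  · exact .sub (.add (.sub
      (isWeightedHomogeneous_mul_X_pow (isWeightedHomogeneous_mul_X_pow
        (isWeightedHomogeneous_C' (by simp; norm_num))))
      (isWeightedHomogeneous_mul_X_pow (isWeightedHomogeneous_mul_X_pow
        (isWeightedHomogeneous_C' (by simp; norm_num)))))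
      (isWeightedHomogeneous_mul_X_pow (isWeightedHomogeneous_mul_X
        (isWeightedHomogeneous_mul_X_pow (isWeightedHomogeneous_C' (by simp; norm_num))))))
      (isWeightedHomogeneous_mul_X_pow (isWeightedHomogeneous_mul_X_pow
        (isWeightedHomogeneous_C' (by simp; norm_num))))
  · simp [weight_exponent, Fin.sum_univ_three]; norm_num
  · set c := 2 * a * b * Complex.I
    trans (-1) ^ (3 + 1).choose 2 * coeff (exponent ![5, 4, 0])
      (C (36⁻¹ * (c * ((288 - 1008 * u + 504 * u ^ 2) * a ^ 5 * b))) *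
          (X 0 ^ 5 * X 1 ^ 4 * X 2 ^ 0) +
        C (36⁻¹ * (c * (-12 * u * b ^ 4))) * (X 0 ^ 0 * X 1 ^ 7 * X 2 ^ 0) +
        C (-6⁻¹ * (c * ((288 - 1008 * u + 504 * u ^ 2) * a ^ 5 * b))) *
          (X 0 ^ 10 * X 1 ^ 1 * X 2 ^ 0) +
        C (-6⁻¹ * (c * (-12 * u * b ^ 4))) * (X 0 ^ 5 * X 1 ^ 4 * X 2 ^ 0) :
          MvPolynomial (Fin 3) ℂ)
    · congr! 2
      simp only [C_mul, C_neg]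
      ring
    · simp only [coeff_add, coeff_C_mul, coeff_X_pow_mul_X_pow_mul_X_pow]
      simp [Nat.choose, c]
      ring
  · set c := 2 * a * b * Complex.I with hc
    trans (-1) ^ (3 + 1).choose 2 * coeff (exponent ![2, 3, 5])
      (C (-6⁻¹ * (c * (6 * u - 3))) * (X 0 ^ 2 * X 1 ^ 3 * X 2 ^ 5) +
        C (18⁻¹ * (c * (6 - 18 * u))) * (X 0 ^ 2 * X 1 ^ 3 * X 2 ^ 5) +
        C (-6⁻¹ * (c * 5)) * (X 0 ^ 2 * X 1 ^ 3 * X 2 ^ 5) +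
        (C (2⁻¹ * (c * (6 * u - 3))) * (X 0 ^ 2 * X 1 ^ 5 * X 2 ^ 2) +
        C (2⁻¹ * (c * (6 - 18 * u))) * (X 0 ^ 0 * X 1 ^ 6 * X 2 ^ 4) +
        C (2⁻¹ * (c * 5)) * (X 0 ^ 0 * X 1 ^ 4 * X 2 ^ 7) +
        C (-6⁻¹ * (c * (6 - 18 * u))) * (X 0 ^ 0 * X 1 ^ 4 * X 2 ^ 7) +
        C (-6⁻¹ * (c * 5)) * (X 0 ^ 0 * X 1 ^ 2 * X 2 ^ 10) +
        C (18⁻¹ * (c * (6 * u - 3))) * (X 0 ^ 4 * X 1 ^ 2 * X 2 ^ 3) +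
        C (18⁻¹ * (c * 5)) * (X 0 ^ 2 * X 1 ^ 1 * X 2 ^ 8) +
        C (-6⁻¹ * (c * (6 * u - 3))) * (X 0 ^ 4 * X 1 ^ 4 * X 2 ^ 0) +
        C (-6⁻¹ * (c * (6 - 18 * u))) * (X 0 ^ 2 * X 1 ^ 5 * X 2 ^ 2)) : MvPolynomial (Fin 3) ℂ)
    · congr! 2
      simp only [C_mul, C_neg]
      ring
    · simp only [coeff_add, coeff_C_mul, coeff_X_pow_mul_X_pow_mul_X_pow]
      simp [Nat.choose, c]
      ring
  -- In each of the three cases `hq` equates to zero a polynomial prime to `u ^ 3 - 3 u + 1`.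
  · intro h
    rw [h] at hq
    refine one_ne_zero (α := ℂ) ?_
    linear_combination (-(26 / 3 - 5 / 3 * u - 10 / 3 * u ^ 2) / 8) * hq - (25 - 50 / 3 * u) * hu
  · intro h
    rw [h] at hq
    refine one_ne_zero (α := ℂ) ?_
    linear_combination (-(-61 + 7 * u + 21 * u ^ 2) / 4) * hq - (-245 + 147 * u) * hu
  · intro h
    rw [h] at hq
    refine one_ne_zero (α := ℂ) ?_
    linear_combination (-(157 / 73 - 39 / 73 * u - 65 / 73 * u ^ 2) / 4) * hq -
      (1183 / 73 - 845 / 73 * u) * hu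

end Z13

/-! ### `E₁₃` and `Z₁₁` -/

section E13

/-- Parameters for which `matrixE13` below has determinant
`z ^ 3 + e x ^ 5 z + ε u ^ 3 v + α v ^ 5`: the fields `ε_eq` to `mul_mul_eq` together say that the
coefficients of all other monomials vanish. -/
structure E13Parameters (R : Type*) [CommRing R] where
  (a α ε b d A B t e : R)
  ε_eq : ε = -1 - α
  α_mul : α * (a + 3) = a - 3
  add_eq : t + ε * (b + d) = a ^ 2
  mul_add_eq : α * b + d + t = -3
  mul_sub_eq : α * (B - b) - d + A + 2 * t = 2
  mul_sub_add_eq : a * (b - d) + A + B = 0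
  mul_mul_add_eq : a * (B - A) + ε * b * d + t * (b + d) = 0
  mul_mul_eq : b * d * t + A * B = A * b + d * B
  e_eq : e = -(A * b + d * B)

/-- The linear form in `(b, d, A, B)` giving the coefficient of `x ^ 3 z ^ 2` in the supertrace for
`matrixE13` at `u = v = 0`. -/
def coeffE13₃ {R : Type*} [CommRing R] (a b d A B t : R) : R :=
  12 * a * b + 6 * a * d + 9 * a * A - 6 * d * t - 9 * A + 18 * B

/-- The cubic form in `(b, d, A, B)` giving the coefficient of `x ^ 8` in the supertrace for
`matrixE13` at `u = v = 0`. -/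
def coeffE13₈ {R : Type*} [CommRing R] (a b d A B t : R) : R :=
  -2 * a * b ^ 2 * d * t - 2 * a * b ^ 2 * A - 4 * a * b * d ^ 2 * t + 2 * a * b * d * A -
    2 * a * b * d * B + 2 * a * b * A ^ 2 + 3 * a * b * A * B + 2 * a * d ^ 2 * B -
    2 * a * d * A * B + 5 * a * d * B ^ 2 + 5 * b ^ 2 * A * t + 3 * b * d * A * t +
    2 * b * d * B * t - 3 * b * A ^ 2 - 3 * b * A * B - 3 * d ^ 2 * B * t - 3 * d * A * B -
    3 * d * B ^ 2 + 6 * A ^ 2 * B - 3 * A * B ^ 2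

namespace E13Parameters

variable {R S : Type*} [CommRing R] [CommRing S]

/-- The image of a system of parameters under a ring homomorphism. -/
@[simps]
def map (f : R →+* S) (P : E13Parameters R) : E13Parameters S where
  a := f P.a
  α := f P.α
  ε := f P.ε
  b := f P.b
  d := f P.d
  A := f P.A
  B := f P.B
  t := f P.t
  e := f P.e
  ε_eq := by simpa using congrArg f P.ε_eq
  α_mul := by simpa [map_ofNat] using congrArg f P.α_mul
  add_eq := by simpa using congrArg f P.add_eq
  mul_add_eq := by simpa [map_ofNat] using congrArg f P.mul_add_eq
  mul_sub_eq := by simpa [map_ofNat] using congrArg f P.mul_sub_eq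
  mul_sub_add_eq := by simpa using congrArg f P.mul_sub_add_eq
  mul_mul_add_eq := by simpa [map_ofNat] using congrArg f P.mul_mul_add_eq
  mul_mul_eq := by simpa using congrArg f P.mul_mul_eq
  e_eq := by simpa using congrArg f P.e_eq

/-- The coefficient of `x ^ 3 z ^ 2` in the supertrace for `matrixE13` at `u = v = 0`. -/
def coeff₃ (P : E13Parameters R) : R := coeffE13₃ P.a P.b P.d P.A P.B P.t

/-- The coefficient of `x ^ 8` in the supertrace for `matrixE13` at `u = v = 0`. -/
def coeff₈ (P : E13Parameters R) : R := coeffE13₈ P.a P.b P.d P.A P.B P.t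

theorem coeff₃_map (f : R →+* S) (P : E13Parameters R) : (P.map f).coeff₃ = f P.coeff₃ := by
  simp [coeff₃, coeffE13₃, map_ofNat]

theorem coeff₈_map (f : R →+* S) (P : E13Parameters R) : (P.map f).coeff₈ = f P.coeff₈ := by
  simp [coeff₈, coeffE13₈, map_ofNat]

end E13Parameters

variable {R : Type*} [CommRing R]

/-- A matrix of determinant `z ^ 3 + e x ^ 5 z + ε u ^ 3 v + α v ^ 5`. -/
def matrixE13 (P : E13Parameters R) (x z u v : R) : Matrix (Fin 3) (Fin 3) R :=
  !![z + x * v, P.α * v ^ 2 + P.a * x * u + P.A * x ^ 3, P.ε * u * v + P.t * x ^ 2 * v;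
    u + P.b * x ^ 2, z - 2 * x * v, v ^ 2 - P.a * x * u + P.B * x ^ 3;
    v, u + P.d * x ^ 2, z + x * v]

theorem det_matrixE13 (P : E13Parameters R) (x z u v : R) : (matrixE13 P x z u v).det =
    z ^ 3 + P.e * x ^ 5 * z + P.ε * u ^ 3 * v + P.α * v ^ 5 := by
  simp [matrixE13, Matrix.det_fin_three]
  linear_combination (-z * u * v ^ 2 + 2 * x * u * v ^ 3) * P.ε_eq - x * u * v ^ 3 * P.α_mul +
    x ^ 2 * u ^ 2 * v * P.add_eq - x ^ 2 * z * v ^ 2 * P.mul_add_eq +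
    x ^ 3 * v ^ 3 * P.mul_sub_eq - x ^ 3 * z * u * P.mul_sub_add_eq +
    x ^ 4 * u * v * (P.mul_mul_add_eq - P.mul_sub_add_eq) + x ^ 6 * v * P.mul_mul_eq -
    x ^ 5 * z * P.e_eq

theorem isWeightedHomogeneous_matrixE13 {σ : Type*} {w : σ → ℚ}
    {P : E13Parameters (MvPolynomial σ R)} {x z u v : MvPolynomial σ R}
    (ha : IsWeightedHomogeneous w P.a (0 : ℚ)) (hα : IsWeightedHomogeneous w P.α (0 : ℚ))
    (hε : IsWeightedHomogeneous w P.ε (0 : ℚ)) (hb : IsWeightedHomogeneous w P.b (0 : ℚ))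
    (hd : IsWeightedHomogeneous w P.d (0 : ℚ)) (hA : IsWeightedHomogeneous w P.A (0 : ℚ))
    (hB : IsWeightedHomogeneous w P.B (0 : ℚ)) (ht : IsWeightedHomogeneous w P.t (0 : ℚ))
    (hx : IsWeightedHomogeneous w x (4 / 15 : ℚ)) (hz : IsWeightedHomogeneous w z (2 / 3 : ℚ))
    (hu : IsWeightedHomogeneous w u (8 / 15 : ℚ)) (hv : IsWeightedHomogeneous w v (2 / 5 : ℚ))
    (i j : Fin 3) : IsWeightedHomogeneous w (matrixE13 P x z u v i j)
      ((![0, 2 / 15, 4 / 15] : Fin 3 → ℚ) j - (![1 / 3, 7 / 15, 3 / 5] : Fin 3 → ℚ) i + 1) := by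
  fin_cases i <;> fin_cases j <;> simp only [matrixE13, Matrix.of_apply, Matrix.cons_val',
    Matrix.cons_val_zero, Matrix.cons_val_one, Matrix.cons_val, Fin.zero_eta, Fin.mk_one,
    Fin.reduceFinMk]
  all_goals
    repeat' with_reducible_and_instances first
      | apply IsWeightedHomogeneous.add
      | apply IsWeightedHomogeneous.sub
      | apply hx.of_eq
      | apply hz.of_eq
      | apply hu.of_eq
      | apply hv.of_eq
      | apply ha.of_eq
      | apply hα.of_eq
      | apply hε.of_eq
      | apply hb.of_eq
      | apply hd.of_eq
      | apply hA.of_eq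
      | apply hB.of_eq
      | apply ht.of_eq
      | apply isWeightedHomogeneous_ofNat'
      | apply isWeightedHomogeneous_mul_right hx
      | apply isWeightedHomogeneous_mul_right hu
      | apply isWeightedHomogeneous_mul_right hv
      | apply isWeightedHomogeneous_mul_pow hx
      | apply isWeightedHomogeneous_mul_pow hv
      | apply isWeightedHomogeneous_pow_of_eq hv
  all_goals norm_num

/-- The differential of `matrixE13`. -/
def matrixE13Diff (P : E13Parameters R) (x u v dx dz du dv : R) : Matrix (Fin 3) (Fin 3) R :=
  !![dz + v * dx + x * dv,
      2 * P.α * v * dv + P.a * (u * dx + x * du) + 3 * P.A * x ^ 2 * dx,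
      P.ε * (v * du + u * dv) + P.t * (2 * x * v * dx + x ^ 2 * dv);
    du + 2 * P.b * x * dx,
      dz - 2 * (v * dx + x * dv),
      2 * v * dv - P.a * (u * dx + x * du) + 3 * P.B * x ^ 2 * dx;
    dv,
      du + 2 * P.d * x * dx,
      dz + v * dx + x * dv]

theorem matrixE13Diff_mul (P : E13Parameters R) (x u v c dx dz du dv : R) :
    matrixE13Diff P x u v (c * dx) (c * dz) (c * du) (c * dv) =
      c • matrixE13Diff P x u v dx dz du dv := by
  ext i j
  fin_cases i <;> fin_cases j <;> simp [matrixE13Diff]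
  all_goals ring

theorem mapMatrix_matrixE13 {S : Type*} [CommRing S] [Algebra ℂ R] [Algebra ℂ S] (φ : R →ₐ[ℂ] S)
    (P : E13Parameters R) (x z u v : R) : φ.mapMatrix (matrixE13 P x z u v) =
      matrixE13 (P.map φ.toRingHom) (φ x) (φ z) (φ u) (φ v) := by
  ext i j
  fin_cases i <;> fin_cases j <;> simp [matrixE13, map_ofNat]

theorem derivAt_matrixE13 [Algebra ℂ R] (φ : Poly 2 2 →ₐ[ℂ] R) (i : Fin 2 ⊕ Fin 2)
    (P : E13Parameters ℂ) (x z u v : Poly 2 2) :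
    derivAt φ i (matrixE13 (P.map C) x z u v) =
      matrixE13Diff ((P.map C).map φ.toRingHom) (φ x) (φ u) (φ v) (φ (pderiv i x))
        (φ (pderiv i z)) (φ (pderiv i u)) (φ (pderiv i v)) := by
  ext1 j k
  rw [derivAt_apply]
  fin_cases j <;> fin_cases k <;>
    simp only [matrixE13, matrixE13Diff, E13Parameters.map, Matrix.of_apply, Matrix.cons_val',
      Matrix.cons_val_zero, Matrix.cons_val_one, Matrix.cons_val, Fin.zero_eta, Fin.mk_one,
      Fin.reduceFinMk, map_add, map_sub, map_mul, map_pow, map_ofNat, map_zero, pderiv_mul,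
      pderiv_pow, pderiv_C, pderiv_ofNat, Nat.cast_ofNat, AlgHom.toRingHom_eq_coe,
      RingHom.coe_coe]
  all_goals ring

theorem trace_matrixE13_left (P : E13Parameters R) (x z : R) :
    Matrix.trace (matrixE13Diff P x 0 0 1 0 0 0 *
      adjugatePolar (matrixE13 P x z 0 0) (matrixE13Diff P x 0 0 0 1 0 0) *
      (matrixE13Diff P x 0 0 0 0 1 0 *
        adjugatePolar (matrixE13 P x z 0 0) (matrixE13Diff P x 0 0 0 0 0 1))) -
    Matrix.trace (adjugatePolar (matrixE13 P x z 0 0) (matrixE13Diff P x 0 0 1 0 0 0) *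
      matrixE13Diff P x 0 0 0 1 0 0 *
      (adjugatePolar (matrixE13 P x z 0 0) (matrixE13Diff P x 0 0 0 0 1 0) *
        matrixE13Diff P x 0 0 0 0 0 1)) =
      P.coeff₃ * x ^ 3 * z ^ 2 + P.coeff₈ * x ^ 8 := by
  simp [adjugatePolar, matrixE13, matrixE13Diff, Matrix.trace_fin_three, E13Parameters.coeff₃,
    E13Parameters.coeff₈, coeffE13₃, coeffE13₈]
  ring

theorem trace_matrixE13_right (P : E13Parameters R) (u v : R) :
    Matrix.trace (matrixE13Diff P 0 u v 1 0 0 0 *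
      adjugatePolar (matrixE13 P 0 0 u v) (matrixE13Diff P 0 u v 0 1 0 0) *
      (matrixE13Diff P 0 u v 0 0 1 0 *
        adjugatePolar (matrixE13 P 0 0 u v) (matrixE13Diff P 0 u v 0 0 0 1))) -
    Matrix.trace (adjugatePolar (matrixE13 P 0 0 u v) (matrixE13Diff P 0 u v 1 0 0 0) *
      matrixE13Diff P 0 u v 0 1 0 0 *
      (adjugatePolar (matrixE13 P 0 0 u v) (matrixE13Diff P 0 u v 0 0 1 0) *
        matrixE13Diff P 0 u v 0 0 0 1)) =
      3 * P.a * P.ε * u ^ 4 - 15 * P.a * P.α * u * v ^ 4 := by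
  simp [adjugatePolar, matrixE13, matrixE13Diff, Matrix.trace_fin_three]
  linear_combination u * v ^ 4 * ((3 * P.a * P.α + 2 * P.a + 12 * P.α - 15) * P.ε_eq +
    (5 - 4 * P.α) * P.α_mul)

/-- `matrixE13` for complex parameters and rescaled variables of `ℂ[x₁, x₂, y₁, y₂]`. -/
noncomputable def polyE13 (P : E13Parameters ℂ) (l m n : ℂ) : Matrix (Fin 3) (Fin 3) (Poly 2 2) :=
  matrixE13 (P.map C) (C l * X (Sum.inl 0)) (X (Sum.inl 1)) (C m * X (Sum.inr 0))
    (C n * X (Sum.inr 1))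

variable {P : E13Parameters ℂ} {l m n : ℂ}

theorem map_strDeriv_polyE13 [Algebra ℂ R] (φ : Poly 2 2 →ₐ[ℂ] R) {Q : E13Parameters R}
    {x z u v : R} (hQ : (P.map C).map φ.toRingHom = Q)
    (hx : φ (C l * X (Sum.inl 0)) = x) (hz : φ (X (Sum.inl 1)) = z)
    (hu : φ (C m * X (Sum.inr 0)) = u) (hv : φ (C n * X (Sum.inr 1)) = v) :
    φ (strDeriv (polyE13 P l m n) (polyE13 P l m n).adjugate) =
      φ (C l) * 1 * (φ (C m) * φ (C n)) *
      (Matrix.trace (matrixE13Diff Q x u v 1 0 0 0 *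
        adjugatePolar (matrixE13 Q x z u v) (matrixE13Diff Q x u v 0 1 0 0) *
        (matrixE13Diff Q x u v 0 0 1 0 *
          adjugatePolar (matrixE13 Q x z u v) (matrixE13Diff Q x u v 0 0 0 1))) -
      Matrix.trace (adjugatePolar (matrixE13 Q x z u v) (matrixE13Diff Q x u v 1 0 0 0) *
        matrixE13Diff Q x u v 0 1 0 0 *
        (adjugatePolar (matrixE13 Q x z u v) (matrixE13Diff Q x u v 0 0 1 0) *
          matrixE13Diff Q x u v 0 0 0 1))) := by
  apply map_strDeriv_adjugate
  · rw [polyE13, mapMatrix_matrixE13, hQ, hx, hz, hu, hv]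
  all_goals
    rw [polyE13, derivAt_matrixE13, hQ, hx, hu, hv, ← matrixE13Diff_mul]
    simp only [pderiv_C_mul, pderiv_X, Pi.single_apply, Sum.inl.injEq, Sum.inr.injEq,
      Fin.reduceEq, reduceCtorEq, if_true, if_false, map_one, map_zero, mul_zero, mul_one]

theorem E13Parameters.map_C_map_aeval (P : E13Parameters ℂ)
    (f : Fin 2 ⊕ Fin 2 → MvPolynomial (Fin 2) ℂ) :
    (P.map (C : ℂ →+* Poly 2 2)).map (aeval f).toRingHom = P.map C := by
  simp [E13Parameters.map, algebraMap_eq]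

theorem strDeriv_polyE13_left :
    aeval (Sum.elim X 0 : _ → MvPolynomial (Fin 2) ℂ)
      (strDeriv (polyE13 P l m n) (polyE13 P l m n).adjugate) =
    C (l * m * n) * (C (P.coeff₃ * l ^ 3) * (X 0 ^ 3 * X 1 ^ 2) +
      C (P.coeff₈ * l ^ 8) * (X 0 ^ 8 * X 1 ^ 0)) := by
  rw [map_strDeriv_polyE13 (x := C l * X 0) (z := X 1) (u := 0) (v := 0) _ (P.map_C_map_aeval _)
    (by simp [algebraMap_eq]) (by simp) (by simp) (by simp), trace_matrixE13_left,
    E13Parameters.coeff₃_map, E13Parameters.coeff₈_map]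
  simp only [aeval_C, algebraMap_eq, map_mul, map_pow]
  ring

theorem strDeriv_polyE13_right :
    aeval (Sum.elim 0 X : _ → MvPolynomial (Fin 2) ℂ)
      (strDeriv (polyE13 P l m n) (polyE13 P l m n).adjugate) =
    C (l * m * n) * (C (3 * P.a * P.ε * m ^ 4) * (X 0 ^ 4 * X 1 ^ 0) +
      C (-15 * P.a * P.α * m * n ^ 4) * (X 0 ^ 1 * X 1 ^ 4)) := by
  rw [map_strDeriv_polyE13 (x := 0) (z := 0) (u := C m * X 0) (v := C n * X 1) _ (P.map_C_map_aeval
    _)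
    (by simp) (by simp) (by simp [algebraMap_eq]) (by simp [algebraMap_eq]), trace_matrixE13_right]
  simp only [E13Parameters.map, aeval_C, algebraMap_eq, map_mul, map_pow, map_neg, map_ofNat]
  ring


theorem isResidueDatum_E13 : IsResidueDatum
    (fun i => pderiv i (X 0 ^ 5 * X 1 + X 1 ^ 3 : MvPolynomial (Fin 2) ℂ)) (exponent ![8, 2])
    !![-9 * C 15⁻¹ * X 1, X 0 ^ 4; -C 15⁻¹ * X 0, 5 * C 15⁻¹ * X 1] := by
  have h : (C 15⁻¹ * 15 : MvPolynomial (Fin 2) ℂ) = 1 := by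
    rw [← map_ofNat C 15, ← map_mul]; norm_num
  intro i
  fin_cases i
  · simp [Fin.sum_univ_two, pderiv_X]
    linear_combination (3 * X 0 ^ 4 * X 1 ^ 2) * h
  · simp [Fin.sum_univ_two, pderiv_X]
    linear_combination (-X 1 ^ 3) * h

theorem isResidueDatum_Z11 : IsResidueDatum
    (fun i => pderiv i (X 0 ^ 3 * X 1 + X 1 ^ 5 : MvPolynomial (Fin 2) ℂ)) (exponent ![4, 4])
    !![-25 * C 15⁻¹ * X 1 ^ 3, X 0 ^ 2; -C 15⁻¹ * X 0, 3 * C 15⁻¹ * X 1] := by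
  have h : (C 15⁻¹ * 15 : MvPolynomial (Fin 2) ℂ) = 1 := by
    rw [← map_ofNat C 15, ← map_mul]; norm_num
  intro i
  fin_cases i
  · simp [Fin.sum_univ_two, pderiv_X]
    linear_combination (5 * X 0 ^ 2 * X 1 ^ 4) * h
  · simp [Fin.sum_univ_two, pderiv_X]
    linear_combination (-X 1 ^ 5) * h

theorem isPotential_E13 : IsPotential ![4 / 15, 2 / 3] (X 0 ^ 5 * X 1 + X 1 ^ 3) := by
  refine .of_isResidueDatum isResidueDatum_E13 (by simp [Fin.forall_fin_two]) ?_ ?_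
  · refine .add (isWeightedHomogeneous_mul_X (isWeightedHomogeneous_X_pow ?_))
      (isWeightedHomogeneous_X_pow ?_) <;> norm_num
  · convert add_mem (X_mul_X_mul_mem_sq 0 1 (X 0 ^ 4)) (X_mul_X_mul_mem_sq 1 1 (X 1)) using 1
    ring

theorem isPotential_Z11 : IsPotential ![8 / 15, 2 / 5] (X 0 ^ 3 * X 1 + X 1 ^ 5) := by
  refine .of_isResidueDatum isResidueDatum_Z11 (by simp [Fin.forall_fin_two]) ?_ ?_
  · refine .add (isWeightedHomogeneous_mul_X (isWeightedHomogeneous_X_pow ?_))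
      (isWeightedHomogeneous_X_pow ?_) <;> norm_num
  · convert add_mem (X_mul_X_mul_mem_sq 0 1 (X 0 ^ 2)) (X_mul_X_mul_mem_sq 1 1 (X 1 ^ 3)) using 1
    ring

theorem isGradedFactorisation_E13 {P : E13Parameters ℂ} {l m n : ℂ} (hl : P.e * l ^ 5 = 1)
    (hn : P.α * n ^ 5 = -1) (hm : P.ε * (m ^ 3 * n) = -1) :
    IsGradedFactorisation ![4 / 15, 2 / 3] ![8 / 15, 2 / 5] (X 0 ^ 5 * X 1 + X 1 ^ 3)
      (X 0 ^ 3 * X 1 + X 1 ^ 5) (polyE13 P l m n) (polyE13 P l m n).adjugate := by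
  have h₁ : (C P.e : Poly 2 2) * C l ^ 5 = 1 := by rw [← map_pow, ← map_mul, hl, map_one]
  have h₂ : (C P.α : Poly 2 2) * C n ^ 5 = -1 := by
    rw [← map_pow, ← map_mul, hn, map_neg, map_one]
  have h₃ : (C P.ε : Poly 2 2) * (C m ^ 3 * C n) = -1 := by
    rw [← map_pow, ← map_mul, ← map_mul, hm, map_neg, map_one]
  have hC (c : ℂ) : IsWeightedHomogeneous
      (Sum.elim ![4 / 15, 2 / 3] ![8 / 15, 2 / 5] : Fin 2 ⊕ Fin 2 → ℚ)
      (C c : Poly 2 2) (0 : ℚ) := isWeightedHomogeneous_C' rfl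
  refine .of_det ?_ ![1 / 3, 7 / 15, 3 / 5] ![0, 2 / 15, 4 / 15] ?_ ?_ ?_ ?_
  · rw [polyE13, det_matrixE13]
    simp [difference]
    linear_combination (X (Sum.inl 0) ^ 5 * X (Sum.inl 1)) * h₁ + X (Sum.inr 1) ^ 5 * h₂ +
      (X (Sum.inr 0) ^ 3 * X (Sum.inr 1)) * h₃
  · refine isWeightedHomogeneous_matrixE13 (hC _) (hC _) (hC _) (hC _) (hC _) (hC _) (hC _) (hC _)
      ?_ ?_ ?_ ?_
    · exact isWeightedHomogeneous_mul_X (isWeightedHomogeneous_C' (by norm_num))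
    · exact isWeightedHomogeneous_X' (by norm_num)
    · exact isWeightedHomogeneous_mul_X (isWeightedHomogeneous_C' (by norm_num))
    · exact isWeightedHomogeneous_mul_X (isWeightedHomogeneous_C' (by norm_num))
  · simp; norm_num
  · simp [Fin.forall_fin_succ]; norm_num
  · simp [Fin.forall_fin_succ]; norm_num

theorem hasTrueOrbifoldEquivalence_E13_of_parameters {P : E13Parameters ℂ} {l m n : ℂ}
    (hl : P.e * l ^ 5 = 1) (hn : P.α * n ^ 5 = -1) (hm : P.ε * (m ^ 3 * n) = -1)
    (hP : 8 * P.a * (3 * P.coeff₈ - P.coeff₃ * P.e) = 15 * (15 + P.a ^ 2) * P.e ^ 2 * P.ε)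
    (h0 : P.a ^ 2 ≠ -15) (h1 : P.a ^ 2 ≠ -11) (h2 : P.a ^ 2 ≠ -19) :
    HasTrueOrbifoldEquivalence 3 (16 / 15)
      (X 0 ^ 5 * X 1 + X 1 ^ 3 : MvPolynomial (Fin 2) ℂ)
      (X 0 ^ 3 * X 1 + X 1 ^ 5 : MvPolynomial (Fin 2) ℂ) := by
  have hq : 4 * (-l * m * n * (P.coeff₃ * l ^ 3 / 15 - P.coeff₈ * l ^ 8 / 5) *
      (-2 * P.a * l * m ^ 2)) = 15 + P.a ^ 2 := by
    linear_combination (-(l ^ 10 * (m ^ 3 * n)) / 15) * hP -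
      (8 * P.a / 15 * l ^ 5 * (m ^ 3 * n) * P.coeff₃) * hl -
      (l ^ 10 * P.e ^ 2 * (15 + P.a ^ 2)) * hm + ((15 + P.a ^ 2) * (P.e * l ^ 5 + 1)) * hl
  refine .of_isGradedFactorisation (isGradedFactorisation_E13 hl hn hm) isPotential_E13
    isPotential_Z11 ?_ ?_
    isResidueDatum_E13 (e₁ := 4 / 3) (D₁ := C 15⁻¹ * X 0 ^ 5 - C 5⁻¹ * X 1 ^ 2) ?_ ?_ ?_
    isResidueDatum_Z11 (e₂ := 8 / 5) (D₂ := C 15⁻¹ * X 0 ^ 3 - C 3⁻¹ * X 1 ^ 4) ?_ ?_ ?_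
    strDeriv_polyE13_left strDeriv_polyE13_right
    (qL := -l * m * n * (P.coeff₃ * l ^ 3 / 15 - P.coeff₈ * l ^ 8 / 5))
    (qR := -2 * P.a * l * m ^ 2) ?_ ?_ ?_ ?_ ?_
  · simp [centralCharge]; norm_num
  · simp [centralCharge]; norm_num
  · have h : (C 15⁻¹ * 15 : MvPolynomial (Fin 2) ℂ) = 1 := by
      rw [← map_ofNat C 15, ← map_mul]; norm_num
    have h' : (C 5⁻¹ : MvPolynomial (Fin 2) ℂ) = 3 * C 15⁻¹ := by
      rw [← map_ofNat C 3, ← map_mul]; norm_num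
    rw [Matrix.det_fin_two_of, h']
    linear_combination (-3 * C 15⁻¹ * X 1 ^ 2) * h
  · exact .sub (isWeightedHomogeneous_mul_X_pow (isWeightedHomogeneous_C' (by norm_num)))
      (isWeightedHomogeneous_mul_X_pow (isWeightedHomogeneous_C' (by norm_num)))
  · simp [weight_exponent]; norm_num
  · have h : (C 15⁻¹ * 15 : MvPolynomial (Fin 2) ℂ) = 1 := by
      rw [← map_ofNat C 15, ← map_mul]; norm_num
    have h' : (C 3⁻¹ : MvPolynomial (Fin 2) ℂ) = 5 * C 15⁻¹ := by
      rw [← map_ofNat C 5, ← map_mul]; norm_num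
    rw [Matrix.det_fin_two_of, h']
    linear_combination (-5 * C 15⁻¹ * X 1 ^ 4) * h
  · exact .sub (isWeightedHomogeneous_mul_X_pow (isWeightedHomogeneous_C' (by norm_num)))
      (isWeightedHomogeneous_mul_X_pow (isWeightedHomogeneous_C' (by norm_num)))
  · simp [weight_exponent]; norm_num
  · trans (-1) ^ (2 + 1).choose 2 * coeff (exponent ![8, 2])
      (C (15⁻¹ * (l * m * n * (P.coeff₃ * l ^ 3))) * (X 0 ^ 8 * X 1 ^ 2) +
        C (15⁻¹ * (l * m * n * (P.coeff₈ * l ^ 8))) * (X 0 ^ 13 * X 1 ^ 0) +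
        C (-5⁻¹ * (l * m * n * (P.coeff₃ * l ^ 3))) * (X 0 ^ 3 * X 1 ^ 4) +
        C (-5⁻¹ * (l * m * n * (P.coeff₈ * l ^ 8))) * (X 0 ^ 8 * X 1 ^ 2) :
          MvPolynomial (Fin 2) ℂ)
    · congr! 2
      simp only [C_mul, C_neg]
      ring
    · simp only [coeff_add, coeff_C_mul, coeff_X_pow_mul_X_pow]
      simp
      ring
  · trans (-1) ^ (2 + 1).choose 2 * coeff (exponent ![4, 4])
      (C (15⁻¹ * (l * m * n * (3 * P.a * P.ε * m ^ 4))) * (X 0 ^ 7 * X 1 ^ 0) +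
        C (15⁻¹ * (l * m * n * (-15 * P.a * P.α * m * n ^ 4))) * (X 0 ^ 4 * X 1 ^ 4) +
        C (-3⁻¹ * (l * m * n * (3 * P.a * P.ε * m ^ 4))) * (X 0 ^ 4 * X 1 ^ 4) +
        C (-3⁻¹ * (l * m * n * (-15 * P.a * P.α * m * n ^ 4))) * (X 0 ^ 1 * X 1 ^ 8) :
          MvPolynomial (Fin 2) ℂ)
    · congr! 2
      simp only [C_mul, C_neg]
      ring
    · simp only [coeff_add, coeff_C_mul, coeff_X_pow_mul_X_pow]
      simp
      linear_combination (P.a * l * m ^ 2) * hn + (P.a * l * m ^ 2) * hm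
  · intro h
    rw [h] at hq
    exact h0 (by linear_combination -hq)
  · intro h
    rw [h] at hq
    exact h1 (by linear_combination -hq)
  · intro h
    rw [h] at hq
    exact h2 (by linear_combination -hq)

theorem coeffE13₃_mul (s a b d A B t : ℂ) :
    coeffE13₃ a (s * b) (s * d) (s * A) (s * B) t = s * coeffE13₃ a b d A B t := by
  simp only [coeffE13₃]
  ring

theorem coeffE13₈_mul (s a b d A B t : ℂ) :
    coeffE13₈ a (s * b) (s * d) (s * A) (s * B) t = s ^ 3 * coeffE13₈ a b d A B t := by
  simp only [coeffE13₈]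
  ring

/-- The parameters are found by the substitution `b = s (a T + 3 q) / 2`, `d = s (a T - 3 q) / 2`,
`A = s (D - 3 a q) / 2`, `B = -s (D + 3 a q) / 2` with `s = (a + 3) / 3`. It turns the defining
equations into four equations for `a ^ 2, T, q, D`, whose solutions used here have `a ^ 2` a root of
an irreducible quartic polynomial and `T, q, D` in the field generated by `a ^ 2`. -/
theorem exists_E13Parameters : ∃ P : E13Parameters ℂ, P.α ≠ 0 ∧ P.ε ≠ 0 ∧ P.e ≠ 0 ∧
    8 * P.a * (3 * P.coeff₈ - P.coeff₃ * P.e) = 15 * (15 + P.a ^ 2) * P.e ^ 2 * P.ε ∧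
    P.a ^ 2 ≠ -15 ∧ P.a ^ 2 ≠ -11 ∧ P.a ^ 2 ≠ -19 := by
  obtain ⟨a, ha⟩ := IsAlgClosed.exists_root (Polynomial.X ^ 8 - 150 * Polynomial.X ^ 4 +
    360 * Polynomial.X ^ 2 + 45 : Polynomial ℂ) (by
      have : (Polynomial.X ^ 8 - 150 * Polynomial.X ^ 4 + 360 * Polynomial.X ^ 2 + 45 :
          Polynomial ℂ).degree = 8 := by
        compute_degree!
      rw [this]; norm_num)
  obtain ⟨L, hLa⟩ : ∃ L, L = a ^ 2 := ⟨_, rfl⟩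
  have hL : L ^ 4 = 150 * L ^ 2 - 360 * L - 45 := by
    simp [Polynomial.IsRoot] at ha
    rw [hLa]
    linear_combination ha
  have hne {c : ℂ} (hc : c ^ 4 - 150 * c ^ 2 + 360 * c + 45 ≠ 0) : L ≠ c := by
    rintro rfl
    exact hc (by linear_combination hL)
  obtain ⟨T, hT⟩ : ∃ T, T = 97 / 32 - 55 / 32 * L + 1 / 96 * L ^ 2 + 1 / 96 * L ^ 3 := ⟨_, rfl⟩
  obtain ⟨q, hq⟩ : ∃ q, q = 27 / 32 + 3 / 32 * L - 5 / 96 * L ^ 2 + 1 / 288 * L ^ 3 := ⟨_, rfl⟩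
  obtain ⟨D, hD⟩ : ∃ D, D = -7 / 32 - 63 / 32 * L + 89 / 96 * L ^ 2 - 7 / 96 * L ^ 3 := ⟨_, rfl⟩
  obtain ⟨t, ht⟩ : ∃ t, t = 2 / 3 * L * T + L := ⟨_, rfl⟩
  obtain ⟨f, hf⟩ : ∃ f, f = 3 / 2 * (D * q - L * q * T) := ⟨_, rfl⟩
  have h₁ : q = 1 + L / 3 + L * T / 3 := by
    rw [hq, hT]
    linear_combination -1 / 288 * hL
  have h₂ : D = L * q - 2 * L * T - 1 - 3 * L := by
    rw [hD, hq, hT]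
    linear_combination 5 / 288 * hL
  have ht' : t = -5 / 16 + 25 / 48 * L - 5 / 48 * L ^ 2 + 1 / 144 * L ^ 3 := by
    rw [ht, hT]
    linear_combination 1 / 144 * hL
  have h₃ : -D - (L * T ^ 2 - 9 * q ^ 2) / 6 + t * T = 0 := by
    rw [ht', hD, hq, hT]
    linear_combination (139 / 18432 + 31 / 18432 * L + 1 / 18432 * L ^ 2 - 1 / 55296 * L ^ 3) * hL
  have h₄ : 9 * L * q ^ 2 - D ^ 2 + t * (L * T ^ 2 - 9 * q ^ 2) + 6 * L * q * T -
    6 * D * q = 0 := by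
    rw [ht', hD, hq, hT]
    linear_combination (10033 / 147456 + 395 / 24576 * L - 5227 / 442368 * L ^ 2 +
      205 / 110592 * L ^ 3 - 89 /
      1327104 * L ^ 4 - 7 / 663552 * L ^ 5 + 1 / 1327104 * L ^ 6) * hL
  have hf' : f = 63 / 8 + 467 / 8 * L - 227 / 8 * L ^ 2 + 17 / 8 * L ^ 3 := by
    rw [hf, hD, hq, hT]
    linear_combination (-371 / 2048 + 197 / 18432 * L + 7 / 18432 * L ^ 2 - 1 / 18432 * L ^ 3) * hL
  have hf0 : f ≠ 0 := by
    intro h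
    -- The factor of `h - hf'` is the inverse of `f` in the field generated by `L`.
    refine one_ne_zero (α := ℂ) ?_
    linear_combination (119 / 64 - 241 / 384 * L + 5 / 1152 * L ^ 3) * (h - hf') -
      (1397 / 4608 - 1135 / 9216 * L + 85 / 9216 * L ^ 2) * hL
  obtain ⟨b, hb⟩ : ∃ b, b = (a * T + 3 * q) / 2 := ⟨_, rfl⟩
  obtain ⟨d, hd⟩ : ∃ d, d = (a * T - 3 * q) / 2 := ⟨_, rfl⟩
  obtain ⟨A, hA⟩ : ∃ A, A = (D - 3 * a * q) / 2 := ⟨_, rfl⟩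
  obtain ⟨B, hB⟩ : ∃ B, B = -(D + 3 * a * q) / 2 := ⟨_, rfl⟩
  -- After the substitution the left-hand side is a multiple of the equation `hL` of `L`;
  -- the cofactor below is the quotient.
  have h₅ : 12 * coeffE13₈ a b d A B t + 4 * coeffE13₃ a b d A B t * f + 5 * (15 + L) * f ^ 2 =
      0 := by
    rw [hb, hd, hA, hB, hf', ht', hD, hq, hT, coeffE13₃, coeffE13₈]
    rw [hLa] at hL ⊢
    linear_combination (108916395 / 1048576 - 1744503 / 1048576 * a +
      783203863 / 1048576 * a ^ 2 - 35646343 /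
      3145728 * a ^ 3 - 580950695 / 1572864 * a ^ 4 + 15470837 / 2359296 * a ^ 5 + 75433831
      / 2359296 * a ^ 6 - 2380261 / 2359296 * a ^ 7 - 1394669 / 1572864 * a ^ 8 + 537653 /
      14155776 * a ^ 9 + 1304275 / 14155776 * a ^ 10 + 72271 / 14155776 * a ^ 11 - 13067 /
      3538944 * a ^ 12 - 12127 / 21233664 * a ^ 13 - 9709 / 21233664 * a ^ 14 + 167 /
      21233664 * a ^ 15 + 3883 / 84934656 * a ^ 16 + 113 / 84934656 * a ^ 17 - 1 / 84934656
      * a ^ 18 - 5 / 84934656 * a ^ 19 - 1 / 14155776 * a ^ 20) * hL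
  have ha0 : a ≠ 0 := by
    rintro rfl
    exact hne (c := 0) (by norm_num) (by rw [hLa]; norm_num)
  have ha3 : a + 3 ≠ 0 := fun h => hne (c := 9) (by norm_num) (by
    rw [hLa]; linear_combination (a - 3) * h)
  have ha3' : a - 3 ≠ 0 := fun h => hne (c := 9) (by norm_num) (by
    rw [hLa]; linear_combination (a + 3) * h)
  obtain ⟨s, hs⟩ : ∃ s, s = (a + 3) / 3 := ⟨_, rfl⟩
  have hs0 : s ≠ 0 := by
    rw [hs]
    exact div_ne_zero ha3 (by norm_num)
  obtain ⟨α, hα⟩ : ∃ α, α * (a + 3) = a - 3 := ⟨(a - 3) / (a + 3), div_mul_cancel₀ _ ha3⟩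
  have hα0 : α ≠ 0 := by
    rintro rfl
    exact ha3' (by linear_combination -hα)
  have hε : s * (-1 - α) = -(2 / 3) * a := by
    rw [hs]
    linear_combination (-1 / 3) * hα
  refine ⟨{ a := a, α := α, ε := -1 - α, b := s * b, d := s * d, A := s * A, B := s * B, t := t,
            e := -(s ^ 2 * f), ε_eq := rfl, α_mul := hα, add_eq := ?_, mul_add_eq := ?_,
            mul_sub_eq := ?_, mul_sub_add_eq := ?_, mul_mul_add_eq := ?_, mul_mul_eq := ?_,
            e_eq := ?_ }, hα0, ?_, ?_, ?_, ?_, ?_, ?_⟩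
  · rw [hb, hd, ht, hLa]
    linear_combination a * T * hε
  · rw [hb, hd, ht, hs, hLa]
    rw [hLa] at h₁
    linear_combination (a * T + 3 * q) / 6 * hα - 3 * h₁
  · rw [hb, hd, hA, hB, ht, hs, hLa]
    rw [hLa] at h₁ h₂
    linear_combination (-3 * a * q - D - a * T - 3 * q) / 6 * hα + h₂ + 3 * h₁
  · rw [hb, hd, hA, hB]
    ring
  · rw [hb, hd, hA, hB]
    rw [hLa] at h₃
    linear_combination s * (a ^ 2 * T ^ 2 - 9 * q ^ 2) / 4 * hε + s * a * h₃
  · rw [hb, hd, hA, hB]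
    rw [hLa] at h₄
    linear_combination s ^ 2 / 4 * h₄
  · rw [hb, hd, hA, hB, hf, hLa]
    ring
  · exact fun h => mul_ne_zero (by norm_num) ha0 (hε.symm.trans (mul_eq_zero_of_right s h))
  · exact neg_ne_zero.mpr (mul_ne_zero (pow_ne_zero 2 hs0) hf0)
  · simp only [E13Parameters.coeff₃, E13Parameters.coeff₈, coeffE13₃_mul, coeffE13₈_mul]
    rw [hLa] at h₅
    linear_combination 2 * a * s ^ 3 * h₅ - 15 * (15 + a ^ 2) * s ^ 3 * f ^ 2 * hε
  all_goals
    rw [← hLa]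
    exact hne (by norm_num)

theorem hasTrueOrbifoldEquivalence_E13 : HasTrueOrbifoldEquivalence 3 (16 / 15)
    (X 0 ^ 5 * X 1 + X 1 ^ 3 : MvPolynomial (Fin 2) ℂ)
    (X 0 ^ 3 * X 1 + X 1 ^ 5 : MvPolynomial (Fin 2) ℂ) := by
  obtain ⟨P, hα, hε, he, hP, h0, h1, h2⟩ := exists_E13Parameters
  obtain ⟨l, hl⟩ := IsAlgClosed.exists_pow_nat_eq P.e⁻¹ (n := 5) (by norm_num)
  obtain ⟨n, hn⟩ := IsAlgClosed.exists_pow_nat_eq (-P.α⁻¹) (n := 5) (by norm_num)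
  have hn0 : n ≠ 0 := by
    rintro rfl
    simp [hα] at hn
  obtain ⟨m, hm⟩ := IsAlgClosed.exists_pow_nat_eq (-(P.ε * n)⁻¹) (n := 3) (by norm_num)
  refine hasTrueOrbifoldEquivalence_E13_of_parameters (P := P) (l := l) (m := m) (n := n)
    ?_ ?_ ?_ hP h0 h1 h2
  · rw [hl, mul_inv_cancel₀ he]
  · rw [hn, mul_neg, mul_inv_cancel₀ hα]
  · rw [hm]
    field_simp

end E13
end LandauGinzburg

theorem theorem4p1 :
    -- (1) the singularities A5 and A2 x A2
    (LandauGinzburg.OrbifoldEquivalent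
        (X 0 ^ 6 + X 1 ^ 2 : MvPolynomial (Fin 2) ℂ)
        (X 0 ^ 3 + X 1 ^ 3 : MvPolynomial (Fin 2) ℂ) ∧
      LandauGinzburg.HasTrueOrbifoldEquivalence 2 (2 / 3)
        (X 0 ^ 6 + X 1 ^ 2 : MvPolynomial (Fin 2) ℂ)
        (X 0 ^ 3 + X 1 ^ 3 : MvPolynomial (Fin 2) ℂ)) ∧
    -- (2) the singularities E13 and Z11
    (LandauGinzburg.OrbifoldEquivalent
        (X 0 ^ 5 * X 1 + X 1 ^ 3 : MvPolynomial (Fin 2) ℂ)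
        (X 0 ^ 3 * X 1 + X 1 ^ 5 : MvPolynomial (Fin 2) ℂ) ∧
      LandauGinzburg.HasTrueOrbifoldEquivalence 3 (16 / 15)
        (X 0 ^ 5 * X 1 + X 1 ^ 3 : MvPolynomial (Fin 2) ℂ)
        (X 0 ^ 3 * X 1 + X 1 ^ 5 : MvPolynomial (Fin 2) ℂ)) ∧
    -- (3) the singularities Z13 and Q11
    (LandauGinzburg.OrbifoldEquivalent
        (X 0 ^ 6 + X 0 * X 1 ^ 3 + X 2 ^ 2 : MvPolynomial (Fin 3) ℂ)
        (X 1 * X 2 ^ 3 + X 1 ^ 3 + X 0 ^ 2 * X 2 : MvPolynomial (Fin 3) ℂ) ∧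
      LandauGinzburg.HasTrueOrbifoldEquivalence 6 (10 / 9)
        (X 0 ^ 6 + X 0 * X 1 ^ 3 + X 2 ^ 2 : MvPolynomial (Fin 3) ℂ)
        (X 1 * X 2 ^ 3 + X 1 ^ 3 + X 0 ^ 2 * X 2 : MvPolynomial (Fin 3) ℂ)) ∧
    -- (4) the singularities S11 and W13
    (LandauGinzburg.OrbifoldEquivalent
        (X 0 ^ 2 * X 2 + X 1 * X 2 ^ 2 + X 1 ^ 4 : MvPolynomial (Fin 3) ℂ)
        (-X 0 ^ 2 + X 1 ^ 4 + X 1 * X 2 ^ 4 : MvPolynomial (Fin 3) ℂ) ∧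
      LandauGinzburg.HasTrueOrbifoldEquivalence 4 (9 / 8)
        (X 0 ^ 2 * X 2 + X 1 * X 2 ^ 2 + X 1 ^ 4 : MvPolynomial (Fin 3) ℂ)
        (-X 0 ^ 2 + X 1 ^ 4 + X 1 * X 2 ^ 4 : MvPolynomial (Fin 3) ℂ)) ∧
    -- (5) a chain and a loop
    (LandauGinzburg.OrbifoldEquivalent
        (X 0 ^ 10 * X 1 + X 1 ^ 3 : MvPolynomial (Fin 2) ℂ)
        (X 0 * X 1 ^ 7 + X 0 ^ 3 * X 1 : MvPolynomial (Fin 2) ℂ) ∧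
      LandauGinzburg.HasTrueOrbifoldEquivalence 3 (6 / 5)
        (X 0 ^ 10 * X 1 + X 1 ^ 3 : MvPolynomial (Fin 2) ℂ)
        (X 0 * X 1 ^ 7 + X 0 ^ 3 * X 1 : MvPolynomial (Fin 2) ℂ)) := by
  exact ⟨⟨LandauGinzburg.hasTrueOrbifoldEquivalence_A5.orbifoldEquivalent,
      LandauGinzburg.hasTrueOrbifoldEquivalence_A5⟩,
    ⟨LandauGinzburg.hasTrueOrbifoldEquivalence_E13.orbifoldEquivalent,
      LandauGinzburg.hasTrueOrbifoldEquivalence_E13⟩,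
    ⟨LandauGinzburg.hasTrueOrbifoldEquivalence_Z13.orbifoldEquivalent,
      LandauGinzburg.hasTrueOrbifoldEquivalence_Z13⟩,
    ⟨LandauGinzburg.hasTrueOrbifoldEquivalence_S11.orbifoldEquivalent,
      LandauGinzburg.hasTrueOrbifoldEquivalence_S11⟩,
    ⟨LandauGinzburg.hasTrueOrbifoldEquivalence_chainLoop.orbifoldEquivalent,
      LandauGinzburg.hasTrueOrbifoldEquivalence_chainLoop⟩⟩
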